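/- **Setting.** Let $G$ be a nilpotent group generated by a $k$-tuple $S=(s_1,\dots,s_k)$. The set $\mathfrak C(S)$ of formal commutators consists of the letters $s_i^{\pm1}$ and, inductively, of all formal brackets $[c_1,c_2]$ with $c_1,c_2\in\mathfrak C(S)$; each $c\in\mathfrak C(S)$ has an image in $G$, computed with $[a,b]=a^{-1}b^{-1}ab$, and we denote it by $c$ too. *Weights.* A weight system $\mathfrak w$ is given by vectors $w_1,\dots,w_k\in(0,\infty)\times\mathbb R^{d-1}$, $d\ge1$, through $w(s_i^{\pm1})=w_i$ and $w([c_1,c_2])=w(c_1)+w(c_2)$. Weights are ordered lexicographically, and $\bar w_1<\bar w_2<\cdots$ are the values of $w$ on $\mathfrak C(S)$. Let $G^{\mathfrak w}_j$ be the subgroup of $G$ generated by the images of all formal commutators of weight at least $\bar w_j$. Then $G^{\mathfrak w}_{j+1}$ is normal in $G$, $G^{\mathfrak w}_j/G^{\mathfrak w}_{j+1}$ is abelian, and $R^{\mathfrak w}_j$ denotes its torsion-free rank. *Weight functions.* A weight-function system $\mathfrak F$ is given by non-decreasing functions $F_i:[1,\infty)\to[1,\infty)$, $1\le i\le k$, through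 $F_{s_i^{\pm1}}=F_i$ and $F_{[c_1,c_2]}=F_{c_1}F_{c_2}$. Assume that: 1. there is $C\ge1$ such that $2F_i(r)\le F_i(Cr)$ and $F_i(2r)\le CF_i(r)$ for all $i$ and all $r\ge1$; 2. for all $c,c'\in\mathfrak C(S)$: $w(c)\le w(c')$ if and only if there is $C\ge1$ such that $F_c(r)\le CF_{c'}(r)$ for all $r\ge1$. For $j\ge 1$ let $\mathbf F_j:[1,\infty)\to[1,\infty)$ be a function with $\mathbf F_j\simeq F_c$ for every $c$ with $w(c)=\bar w_j$, where $f\simeq g$ means that there are constants $a,b,a',b'>0$ with $af(br)\le g(r)\le a'f(b'r)$ for all large $r$. *Words.* For a finite word $\omega$ in the elements of $\mathfrak C(S)$ and their formal inverses, let $\deg_c(\omega)$ be the number of occurrences of $c$ and $c^{-1}$ in $\omega$. For $r\ge1$ let $K(r)$ be the set of the elements $g\in G$ that are the image of such a word $\omega$ with $\deg_c(\omega)\le F_c(r)$ for all $c\in\mathfrak C(S)$. *Adapted tuples.* Let $\Sigma=(c_1,\dots,c_t)$ be a tuple in $\mathfrak C(S)$ with non-decreasing weights $w(c_1)\le\dots\le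 w(c_t)$, and let $m_j$ be the number of indices $i$ with $w(c_i)\le\bar w_j$ ($m_0=0$), so that $w(c_i)=\bar w_j$ if and only if $m_{j-1}<i\le m_j$. Assume that for each $j\ge 1$ the images of the $c_i$ with $m_{j-1}<i\le m_j$ generate $G^{\mathfrak w}_j$ modulo $G^{\mathfrak w}_{j+1}$, and that the $c_i$ with $m_{j-1}<i\le m_{j-1}+R^{\mathfrak w}_j$ are free (i.e. $\mathbb Z$-linearly independent) in $G^{\mathfrak w}_j/G^{\mathfrak w}_{j+1}$. **Theorem.** (i) There is a constant $C>0$, depending only on $G$, $S$, $\mathfrak F$ and the chosen functions $\mathbf F_j$ (not on $\mathfrak w$, $\Sigma$, $r$ or $g$), such that for all $r\ge1$ every $g\in K(r)$ can be written as $$g=\prod_{i=1}^tc_i^{x_i},\quad x_i\in\mathbb Z,\qquad |x_i|\le C\times\begin{cases}\mathbf F_j(r)&\text{if } m_{j-1}+1\le i\le m_{j-1}+R^{\mathfrak w}_j,\\ 1&\text{if } m_{j-1}+R^{\mathfrak w}_j+1\le i\le m_j.\end{cases}$$ (ii) There are an integer $p$, a sequence $(i_1,\dots,i_p)\in\{1,\dots,k\}^p$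 and a constant $C>0$, depending only on $G$, $S$ and $\mathfrak F$, such that for all $r\ge1$ every $g\in K(r)$ can be written as $$g=\prod_{j=1}^ps_{i_j}^{x_j},\quad x_j\in\mathbb Z,\qquad |x_j|\le CF_{i_j}(r).$$ -/

import Mathlib

open Set Filter

/-- Formal commutators over the alphabet `s_1^{±1}, …, s_k^{±1}`: the letters `s_i` (`letter i true`),
their formal inverses `s_i⁻¹` (`letter i false`), and all formal brackets `[a, b]`. -/
inductive FormalCommutator (k : ℕ) : Type
  | letter (i : Fin k) (positive : Bool) : FormalCommutator k
  | bracket (a b : FormalCommutator k) : FormalCommutator k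

namespace FormalCommutator

/-- The image in a group `G` of a formal commutator, with the convention
`[a, b] = a⁻¹ b⁻¹ a b`, when the letter `s_i` is interpreted as `S i`. -/
def eval {G : Type*} [Group G] {k : ℕ} (S : Fin k → G) : FormalCommutator k → G
  | letter i true => S i
  | letter i false => (S i)⁻¹
  | bracket a b => (eval S a)⁻¹ * (eval S b)⁻¹ * eval S a * eval S b

/-- The number of letters of a formal commutator. -/
def length {k : ℕ} : FormalCommutator k → ℕ
  | letter _ _ => 1
  | bracket a b => length a + length b

theorem finite_length_le (k n : ℕ) : {c : FormalCommutator k | c.length ≤ n}.Finite := by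
  have hpos : ∀ c : FormalCommutator k, 1 ≤ c.length := by
    intro c
    induction c with
    | letter i b => simp [length]
    | bracket a b ha hb => simp only [length]; omega
  induction n with
  | zero =>
    refine Set.Finite.subset Set.finite_empty ?_
    intro c hc
    have := hpos c
    have hc' : c.length ≤ 0 := hc
    omega
  | succ n ih =>
    refine Set.Finite.subset ((Set.finite_range
      (fun p : Fin k × Bool => (letter p.1 p.2 : FormalCommutator k))).union
      (Set.Finite.image2 bracket ih ih)) ?_
    intro c hc
    cases c with
    | letter i b => exact Or.inl ⟨(i, b), rfl⟩
    | bracket a b =>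
      refine Or.inr ⟨a, ?_, b, ?_, rfl⟩ <;>
      · have h1 := hpos a
        have h2 := hpos b
        have hc' : a.length + b.length ≤ n + 1 := hc
        show FormalCommutator.length _ ≤ n
        omega

end FormalCommutator

/-- Multidimensional weights of dimension `d + 1`: vectors with the lexicographic order. -/
abbrev WeightVector (d : ℕ) : Type := Lex (Fin (d + 1) → ℝ)

/-- The data generating a weight system on `k` letters: a weight in `(0, ∞) × ℝ^d` for each letter.
-/
structure WeightSystem (k d : ℕ) where
  letterWeight : Fin k → WeightVector d
  pos : ∀ i, 0 < ofLex (letterWeight i) 0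

namespace WeightSystem

variable {k d : ℕ}

/-- The weight of a formal commutator: the sum of the weights of its letters. -/
noncomputable def weight (w : WeightSystem k d) : FormalCommutator k → WeightVector d
  | .letter i _ => w.letterWeight i
  | .bracket a b => weight w a + weight w b

/-- Let `w̄_1 < w̄_2 < ⋯` be the increasing enumeration of all the values of the weight on formal
commutators. Then `w.index c` is the `j ≥ 1` with `w.weight c = w̄_j`, computed as the number of
weight values that are at most the weight of `c` (a finite number, by `finite_values_le`). -/
noncomputable def index (w : WeightSystem k d) (c : FormalCommutator k) : ℕ :=
  {v : WeightVector d | v ∈ range w.weight ∧ v ≤ w.weight c}.ncard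

theorem weight_zero_pos (w : WeightSystem k d) (c : FormalCommutator k) :
    0 < ofLex (w.weight c) 0 := by
  induction c with
  | letter i b => exact w.pos i
  | bracket a b ha hb => exact add_pos ha hb

theorem zero_lt_weight (w : WeightSystem k d) (c : FormalCommutator k) : 0 < w.weight c :=
  ⟨0, fun j hj => absurd hj (Fin.not_lt_zero j), w.weight_zero_pos c⟩

theorem finite_values_le (w : WeightSystem k d) (u : WeightVector d) :
    {v : WeightVector d | v ∈ range w.weight ∧ v ≤ u}.Finite := by
  obtain ⟨δ, hδ, hle⟩ : ∃ δ : ℝ, 0 < δ ∧ ∀ i, δ ≤ ofLex (w.letterWeight i) 0 := by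
    rcases isEmpty_or_nonempty (Fin k) with h | h
    · exact ⟨1, one_pos, fun i => isEmptyElim i⟩
    · obtain ⟨i, hi⟩ := Finite.exists_min (fun i => ofLex (w.letterWeight i) 0)
      exact ⟨_, w.pos i, hi⟩
  have hlen : ∀ c : FormalCommutator k, δ * c.length ≤ ofLex (w.weight c) 0 := by
    intro c
    induction c with
    | letter i b =>
      have h := hle i
      simp only [FormalCommutator.length, Nat.cast_one, mul_one]
      exact h
    | bracket a b ha hb =>
      have h := add_le_add ha hb
      rw [← mul_add] at h
      simp only [FormalCommutator.length, Nat.cast_add]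
      exact h
  refine Set.Finite.subset
    ((FormalCommutator.finite_length_le k ⌊ofLex u 0 / δ⌋₊).image w.weight) ?_
  rintro _ ⟨⟨c, rfl⟩, hc⟩
  refine ⟨c, ?_, rfl⟩
  have h0 : ofLex (w.weight c) 0 ≤ ofLex u 0 := by
    by_contra! hlt
    exact absurd hc (not_le.2 ⟨0, fun j hj => absurd hj (Fin.not_lt_zero j), hlt⟩)
  refine Nat.le_floor ?_
  rw [le_div_iff₀ hδ, mul_comm]
  exact (hlen c).trans h0

theorem index_le_index_iff (w : WeightSystem k d) (c c' : FormalCommutator k) :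
    w.index c ≤ w.index c' ↔ w.weight c ≤ w.weight c' := by
  constructor
  · intro h
    by_contra! hlt
    refine absurd h (not_le.2 (Set.ncard_lt_ncard ?_ (w.finite_values_le _)))
    refine ⟨fun v hv => ⟨hv.1, hv.2.trans hlt.le⟩, fun hsub => ?_⟩
    exact absurd (hsub ⟨⟨c, rfl⟩, le_rfl⟩).2 (not_le.2 hlt)
  · intro h
    exact Set.ncard_le_ncard (fun v hv => ⟨hv.1, hv.2.trans h⟩) (w.finite_values_le _)

theorem index_lt_index_bracket (w : WeightSystem k d) (a b : FormalCommutator k) :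
    w.index a < w.index (.bracket a b) := by
  rw [← not_le, index_le_index_iff, not_le]
  exact lt_add_of_pos_right _ (w.zero_lt_weight b)

end WeightSystem

section Filtration

variable {G : Type*} [Group G] {k d : ℕ}

/-- The subgroup `G^w_j` generated by the images of all formal commutators of weight at least
`w̄_j`. -/
def weightFiltration (S : Fin k → G) (w : WeightSystem k d) (j : ℕ) : Subgroup G :=
  Subgroup.closure (FormalCommutator.eval S '' {c | j ≤ w.index c})

theorem eval_mem_weightFiltration (S : Fin k → G) (w : WeightSystem k d) {j : ℕ}
    {c : FormalCommutator k} (hc : j ≤ w.index c) : c.eval S ∈ weightFiltration S w j :=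
  Subgroup.subset_closure ⟨c, hc, rfl⟩

theorem weightFiltration_normal (S : Fin k → G) (hS : Subgroup.closure (range S) = ⊤)
    (w : WeightSystem k d) (j : ℕ) : (weightFiltration S w j).Normal := by
  have key : ∀ (i : Fin k) (e : Bool) (h : G), h ∈ weightFiltration S w j →
      ((FormalCommutator.letter i e).eval S)⁻¹ * h * (FormalCommutator.letter i e).eval S
        ∈ weightFiltration S w j := by
    intro i e h hh
    induction hh using Subgroup.closure_induction with
    | mem x hx =>
      obtain ⟨c, hc, rfl⟩ := hx
      have hb : j ≤ w.index (.bracket c (.letter i e)) :=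
        le_trans hc (w.index_lt_index_bracket _ _).le
      have := mul_mem (eval_mem_weightFiltration S w hc) (eval_mem_weightFiltration S w hb)
      rw [FormalCommutator.eval.eq_3] at this
      convert this using 1
      group
    | one => simp [one_mem]
    | mul x y _ _ hx hy =>
      convert mul_mem hx hy using 1
      group
    | inv x _ hx =>
      convert inv_mem hx using 1
      group
  have key' : ∀ g : G, ∀ h ∈ weightFiltration S w j, g * h * g⁻¹ ∈ weightFiltration S w j := by
    intro g
    have hg : g ∈ Subgroup.closure (range S) := hS ▸ Subgroup.mem_top g
    induction hg using Subgroup.closure_induction'' with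
    | mem x hx =>
      obtain ⟨i, rfl⟩ := hx
      intro h hh
      simpa [FormalCommutator.eval] using key i false h hh
    | inv_mem x hx =>
      obtain ⟨i, rfl⟩ := hx
      intro h hh
      simpa [FormalCommutator.eval] using key i true h hh
    | one => intro h hh; simpa using hh
    | mul x y _ _ hx hy =>
      intro h hh
      convert hx _ (hy h hh) using 1
      group
  exact ⟨fun h hh g => key' g h hh⟩

/-- The quotient `G^w_j / G^w_{j+1}`. -/
abbrev GradedPiece (S : Fin k → G) (w : WeightSystem k d) (j : ℕ) : Type _ :=
  weightFiltration S w j ⧸ (weightFiltration S w (j + 1)).subgroupOf (weightFiltration S w j)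

/-- When `S` generates `G`, the quotient `G^w_j / G^w_{j+1}` is an abelian group. -/
abbrev gradedPieceCommGroup (S : Fin k → G) (hS : Subgroup.closure (range S) = ⊤)
    (w : WeightSystem k d) (j : ℕ) : CommGroup (GradedPiece S w j) :=
  haveI := weightFiltration_normal S hS w (j + 1)
  { (inferInstance : Group (GradedPiece S w j)) with
    mul_comm := by
      have key : ∀ a b : G, a ∈ weightFiltration S w j → b ∈ weightFiltration S w j →
          Commute (a : G ⧸ weightFiltration S w (j + 1)) b := by
        intro a b ha hb
        induction ha, hb using Subgroup.closure_induction₂ with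
        | mem x y hx hy =>
          obtain ⟨c, hc, rfl⟩ := hx
          obtain ⟨c', hc', rfl⟩ := hy
          have h := eval_mem_weightFiltration S w (j := j + 1) (c := .bracket c' c)
            (Nat.succ_le_of_lt (lt_of_le_of_lt hc' (w.index_lt_index_bracket c' c)))
          refine (QuotientGroup.eq.2 ?_)
          simpa [FormalCommutator.eval, mul_assoc] using h
        | one_left => exact Commute.one_left _
        | one_right => exact Commute.one_right _
        | mul_left x y z _ _ _ h1 h2 => exact Commute.mul_left h1 h2
        | mul_right x y z _ _ _ h1 h2 => exact Commute.mul_right h1 h2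
        | inv_left x y _ _ h => exact Commute.inv_left h
        | inv_right x y _ _ h => exact Commute.inv_right h
      rintro ⟨a⟩ ⟨b⟩
      have h := QuotientGroup.eq.1 (key a b a.2 b.2)
      exact QuotientGroup.eq.2 (Subgroup.mem_subgroupOf.2 (by simpa using h)) }

/-- The torsion free rank `R^w_j` of the abelian group `G^w_j / G^w_{j+1}`. -/
noncomputable def torsionFreeRank (S : Fin k → G) (hS : Subgroup.closure (range S) = ⊤)
    (w : WeightSystem k d) (j : ℕ) : ℕ :=
  letI := gradedPieceCommGroup S hS w j
  Module.finrank ℤ (Additive (GradedPiece S w j))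

/-- A family of formal commutators of weight `w̄_j` is free in `G^w_j / G^w_{j+1}`: its images are
`ℤ`-linearly independent. -/
def IsFreeFamily (S : Fin k → G) (hS : Subgroup.closure (range S) = ⊤)
    (w : WeightSystem k d) (j : ℕ) {ι : Type*} (c : ι → {c : FormalCommutator k // w.index c = j}) :
    Prop :=
  letI := gradedPieceCommGroup S hS w j
  LinearIndependent ℤ fun i =>
    (Additive.ofMul (QuotientGroup.mk
      ⟨(c i).1.eval S, eval_mem_weightFiltration S w (c i).2.ge⟩) : Additive (GradedPiece S w j))

/-- The number of entries of weight less than `w̄_j` in a tuple of formal commutators. For a tuple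
with non-decreasing weights this is the number `m_{j-1}` such that the entries of weight `w̄_j` are
those in the (1-based) positions `m_{j-1} < i ≤ m_j`. -/
noncomputable def blockStart (w : WeightSystem k d) {t : ℕ} (c : Fin t → FormalCommutator k) (j : ℕ) : ℕ :=
  (Finset.univ.filter fun i => w.index (c i) < j).card

/-- The `i`-th entry is one of the first `R^w_j` entries of weight `w̄_j = w(c_i)`, i.e. its 1-based
position is in `(m_{j-1}, m_{j-1} + R^w_j]`. Positions in `Fin t` start at `0`. -/
def InFreeBlock (S : Fin k → G) (hS : Subgroup.closure (range S) = ⊤) (w : WeightSystem k d)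
    {t : ℕ} (c : Fin t → FormalCommutator k) (i : Fin t) : Prop :=
  (i : ℕ) < blockStart w c (w.index (c i)) + torsionFreeRank S hS w (w.index (c i))

/-- Tuples `(c_1, …, c_t)` of formal commutators with non-decreasing weights such that, for each
`j ≥ 1`, the entries of weight `w̄_j` generate `G^w_j` modulo `G^w_{j+1}` and the first `R^w_j` of
these entries are free in `G^w_j / G^w_{j+1}`. -/
structure IsAdaptedTuple (S : Fin k → G) (hS : Subgroup.closure (range S) = ⊤)
    (w : WeightSystem k d) {t : ℕ} (c : Fin t → FormalCommutator k) : Prop where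
  monotone_weight : Monotone fun i => w.weight (c i)
  generates : ∀ j, 1 ≤ j →
    Subgroup.closure (FormalCommutator.eval S '' {x | ∃ i, c i = x ∧ w.index (c i) = j})
      ⊔ weightFiltration S w (j + 1) = weightFiltration S w j
  free : ∀ j, 1 ≤ j → IsFreeFamily S hS w j
    fun i : {i : Fin t // InFreeBlock S hS w c i ∧ w.index (c i) = j} => ⟨c i.1, i.2.2⟩

end Filtration

/-- The data generating a weight-function system: increasing functions
`F_i : [1, ∞) → [1, ∞)` (values outside `[1, ∞)` are irrelevant). -/
structure WeightFunctionSystem (k : ℕ) where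
  letterFun : Fin k → ℝ → ℝ
  monotoneOn : ∀ i, MonotoneOn (letterFun i) (Ici 1)
  one_le : ∀ i, ∀ r, 1 ≤ r → 1 ≤ letterFun i r

namespace WeightFunctionSystem

variable {k d : ℕ}

/-- The weight function `F_c` of a formal commutator: `F_i` for `c = s_i^{±1}`, and
`F_{[a,b]} = F_a F_b`. -/
def weightFun (F : WeightFunctionSystem k) : FormalCommutator k → ℝ → ℝ
  | .letter i _, r => F.letterFun i r
  | .bracket a b, r => weightFun F a r * weightFun F b r

/-- `2 F_i(r) ≤ F_i(C r)` and `F_i(2 r) ≤ C F_i(r)` for all `i` and all `r ≥ 1`. -/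
def IsRegular (F : WeightFunctionSystem k) : Prop :=
  ∃ C : ℝ, 1 ≤ C ∧ ∀ i, ∀ r, 1 ≤ r →
    2 * F.letterFun i r ≤ F.letterFun i (C * r) ∧ F.letterFun i (2 * r) ≤ C * F.letterFun i r

/-- Weight-function system and weight system are compatible: `w(c) ≤ w(c')` if and only if
`F_c = O(F_{c'})` on `[1, ∞)`. -/
def IsCompatible (F : WeightFunctionSystem k) (w : WeightSystem k d) : Prop :=
  ∀ c c' : FormalCommutator k, w.weight c ≤ w.weight c' ↔
    ∃ C : ℝ, 1 ≤ C ∧ ∀ r, 1 ≤ r → F.weightFun c r ≤ C * F.weightFun c' r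

end WeightFunctionSystem

/-- `f ≃ g` at infinity: `a f(b r) ≤ g(r) ≤ a' f(b' r)` for all large `r`, for some positive
constants `a, b, a', b'`. -/
def IsComparable (f g : ℝ → ℝ) : Prop :=
  ∃ a b a' b' : ℝ, 0 < a ∧ 0 < b ∧ 0 < a' ∧ 0 < b' ∧
    ∀ᶠ r in atTop, a * f (b * r) ≤ g r ∧ g r ≤ a' * f (b' * r)

/-- A word over the formal commutators and their formal inverses: `(c, true)` stands for the letter
`c` and `(c, false)` for the letter `c⁻¹`. -/
abbrev CommutatorWord (k : ℕ) : Type := List (FormalCommutator k × Bool)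

namespace CommutatorWord

variable {k : ℕ}

/-- The image of a word in the group `G`. -/
def eval {G : Type*} [Group G] (S : Fin k → G) (ω : CommutatorWord k) : G :=
  (ω.map fun p => if p.2 then p.1.eval S else (p.1.eval S)⁻¹).prod

open Classical in
/-- The number `deg_c(ω)` of occurrences of `c` and `c⁻¹` in the word `ω`. -/
noncomputable def deg (c : FormalCommutator k) (ω : CommutatorWord k) : ℕ :=
  (ω.map Prod.fst).count c

end CommutatorWord

/-- `g` can be expressed as a word `ω` over the formal commutators with `deg_c(ω) ≤ F_c(r)` for
every formal commutator `c`. -/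
def IsExpressible {G : Type*} [Group G] {k : ℕ} (S : Fin k → G) (F : WeightFunctionSystem k)
    (r : ℝ) (g : G) : Prop :=
  ∃ ω : CommutatorWord k, CommutatorWord.eval S ω = g ∧
    ∀ c : FormalCommutator k, (CommutatorWord.deg c ω : ℝ) ≤ F.weightFun c r

/-! Both parts rest on a collection process in which letters are counted. Conjugating a word by a
word `X` only inserts iterated brackets, and the letters `[e, z]` so created number at most (number
of `z` in `X`) times (final number of `e`). Since `F_[e,z] = F_e F_z`, induction on the length of
commutators shows that a word with at most `A F_c(r)` letters `c`, for every `c`, keeps a bound of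
this form after rearrangement, with a new constant that does not depend on `r`
(`IsBounded.conjWord`). Nilpotency gives an `n` such that all commutators longer than `n` are
trivial in `G`, so only finitely many letters have to be collected and the constants are enlarged
boundedly often.

For (ii), commutators are removed in order of increasing length. A collected power `[a,b]^q` with `q
≤ A F_a(r) F_b(r)` is split by dividing `q` by `v = ⌊F_b(r)⌋`. Up to longer commutators `[a,b]^(uv)`
equals `[a^u, b^v]`, and by induction `a^u` and `b^v` are products of letter powers up to longer
commutators (`isFactorable_pow_mul`, `isFactorable_boundedPowers`).

For (i), commutators are removed in order of increasing index `j`. The letters of index `j`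
contribute an integer combination in the abelian group `G_j / G_{j+1}`, which is rewritten in the
classes of the adapted tuple. The free block spans a subgroup of finite index, so division with
remainder puts the large coefficients on the free block and leaves only bounded ones elsewhere
(`exists_bounded_coeff`). The quotient of the word by the resulting product of powers lies in
`G_{j+1}`, but it is still spelled with letters of index `j`. The main difficulty is to respell it
with letters of larger index without losing the bounds (`mem_wordSet_succ`): its letter counts form
an integer relation, hence a combination of finitely many basic relations with linearly bounded
coefficients. Each basic relation has a fixed spelling one level up. Once these are split off, every
letter of index `j` occurs as often as its inverse and can be cancelled by collection
(`mem_wordSet_of_net_eq_zero`).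

The constants are uniform because the index, and with it the filtration, is determined by the weight
functions (`index_eq_of_isCompatible`), and because an adapted tuple enters the linear algebra only
through the sets of values of its two parts, which range over finitely many possibilities. -/

namespace FormalCommutator

/-! ### Words in formal commutators and the collection process -/

variable {G : Type*} [Group G] {k : ℕ}

noncomputable instance : DecidableEq (FormalCommutator k) := Classical.decEq _

/-- The formal inverse of a formal commutator. -/
def finv : FormalCommutator k → FormalCommutator k
  | letter i b => letter i (!b)
  | bracket a b => bracket b a

@[simp] theorem finv_finv (c : FormalCommutator k) : c.finv.finv = c := by
  cases c <;> simp [finv]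

@[simp] theorem eval_finv (S : Fin k → G) (c : FormalCommutator k) :
    c.finv.eval S = (c.eval S)⁻¹ := by
  rcases c with ⟨i, b⟩ | ⟨a, b⟩
  · cases b <;> simp [finv, eval]
  · simp [finv, eval, mul_assoc]

@[simp] theorem length_finv (c : FormalCommutator k) : c.finv.length = c.length := by
  cases c <;> simp [finv, length, add_comm]

theorem one_le_length (c : FormalCommutator k) : 1 ≤ c.length := by
  induction c with
  | letter i b => simp [length]
  | bracket a b ha hb => simp only [length]; omega

theorem finv_eq_iff {c d : FormalCommutator k} : c.finv = d ↔ c = d.finv :=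
  ⟨fun h => by rw [← h, finv_finv], fun h => by rw [h, finv_finv]⟩

/-- The value in `G` of a list of formal commutators. -/
def evalList (S : Fin k → G) (L : List (FormalCommutator k)) : G := (L.map (eval S)).prod

@[simp] theorem evalList_nil (S : Fin k → G) : evalList S [] = 1 := rfl

@[simp] theorem evalList_cons (S : Fin k → G) (c : FormalCommutator k) (L) :
    evalList S (c :: L) = c.eval S * evalList S L := by simp [evalList]

@[simp] theorem evalList_append (S : Fin k → G) (L L' : List (FormalCommutator k)) :
    evalList S (L ++ L') = evalList S L * evalList S L' := by simp [evalList]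

@[simp] theorem evalList_replicate (S : Fin k → G) (q : ℕ) (c : FormalCommutator k) :
    evalList S (List.replicate q c) = c.eval S ^ q := by simp [evalList]

/-- The inverse word. -/
def wordInv (L : List (FormalCommutator k)) : List (FormalCommutator k) := (L.map finv).reverse

theorem evalList_wordInv (S : Fin k → G) (L : List (FormalCommutator k)) :
    evalList S (wordInv L) = (evalList S L)⁻¹ := by
  induction L with
  | nil => simp [wordInv]
  | cons c L ih =>
    have : wordInv (c :: L) = wordInv L ++ [c.finv] := by simp [wordInv]
    simp [this, ih]

theorem finv_injective : Function.Injective (finv : FormalCommutator k → FormalCommutator k) :=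
  fun a b h => by rw [← finv_finv a, h, finv_finv]

theorem count_wordInv (c : FormalCommutator k) (L : List (FormalCommutator k)) :
    (wordInv L).count c = L.count c.finv := by
  rw [wordInv, List.count_reverse, ← finv_finv c, List.count_map_of_injective _ _ finv_injective,
    finv_finv]

theorem mem_wordInv {c : FormalCommutator k} {L : List (FormalCommutator k)} :
    c ∈ wordInv L ↔ c.finv ∈ L := by
  simp only [wordInv, List.mem_reverse, List.mem_map]
  constructor
  · rintro ⟨a, ha, rfl⟩; simpa
  · exact fun h => ⟨_, h, finv_finv c⟩

/-- The word obtained from `Y` by conjugation with a letter. -/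
def conjLetter (x : FormalCommutator k) (Y : List (FormalCommutator k)) :
    List (FormalCommutator k) := Y.flatMap fun y => [y, bracket y x]

/-- A word for the conjugate `Y ^ X` of words. -/
def conjWord : List (FormalCommutator k) → List (FormalCommutator k) → List (FormalCommutator k)
  | [], Y => Y
  | x :: X, Y => conjWord X (conjLetter x Y)

theorem evalList_conjLetter (S : Fin k → G) (x : FormalCommutator k) (Y) :
    evalList S (conjLetter x Y) = (x.eval S)⁻¹ * evalList S Y * x.eval S := by
  induction Y with
  | nil => simp [conjLetter]
  | cons y Y ih =>
    have : conjLetter x (y :: Y) = [y, bracket y x] ++ conjLetter x Y := by simp [conjLetter]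
    rw [this, evalList_append, ih]
    simp [eval]
    group

theorem evalList_conjWord (S : Fin k → G) (X Y : List (FormalCommutator k)) :
    evalList S (conjWord X Y) = (evalList S X)⁻¹ * evalList S Y * evalList S X := by
  induction X generalizing Y with
  | nil => simp [conjWord]
  | cons x X ih =>
    simp [conjWord, ih, evalList_conjLetter, mul_assoc]

theorem conjLetter_append (x : FormalCommutator k) (Y Y') :
    conjLetter x (Y ++ Y') = conjLetter x Y ++ conjLetter x Y' := by simp [conjLetter]

theorem conjWord_append (X Y Y' : List (FormalCommutator k)) :
    conjWord X (Y ++ Y') = conjWord X Y ++ conjWord X Y' := by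
  induction X generalizing Y Y' with
  | nil => rfl
  | cons x X ih => simp [conjWord, conjLetter_append, ih]

theorem sublist_conjLetter (x : FormalCommutator k) (Y : List (FormalCommutator k)) : Y.Sublist (conjLetter x Y) := by
  induction Y with
  | nil => simp
  | cons y Y ih =>
    have : conjLetter x (y :: Y) = y :: bracket y x :: conjLetter x Y := by simp [conjLetter]
    rw [this]
    exact (ih.cons _).cons_cons _

theorem conjLetter_sublist (x : FormalCommutator k) {Y Y'} (h : Y.Sublist Y') :
    (conjLetter x Y).Sublist (conjLetter x Y') := h.flatMap _

theorem conjWord_sublist_right (X : List (FormalCommutator k)) {Y Y'} (h : Y.Sublist Y') :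
    (conjWord X Y).Sublist (conjWord X Y') := by
  induction X generalizing Y Y' with
  | nil => exact h
  | cons x X ih => exact ih (conjLetter_sublist x h)

theorem sublist_conjWord (X Y : List (FormalCommutator k)) : Y.Sublist (conjWord X Y) := by
  induction X generalizing Y with
  | nil => exact List.Sublist.refl _
  | cons x X ih => exact (sublist_conjLetter x Y).trans (ih _)

theorem conjWord_sublist_left {X X' : List (FormalCommutator k)} (h : X.Sublist X') (Y) :
    (conjWord X Y).Sublist (conjWord X' Y) := by
  induction h generalizing Y with
  | slnil => exact List.Sublist.refl _
  | cons x _ ih => exact (conjWord_sublist_right _ (sublist_conjLetter x Y)).trans (ih _)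
  | cons_cons x _ ih => exact ih _

theorem count_letter_conjLetter (x : FormalCommutator k) (i b) (Y) :
    (conjLetter x Y).count (letter i b) = Y.count (letter i b) := by
  induction Y with
  | nil => simp [conjLetter]
  | cons y Y ih =>
    have : conjLetter x (y :: Y) = y :: bracket y x :: conjLetter x Y := by simp [conjLetter]
    simp [this, List.count_cons, ih]

theorem count_bracket_conjLetter (x e z : FormalCommutator k) (Y) :
    (conjLetter x Y).count (bracket e z) =
      Y.count (bracket e z) + if x = z then Y.count e else 0 := by
  induction Y with
  | nil => simp [conjLetter]
  | cons y Y ih =>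
    have : conjLetter x (y :: Y) = y :: bracket y x :: conjLetter x Y := by simp [conjLetter]
    rw [this, List.count_cons, List.count_cons, List.count_cons, List.count_cons, ih]
    by_cases hx : x = z <;> by_cases hy : y = e <;> simp [hx, hy] <;> omega

theorem count_letter_conjWord (X Y : List (FormalCommutator k)) (i b) :
    (conjWord X Y).count (letter i b) = Y.count (letter i b) := by
  induction X generalizing Y with
  | nil => rfl
  | cons x X ih => rw [conjWord, ih, count_letter_conjLetter]

/-- Each letter `z` of `X` inserts one `[e, z]` for every `e` present at that moment. Letters are
never removed, so this number is at most the final number of `e`. -/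
theorem count_bracket_conjWord_le (X Y : List (FormalCommutator k)) (e z) :
    (conjWord X Y).count (bracket e z) ≤
      Y.count (bracket e z) + X.count z * (conjWord X Y).count e := by
  induction X generalizing Y with
  | nil => simp [conjWord]
  | cons x X ih =>
    have h1 := ih (conjLetter x Y)
    rw [count_bracket_conjLetter] at h1
    have h2 : Y.count e ≤ (conjWord (x :: X) Y).count e := (sublist_conjWord _ _).count_le _
    rw [conjWord] at h2 ⊢
    rw [List.count_cons]
    by_cases hx : x = z
    · simp only [hx, if_true, beq_self_eq_true] at h1 h2 ⊢
      rw [add_mul, one_mul]; omega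
    · simpa [hx] using h1

theorem forall_mem_conjWord {P : FormalCommutator k → Prop} {X Y : List (FormalCommutator k)}
    (hY : ∀ y ∈ Y, P y) (h : ∀ y, P y → ∀ x ∈ X, P (bracket y x)) : ∀ z ∈ conjWord X Y, P z := by
  induction X generalizing Y with
  | nil => exact hY
  | cons x X ih =>
    refine ih (fun z hz => ?_) fun y hy x hx => h y hy x (List.mem_cons_of_mem _ hx)
    simp only [conjLetter, List.mem_flatMap, List.mem_cons, List.not_mem_nil, or_false] at hz
    obtain ⟨y, hy, rfl | rfl⟩ := hz
    · exact hY _ hy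
    · exact h y (hY y hy) x (List.mem_cons_self)

/-- All inserted letters fail `q`, so conjugation does not affect the subword selected by `q`. This
gives exact control of the letters of lowest length or index. -/
theorem filter_conjWord {P : FormalCommutator k → Prop} (q : FormalCommutator k → Bool)
    {X Y : List (FormalCommutator k)}
    (hY : ∀ y ∈ Y, P y) (h : ∀ y, P y → ∀ x ∈ X, P (bracket y x))
    (hq : ∀ y, P y → ∀ x ∈ X, q (bracket y x) = false) :
    (conjWord X Y).filter q = Y.filter q := by
  induction X generalizing Y with
  | nil => rfl
  | cons x X ih =>
    rw [conjWord, ih]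
    · clear ih
      induction Y with
      | nil => simp [conjLetter]
      | cons y Y ihY =>
        have : conjLetter x (y :: Y) = [y] ++ [bracket y x] ++ conjLetter x Y := by
          simp [conjLetter]
        rw [this, List.filter_append, ihY fun y hy => hY y (List.mem_cons_of_mem _ hy)]
        have := hq y (hY y List.mem_cons_self) x List.mem_cons_self
        simp [List.filter_cons, this]
        split <;> simp
    · have := forall_mem_conjWord (X := [x]) hY fun y hy x' hx' => h y hy x' (by simp at hx'; simp [hx'])
      exact this
    · exact fun y hy x hx => h y hy x (List.mem_cons_of_mem _ hx)
    · exact fun y hy x hx => hq y hy x (List.mem_cons_of_mem _ hx)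

/-- A word for the commutator of a letter and a word. -/
def commLetter (y : FormalCommutator k) : List (FormalCommutator k) → List (FormalCommutator k)
  | [] => []
  | x :: X => commLetter y X ++ conjWord X [bracket y x]

/-- A word for the commutator of two words. -/
def commWord : List (FormalCommutator k) → List (FormalCommutator k) → List (FormalCommutator k)
  | [], _ => []
  | y :: Y, X => conjWord Y (commLetter y X) ++ commWord Y X

theorem conjWord_singleton (y : FormalCommutator k) (X) :
    conjWord X [y] = y :: commLetter y X := by
  induction X with
  | nil => rfl
  | cons x X ih =>
    have : conjLetter x [y] = [y] ++ [bracket y x] := by simp [conjLetter]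
    rw [conjWord, this, conjWord_append, ih, commLetter, List.cons_append]

theorem evalList_commLetter (S : Fin k → G) (y : FormalCommutator k) (X) :
    evalList S (commLetter y X) =
      (y.eval S)⁻¹ * (evalList S X)⁻¹ * y.eval S * evalList S X := by
  have h := evalList_conjWord S X [y]
  rw [conjWord_singleton, evalList_cons, ← eq_inv_mul_iff_mul_eq] at h
  rw [h]; simp [mul_assoc]

theorem evalList_commWord (S : Fin k → G) (Y X : List (FormalCommutator k)) :
    evalList S (commWord Y X) =
      (evalList S Y)⁻¹ * (evalList S X)⁻¹ * evalList S Y * evalList S X := by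
  induction Y with
  | nil => simp [commWord]
  | cons y Y ih =>
    simp only [commWord, evalList_append, ih, evalList_conjWord, evalList_commLetter,
      evalList_cons]
    group

/-- Multiplicities in a commutator of words need no separate count: they are dominated by those in
an iterated conjugate. -/
theorem commWord_sublist (Y X : List (FormalCommutator k)) :
    (commWord Y X).Sublist (conjWord Y (conjWord X Y)) := by
  induction Y with
  | nil => exact List.nil_sublist _
  | cons y Y ih =>
    refine List.Sublist.trans ?_ (conjWord_sublist_left (List.sublist_cons_self y Y) _)
    have : conjWord X (y :: Y) = (y :: commLetter y X) ++ conjWord X Y := by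
      rw [← conjWord_singleton, ← conjWord_append]; rfl
    rw [this, conjWord_append]
    exact (conjWord_sublist_right _ (List.sublist_cons_self _ _)).append ih

theorem forall_mem_commLetter {R : FormalCommutator k → Prop} {y : FormalCommutator k}
    {X : List (FormalCommutator k)} (h0 : ∀ x ∈ X, R (bracket y x))
    (h : ∀ z, R z → ∀ x ∈ X, R (bracket z x)) : ∀ z ∈ commLetter y X, R z := by
  induction X with
  | nil => simp [commLetter]
  | cons x X ih =>
    have h' : ∀ z, R z → ∀ x ∈ X, R (bracket z x) :=
      fun z hz x hx => h z hz x (List.mem_cons_of_mem _ hx)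
    intro z hz
    rcases List.mem_append.1 hz with hz | hz
    · exact ih (fun x hx => h0 x (List.mem_cons_of_mem _ hx)) h' z hz
    · exact forall_mem_conjWord (by simpa using h0 x List.mem_cons_self) h' z hz

theorem forall_mem_commWord {R : FormalCommutator k → Prop} {Y X : List (FormalCommutator k)}
    (h0 : ∀ y ∈ Y, ∀ x ∈ X, R (bracket y x)) (hX : ∀ z, R z → ∀ x ∈ X, R (bracket z x))
    (hY : ∀ z, R z → ∀ y ∈ Y, R (bracket z y)) : ∀ z ∈ commWord Y X, R z := by
  induction Y with
  | nil => simp [commWord]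
  | cons y Y ih =>
    have hY' : ∀ z, R z → ∀ y ∈ Y, R (bracket z y) :=
      fun z hz x hx => hY z hz x (List.mem_cons_of_mem _ hx)
    intro z hz
    rcases List.mem_append.1 hz with hz | hz
    · exact forall_mem_conjWord (forall_mem_commLetter (h0 y List.mem_cons_self) hX) hY' z hz
    · exact ih (fun y hy => h0 y (List.mem_cons_of_mem _ hy)) hY' z hz

/-- The word left over when the letters satisfying `p` are moved to the front. -/
def collectRest (p : FormalCommutator k → Bool) :
    List (FormalCommutator k) → List (FormalCommutator k)
  | [] => []
  | c :: L => if p c then collectRest p L else conjWord (L.filter p) [c] ++ collectRest p L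

theorem evalList_collect (S : Fin k → G) (p : FormalCommutator k → Bool) (L) :
    evalList S L = evalList S (L.filter p) * evalList S (collectRest p L) := by
  induction L with
  | nil => simp [collectRest]
  | cons c L ih =>
    rw [evalList_cons, ih, collectRest, List.filter_cons]
    split
    · simp [mul_assoc]
    · simp [evalList_conjWord, mul_assoc]

/-- Reduces the multiplicities of the remainder of a collection to those of a conjugate. -/
theorem collectRest_sublist (p : FormalCommutator k → Bool) (L) :
    (collectRest p L).Sublist (conjWord L L) := by
  have : (collectRest p L).Sublist (conjWord (L.filter p) L) := by
    induction L with
    | nil => exact List.nil_sublist _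
    | cons c L ih =>
      have h1 : c :: L = [c] ++ L := rfl
      rw [collectRest, h1, conjWord_append]
      split
      · rename_i hc
        refine (ih.trans (conjWord_sublist_left ?_ _)).trans (List.sublist_append_right _ _)
        exact List.Sublist.filter _ (List.sublist_append_right _ _)
      · rename_i hc
        simpa [List.filter_cons, hc] using ih
  exact this.trans (conjWord_sublist_left List.filter_sublist _)

theorem forall_mem_collectRest {P Q : FormalCommutator k → Prop} {p : FormalCommutator k → Bool} {L}
    (h0 : ∀ c ∈ L, p c = false → P c) (hQ : ∀ c ∈ L, p c → Q c)
    (h : ∀ y, P y → ∀ x, Q x → P (bracket y x)) : ∀ c ∈ collectRest p L, P c := by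
  induction L with
  | nil => simp [collectRest]
  | cons c L ih =>
    have ih := ih (fun c hc => h0 c (List.mem_cons_of_mem _ hc))
      (fun c hc => hQ c (List.mem_cons_of_mem _ hc))
    rw [collectRest]
    split
    · exact ih
    · rename_i hc
      intro z hz
      rcases List.mem_append.1 hz with hz | hz
      · refine forall_mem_conjWord (by simpa using h0 c List.mem_cons_self (by simpa using hc))
          (fun y hy x hx => h y hy x ?_) z hz
        rw [List.mem_filter] at hx
        exact hQ x (List.mem_cons_of_mem _ hx.1) hx.2
      · exact ih z hz

theorem filter_collectRest {P : FormalCommutator k → Prop} {p : FormalCommutator k → Bool} {L}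
    (q : FormalCommutator k → Bool) (h0 : ∀ c ∈ L, P c)
    (h : ∀ y, P y → ∀ x, P x → P (bracket y x) ∧ q (bracket y x) = false) :
    (collectRest p L).filter q = L.filter fun c => q c && !p c := by
  induction L with
  | nil => simp [collectRest]
  | cons c L ih =>
    have ih := ih (fun c hc => h0 c (List.mem_cons_of_mem _ hc))
    have hL : ∀ x ∈ L.filter p, P x := fun x hx =>
      h0 x (List.mem_cons_of_mem _ (List.mem_filter.1 hx).1)
    rw [collectRest, List.filter_cons]
    split
    · rename_i hc; simp [hc, ih]
    · rename_i hc
      rw [List.filter_append, ih, filter_conjWord (P := P) q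
        (by simpa using h0 c List.mem_cons_self)
        (fun y hy x hx => (h y hy x (hL x hx)).1) (fun y hy x hx => (h y hy x (hL x hx)).2)]
      cases hq : q c <;> simp [hc, hq]

end FormalCommutator

/-! ### Multiplicity bounds that survive collection -/

namespace FormalCommutator

variable {G : Type*} [Group G] {k : ℕ}

/-- Positive weights of formal commutators that multiply under brackets. -/
structure IsMultiplicativeWeight (φ : FormalCommutator k → ℝ) : Prop where
  one_le : ∀ c, 1 ≤ φ c
  bracket : ∀ a b, φ (bracket a b) = φ a * φ b
  finv : ∀ c, φ c.finv = φ c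

theorem isMultiplicativeWeight_weightFun (F : WeightFunctionSystem k) {r : ℝ} (hr : 1 ≤ r) :
    IsMultiplicativeWeight fun c => F.weightFun c r where
  one_le c := by
    induction c with
    | letter i b => exact F.one_le i r hr
    | bracket a b ha hb => exact one_le_mul_of_one_le_of_one_le ha hb
  bracket a b := rfl
  finv c := by
    cases c
    · rfl
    · exact mul_comm _ _

/-- Each formal commutator `c` of length at most `n` occurs at most `A * φ c` times. -/
def IsBounded (n : ℕ) (φ : FormalCommutator k → ℝ) (A : ℝ) (L : List (FormalCommutator k)) : Prop :=
  ∀ c, c.length ≤ n → (L.count c : ℝ) ≤ A * φ c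

section Bounded

variable {n : ℕ} {φ : FormalCommutator k → ℝ} {A B : ℝ} {L L' X Y : List (FormalCommutator k)}

theorem IsBounded.mono (hφ : IsMultiplicativeWeight φ) (h : IsBounded n φ A L) (hAB : A ≤ B) :
    IsBounded n φ B L := fun c hc =>
  (h c hc).trans (mul_le_mul_of_nonneg_right hAB (zero_le_one.trans (hφ.one_le c)))

theorem IsBounded.sublist (h : IsBounded n φ A L) (hL : L'.Sublist L) : IsBounded n φ A L' :=
  fun c hc => (Nat.cast_le.2 (hL.count_le c)).trans (h c hc)

theorem IsBounded.append (h : IsBounded n φ A L) (h' : IsBounded n φ B L') :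
    IsBounded n φ (A + B) (L ++ L') := fun c hc => by
  rw [List.count_append, Nat.cast_add, add_mul]
  exact add_le_add (h c hc) (h' c hc)

theorem IsBounded.wordInv (hφ : IsMultiplicativeWeight φ) (h : IsBounded n φ A L) :
    IsBounded n φ A (wordInv L) := fun c hc => by
  rw [count_wordInv, ← hφ.finv]
  exact h _ (by simpa)

/-- Induction on the length of the counted letter: for `[e, z]` the product of the bounds for `z` in
`X` and for `e` in the conjugate is a multiple of `φ e * φ z = φ [e, z]`. Each step costs a factor
`1 + A` at most, whatever `φ` is, and letters longer than `n` are not counted. -/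
theorem IsBounded.conjWord (hφ : IsMultiplicativeWeight φ) (hA : 0 ≤ A) (hB : 0 ≤ B)
    (hX : IsBounded n φ A X) (hY : IsBounded n φ B Y) :
    IsBounded n φ (B * (1 + A) ^ n) (conjWord X Y) := by
  have hpow : ∀ m : ℕ, 1 ≤ (1 + A) ^ m := fun m => one_le_pow₀ (by linarith)
  have key : ∀ c : FormalCommutator k, c.length ≤ n →
      ((FormalCommutator.conjWord X Y).count c : ℝ) ≤ B * (1 + A) ^ c.length * φ c := by
    intro c
    induction c with
    | letter i b =>
      intro hc
      rw [count_letter_conjWord]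
      refine (hY _ hc).trans (mul_le_mul_of_nonneg_right ?_ (zero_le_one.trans (hφ.one_le _)))
      exact le_mul_of_one_le_right hB (hpow _)
    | bracket e z ihe _ =>
      intro hc
      simp only [length] at hc ⊢
      have hz := one_le_length z
      have h1 := ihe (by omega)
      have h2 := hX z (by omega)
      have h3 : ((FormalCommutator.conjWord X Y).count (.bracket e z) : ℝ) ≤
          Y.count (.bracket e z) + X.count z * (FormalCommutator.conjWord X Y).count e := by
        exact_mod_cast count_bracket_conjWord_le X Y e z
      have h4 := hY (.bracket e z) hc
      have he := zero_le_one.trans (hφ.one_le e)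
      have hz0 := zero_le_one.trans (hφ.one_le z)
      have h5 : (X.count z : ℝ) * (FormalCommutator.conjWord X Y).count e ≤
          (A * φ z) * (B * (1 + A) ^ e.length * φ e) :=
        mul_le_mul h2 h1 (by positivity) (by positivity)
      rw [hφ.bracket] at h4 ⊢
      have h6 : (1 + A) ^ e.length * (1 + A) ≤ (1 + A) ^ (e.length + z.length) := by
        rw [← pow_succ]
        exact pow_le_pow_right₀ (by linarith) (by omega)
      have h7 : 1 + A * (1 + A) ^ e.length ≤ (1 + A) ^ (e.length + z.length) := by
        have := hpow e.length
        nlinarith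
      calc _ ≤ B * (φ e * φ z) + (A * φ z) * (B * (1 + A) ^ e.length * φ e) := by linarith
        _ = (B * (φ e * φ z)) * (1 + A * (1 + A) ^ e.length) := by ring
        _ ≤ (B * (φ e * φ z)) * (1 + A) ^ (e.length + z.length) :=
          mul_le_mul_of_nonneg_left h7 (by positivity)
        _ = _ := by ring
  intro c hc
  refine (key c hc).trans (mul_le_mul_of_nonneg_right ?_ (zero_le_one.trans (hφ.one_le _)))
  exact mul_le_mul_of_nonneg_left (pow_le_pow_right₀ (by linarith) hc) hB

end Bounded

/-- The elements represented by bounded words in the formal commutators satisfying `P`. -/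
def wordSet (S : Fin k → G) (n : ℕ) (φ : FormalCommutator k → ℝ) (P : FormalCommutator k → Prop)
    (A : ℝ) : Set G :=
  {g | ∃ L : List (FormalCommutator k), (∀ c ∈ L, P c) ∧ IsBounded n φ A L ∧ evalList S L = g}

section WordSet

variable {S : Fin k → G} {n : ℕ} {φ : FormalCommutator k → ℝ} {P Q R : FormalCommutator k → Prop}
  {A B : ℝ} {g h : G}

theorem wordSet_mono (hφ : IsMultiplicativeWeight φ) (hPQ : ∀ c, P c → Q c) (hAB : A ≤ B)
    (hg : g ∈ wordSet S n φ P A) : g ∈ wordSet S n φ Q B := by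
  obtain ⟨L, h1, h2, h3⟩ := hg
  exact ⟨L, fun c hc => hPQ c (h1 c hc), h2.mono hφ hAB, h3⟩

theorem one_mem_wordSet (hφ : IsMultiplicativeWeight φ) (hA : 0 ≤ A) : 1 ∈ wordSet S n φ P A :=
  ⟨[], by simp, fun c _ => by
    simpa using mul_nonneg hA (zero_le_one.trans (hφ.one_le c)), rfl⟩

theorem mul_mem_wordSet (hg : g ∈ wordSet S n φ P A) (hh : h ∈ wordSet S n φ P B) :
    g * h ∈ wordSet S n φ P (A + B) := by
  obtain ⟨L, h1, h2, rfl⟩ := hg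
  obtain ⟨L', h1', h2', rfl⟩ := hh
  refine ⟨L ++ L', ?_, h2.append h2', evalList_append _ _ _⟩
  simp only [List.mem_append]
  rintro c (hc | hc)
  exacts [h1 c hc, h1' c hc]

theorem inv_mem_wordSet (hφ : IsMultiplicativeWeight φ) (hP : ∀ c, P c → P c.finv)
    (hg : g ∈ wordSet S n φ P A) : g⁻¹ ∈ wordSet S n φ P A := by
  obtain ⟨L, h1, h2, rfl⟩ := hg
  refine ⟨wordInv L, fun c hc => ?_, h2.wordInv hφ, evalList_wordInv _ _⟩
  have := hP _ (h1 _ (mem_wordInv.1 hc))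
  simpa using this

theorem conj_mem_wordSet (hφ : IsMultiplicativeWeight φ) (hA : 0 ≤ A) (hB : 0 ≤ B)
    (hPQ : ∀ y, P y → ∀ x, Q x → P (bracket y x))
    (hg : g ∈ wordSet S n φ P B) (hh : h ∈ wordSet S n φ Q A) :
    h⁻¹ * g * h ∈ wordSet S n φ P (B * (1 + A) ^ n) := by
  obtain ⟨L, h1, h2, rfl⟩ := hg
  obtain ⟨L', h1', h2', rfl⟩ := hh
  exact ⟨conjWord L' L, forall_mem_conjWord h1 fun y hy x hx => hPQ y hy x (h1' x hx),
    IsBounded.conjWord hφ hA hB h2' h2, evalList_conjWord _ _ _⟩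

theorem comm_mem_wordSet (hφ : IsMultiplicativeWeight φ) (hA : 0 ≤ A) (hB : 0 ≤ B)
    (h0 : ∀ y, P y → ∀ x, Q x → R (bracket y x)) (hRP : ∀ z, R z → ∀ y, P y → R (bracket z y))
    (hRQ : ∀ z, R z → ∀ x, Q x → R (bracket z x))
    (hg : g ∈ wordSet S n φ P A) (hh : h ∈ wordSet S n φ Q B) :
    g⁻¹ * h⁻¹ * g * h ∈ wordSet S n φ R (A * (1 + B) ^ n * (1 + A) ^ n) := by
  obtain ⟨L, h1, h2, rfl⟩ := hg
  obtain ⟨L', h1', h2', rfl⟩ := hh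
  refine ⟨commWord L L', ?_, ?_, evalList_commWord _ _ _⟩
  · exact forall_mem_commWord (fun y hy x hx => h0 y (h1 y hy) x (h1' x hx))
      (fun z hz x hx => hRQ z hz x (h1' x hx)) fun z hz y hy => hRP z hz y (h1 y hy)
  · refine IsBounded.sublist ?_ (commWord_sublist L L')
    exact IsBounded.conjWord hφ hA (by positivity) h2 (IsBounded.conjWord hφ hB hA h2' h2)

theorem pow_mem_wordSet (hφ : IsMultiplicativeWeight φ) {c : FormalCommutator k} (hP : P c) {q : ℕ}
    (hA : 0 ≤ A) (hq : (q : ℝ) ≤ A * φ c) : c.eval S ^ q ∈ wordSet S n φ P A := by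
  refine ⟨List.replicate q c, fun d hd => ?_, fun d _ => ?_, evalList_replicate _ _ _⟩
  · rwa [List.eq_of_mem_replicate hd]
  · rw [List.count_replicate]
    split
    · rename_i h; rw [← eq_of_beq h]; exact hq
    · simpa using mul_nonneg hA (zero_le_one.trans (hφ.one_le d))

/-- Letters that are trivial in `G` may be dropped. -/
theorem wordSet_and_length_le (hn : ∀ c : FormalCommutator k, n < c.length → c.eval S = 1)
    (hg : g ∈ wordSet S n φ P A) : g ∈ wordSet S n φ (fun c => P c ∧ c.length ≤ n) A := by
  obtain ⟨L, h1, h2, rfl⟩ := hg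
  refine ⟨L.filter fun c => c.length ≤ n, fun c hc => ?_, h2.sublist List.filter_sublist, ?_⟩
  · rw [List.mem_filter] at hc
    exact ⟨h1 c hc.1, by simpa using hc.2⟩
  · clear h1 h2
    induction L with
    | nil => rfl
    | cons c L ih =>
      rw [List.filter_cons]
      split
      · simp [ih]
      · rename_i hc
        simp [ih, hn c (by simpa using hc)]

/-- Moving the copies of `e` to the front creates only iterated brackets with `e`, so the remainder
keeps any property `R` that is stable under bracketing with `e`. -/
theorem collect_single (hφ : IsMultiplicativeWeight φ) (hA : 0 ≤ A) (e : FormalCommutator k)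
    (hR : ∀ c, P c → c ≠ e → R c) (hRe : ∀ y, R y → R (bracket y e))
    (hg : g ∈ wordSet S n φ P A) (he : e.length ≤ n) :
    ∃ q : ℕ, (q : ℝ) ≤ A * φ e ∧ ∃ h ∈ wordSet S n φ R (A * (1 + A) ^ n),
      g = e.eval S ^ q * h := by
  obtain ⟨L, h1, h2, rfl⟩ := hg
  have hf : L.filter (fun c => decide (c = e)) = List.replicate (L.count e) e := by
    rw [List.filter_eq]
  refine ⟨L.count e, h2 e he, evalList S (collectRest (fun c => decide (c = e)) L), ?_, ?_⟩
  · refine ⟨_, ?_, (IsBounded.conjWord hφ hA hA h2 h2).sublist (collectRest_sublist _ _), rfl⟩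
    exact forall_mem_collectRest (Q := fun c => c = e)
      (fun c hc hce => hR c (h1 c hc) (by simpa using hce)) (fun c _ hce => by simpa using hce)
      fun y hy x hx => hx ▸ hRe y hy
  · rw [evalList_collect S (fun c => decide (c = e)) L, hf, evalList_replicate]

end WordSet

/-! ### Vanishing of long commutators -/

section Nilpotent

open Subgroup

/-- The three subgroups lemma, applied in the quotient by `N`. -/
theorem commutator_le_of_rotate {N H₁ H₂ H₃ : Subgroup G} [N.Normal]
    (h1 : ⁅⁅H₂, H₃⁆, H₁⁆ ≤ N) (h2 : ⁅⁅H₃, H₁⁆, H₂⁆ ≤ N) : ⁅⁅H₁, H₂⁆, H₃⁆ ≤ N := by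
  have key : ∀ K : Subgroup G, K ≤ N ↔ K.map (QuotientGroup.mk' N) = ⊥ := fun K => by
    rw [Subgroup.map_eq_bot_iff, QuotientGroup.ker_mk']
  rw [key, map_commutator, map_commutator] at h1 h2 ⊢
  exact commutator_commutator_eq_bot_of_rotate h1 h2

/-- Induction on `j` by the three subgroups lemma. The series is indexed from `0`, whence the `+ 1`.
-/
theorem commutator_lowerCentralSeries_le (i j : ℕ) :
    ⁅(⊤ : Subgroup G).lowerCentralSeries i, (⊤ : Subgroup G).lowerCentralSeries j⁆ ≤
      (⊤ : Subgroup G).lowerCentralSeries (i + j + 1) := by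
  induction j generalizing i with
  | zero => exact le_of_eq rfl
  | succ j ih =>
    rw [commutator_comm, Subgroup.lowerCentralSeries_succ]
    refine commutator_le_of_rotate ?_ ?_
    · rw [commutator_comm ⊤, ← Subgroup.lowerCentralSeries_succ]
      exact (ih (i + 1)).trans (le_of_eq (by congr 1; omega))
    · exact (commutator_mono (ih i) le_rfl).trans (le_of_eq rfl)

theorem eval_mem_lowerCentralSeries (S : Fin k → G) (c : FormalCommutator k) :
    c.eval S ∈ (⊤ : Subgroup G).lowerCentralSeries (c.length - 1) := by
  induction c with
  | letter i b => simp [length]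
  | bracket a b ha hb =>
    have h1 := one_le_length a
    have h2 := one_le_length b
    have h := commutator_lowerCentralSeries_le (G := G) _ _
      (commutator_mem_commutator (inv_mem ha) (inv_mem hb))
    have e : a.length - 1 + (b.length - 1) + 1 = (bracket a b).length - 1 := by
      simp only [length]; omega
    rw [e] at h
    simpa [commutatorElement_def, eval] using h

theorem exists_eval_eq_one [Group.IsNilpotent G] (S : Fin k → G) :
    ∃ n : ℕ, ∀ c : FormalCommutator k, n < c.length → c.eval S = 1 := by
  obtain ⟨n, hn⟩ := Subgroup.nilpotent_iff_lowerCentralSeries.1 ‹Group.IsNilpotent G›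
  refine ⟨n, fun c hc => ?_⟩
  have h := Subgroup.lowerCentralSeries_antitone (⊤ : Subgroup G) (show n ≤ c.length - 1 by omega)
    (eval_mem_lowerCentralSeries S c)
  rw [hn] at h
  simpa using h

end Nilpotent

end FormalCommutator

/-! ### Products of powers of generators -/

namespace FormalCommutator

variable {G : Type*} [Group G] {k : ℕ}

/-- The products of powers of generators with a prescribed pattern and bounded exponents. -/
def letterPowers (S : Fin k → G) (f : Fin k → ℝ) (C : ℝ) : List (Fin k) → Set G
  | [] => {1}
  | i :: s => {g | ∃ x : ℤ, |(x : ℝ)| ≤ C * f i ∧ ∃ h ∈ letterPowers S f C s, g = S i ^ x * h}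

section LetterPowers

variable {S : Fin k → G} {f : Fin k → ℝ} {C D : ℝ} {s s' : List (Fin k)} {g h : G}

theorem letterPowers_mono (hf : ∀ i, 0 ≤ f i) (hCD : C ≤ D) (hg : g ∈ letterPowers S f C s) :
    g ∈ letterPowers S f D s := by
  induction s generalizing g with
  | nil => exact hg
  | cons i s ih =>
    obtain ⟨x, hx, h, hh, rfl⟩ := hg
    exact ⟨x, hx.trans (mul_le_mul_of_nonneg_right hCD (hf i)), h, ih hh, rfl⟩

theorem mul_mem_letterPowers (hg : g ∈ letterPowers S f C s) (hh : h ∈ letterPowers S f C s') :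
    g * h ∈ letterPowers S f C (s ++ s') := by
  induction s generalizing g with
  | nil => rw [Set.mem_singleton_iff.1 hg, one_mul]; exact hh
  | cons i s ih =>
    obtain ⟨x, hx, g', hg', rfl⟩ := hg
    exact ⟨x, hx, g' * h, ih hg', mul_assoc _ _ _⟩

theorem zpow_mem_letterPowers {i : Fin k} {x : ℤ} (hx : |(x : ℝ)| ≤ C * f i) :
    S i ^ x ∈ letterPowers S f C [i] := ⟨x, hx, 1, rfl, (mul_one _).symm⟩

theorem inv_mem_letterPowers (hg : g ∈ letterPowers S f C s) :
    g⁻¹ ∈ letterPowers S f C s.reverse := by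
  induction s generalizing g with
  | nil => rw [Set.mem_singleton_iff.1 hg, inv_one]; rfl
  | cons i s ih =>
    obtain ⟨x, hx, h, hh, rfl⟩ := hg
    rw [mul_inv_rev, List.reverse_cons, ← zpow_neg]
    exact mul_mem_letterPowers (ih hh) (zpow_mem_letterPowers (by simpa using hx))

theorem zpow_mem_wordSet {φ : FormalCommutator k → ℝ} (hφ : IsMultiplicativeWeight φ) {n : ℕ}
    {P : FormalCommutator k → Prop} {A : ℝ} {c : FormalCommutator k} (hP : P c) (hP' : P c.finv)
    {x : ℤ} (hA : 0 ≤ A) (hx : |(x : ℝ)| ≤ A * φ c) : c.eval S ^ x ∈ wordSet S n φ P A := by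
  obtain ⟨q, rfl | rfl⟩ := x.eq_nat_or_neg
  · rw [zpow_natCast]
    exact pow_mem_wordSet hφ hP hA (by simpa using hx)
  · rw [zpow_neg, zpow_natCast, ← inv_pow, ← eval_finv]
    exact pow_mem_wordSet hφ hP' hA (by rw [hφ.finv]; simpa using hx)

theorem letterPowers_subset_wordSet {φ : FormalCommutator k → ℝ} (hφ : IsMultiplicativeWeight φ)
    (n : ℕ) (hf : ∀ i, φ (letter i true) = f i) (hC : 0 ≤ C) (hg : g ∈ letterPowers S f C s) :
    g ∈ wordSet S n φ (fun _ => True) (s.length * C) := by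
  induction s generalizing g with
  | nil =>
    rw [Set.mem_singleton_iff.1 hg]
    exact one_mem_wordSet hφ (by simp)
  | cons i s ih =>
    obtain ⟨x, hx, h, hh, rfl⟩ := hg
    have := mul_mem_wordSet (zpow_mem_wordSet (S := S) (n := n) (P := fun _ => True)
      (c := letter i true) (x := x) hφ trivial trivial hC (by rw [hf]; exact hx)) (ih hh)
    rw [show ((i :: s).length : ℝ) * C = C + s.length * C by
      rw [List.length_cons]; push_cast; ring]
    exact this

end LetterPowers

/-! ### Commutator identities modulo longer commutators -/

section Factor

variable {S : Fin k → G} {n : ℕ}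

theorem comm_mem_wordSet_length {φ : FormalCommutator k → ℝ} (hφ : IsMultiplicativeWeight φ)
    {l m : ℕ} {A B : ℝ} {g h : G} (hA : 0 ≤ A) (hB : 0 ≤ B)
    (hg : g ∈ wordSet S n φ (fun c => l ≤ c.length) A)
    (hh : h ∈ wordSet S n φ (fun c => m ≤ c.length) B) :
    g⁻¹ * h⁻¹ * g * h ∈
      wordSet S n φ (fun c => l + m ≤ c.length) (A * (1 + B) ^ n * (1 + A) ^ n) := by
  refine comm_mem_wordSet hφ hA hB ?_ ?_ ?_ hg hh <;> · intro y hy x hx; simp only [length]; omega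

theorem conj_mem_wordSet_length {φ : FormalCommutator k → ℝ} (hφ : IsMultiplicativeWeight φ)
    {l : ℕ} {Q : FormalCommutator k → Prop} {A B : ℝ} {g h : G} (hA : 0 ≤ A) (hB : 0 ≤ B)
    (hg : g ∈ wordSet S n φ (fun c => l ≤ c.length) B) (hh : h ∈ wordSet S n φ Q A) :
    h⁻¹ * g * h ∈ wordSet S n φ (fun c => l ≤ c.length) (B * (1 + A) ^ n) := by
  refine conj_mem_wordSet hφ hA hB ?_ hg hh; intro y hy x _; simp only [length]; omega

/-- `[a ^ q, b ^ v]` and `[a, b] ^ (q v)` agree up to longer commutators. -/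
theorem comm_pow_pow {φ : FormalCommutator k → ℝ} (hφ : IsMultiplicativeWeight φ)
    (a b : FormalCommutator k) {A B : ℝ} (hA : 0 ≤ A) (hB : 0 ≤ B) {q v : ℕ}
    (hq : (q : ℝ) ≤ A * φ a) (hv : (v : ℝ) ≤ B * φ b) :
    ∃ h ∈ wordSet S n φ (fun c => a.length + b.length + 1 ≤ c.length)
        (A * (1 + B) ^ n * (1 + A) ^ n * (1 + A * (1 + B) ^ n * (1 + A) ^ n) ^ n),
      (a.eval S ^ q)⁻¹ * (b.eval S ^ v)⁻¹ * a.eval S ^ q * b.eval S ^ v =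
        (bracket a b).eval S ^ (q * v) * h := by
  have hbd : ∀ {c : FormalCommutator k} {m : ℕ} {C : ℝ}, 0 ≤ C → (m : ℝ) ≤ C * φ c →
      IsBounded n φ C (List.replicate m c) := by
    intro c m C hC hm d _
    rw [List.count_replicate]
    split
    · rename_i h; rw [← eq_of_beq h]; exact hm
    · simpa using mul_nonneg hC (zero_le_one.trans (hφ.one_le d))
  -- `p` selects the smallest length that can occur. Every letter inserted by a conjugation is
  -- longer, so the letters of this length can be listed exactly: they are the `q * v` copies of
  -- `[a, b]`.
  set p : FormalCommutator k → Bool := fun c => decide (c.length = a.length + b.length)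
  have hge : ∀ v : ℕ, ∀ c ∈ commLetter a (List.replicate v b), a.length + b.length ≤ c.length := by
    intro v
    refine forall_mem_commLetter ?_ ?_
    · intro x hx; rw [List.eq_of_mem_replicate hx]; rfl
    · intro z hz x _; simp only [length]; omega
  have hlen : ∀ y : FormalCommutator k, a.length + b.length ≤ y.length →
      ∀ x : FormalCommutator k, p (bracket y x) = false := by
    intro y hy x
    have := one_le_length x
    exact decide_eq_false (by simp only [length]; omega)
  have hstep : ∀ y : FormalCommutator k, a.length + b.length ≤ y.length →
      ∀ x : FormalCommutator k, a.length + b.length ≤ (bracket y x).length := by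
    intro y hy x; simp only [length]; omega
  have h1 : ∀ v : ℕ, (commLetter a (List.replicate v b)).filter p =
      List.replicate v (bracket a b) := by
    intro v
    induction v with
    | zero => rfl
    | succ v ih =>
      rw [List.replicate_succ, commLetter, List.filter_append, ih,
        filter_conjWord (P := fun c => a.length + b.length ≤ c.length) p (by simp [length])
          (fun y hy x _ => hstep y hy x) (fun y hy x _ => hlen y hy x), List.replicate_succ']
      simp [p, length]
  have h2 : (commWord (List.replicate q a) (List.replicate v b)).filter p =
      List.replicate (q * v) (bracket a b) := by
    clear hq
    induction q with
    | zero => simp [commWord]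
    | succ q ih =>
      rw [List.replicate_succ, commWord, List.filter_append, ih,
        filter_conjWord (P := fun c => a.length + b.length ≤ c.length) p (hge v)
          (fun y hy x _ => hstep y hy x) (fun y hy x _ => hlen y hy x), h1,
          List.replicate_append_replicate]
      congr 1; ring
  have hb : IsBounded n φ (A * (1 + B) ^ n * (1 + A) ^ n)
      (commWord (List.replicate q a) (List.replicate v b)) :=
    IsBounded.sublist (IsBounded.conjWord hφ hA (by positivity) (hbd hA hq)
      (IsBounded.conjWord hφ hB hA (hbd hB hv) (hbd hA hq))) (commWord_sublist _ _)
  have hmem : ∀ c ∈ commWord (List.replicate q a) (List.replicate v b),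
      a.length + b.length ≤ c.length := by
    refine forall_mem_commWord ?_ ?_ ?_
    · intro y hy x hx; rw [List.eq_of_mem_replicate hx, List.eq_of_mem_replicate hy]; rfl
    · intro z hz x _; exact hstep z hz x
    · intro z hz x _; exact hstep z hz x
  refine ⟨evalList S (collectRest p (commWord (List.replicate q a) (List.replicate v b))),
    ⟨_, ?_, (IsBounded.conjWord hφ (by positivity) (by positivity) hb hb).sublist
      (collectRest_sublist _ _), rfl⟩, ?_⟩
  · refine forall_mem_collectRest (Q := fun _ => True) ?_ (fun _ _ _ => trivial) ?_
    · intro c hc hpc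
      have := hmem c hc
      simp only [p, decide_eq_false_iff_not] at hpc
      omega
    · intro y hy x _; simp only [length]; omega
  · have := evalList_collect S p (commWord (List.replicate q a) (List.replicate v b))
    rw [h2, evalList_commWord, evalList_replicate, evalList_replicate, evalList_replicate] at this
    exact this

/-- Perturbing the entries of a commutator by longer words changes it by longer words. -/
theorem comm_mul_mul (S : Fin k → G) (n l m : ℕ) {A : ℝ} (hA : 0 ≤ A) : ∃ C : ℝ, 0 ≤ C ∧
    ∀ φ : FormalCommutator k → ℝ, IsMultiplicativeWeight φ → ∀ x u y z : G,
      x ∈ wordSet S n φ (fun c => l ≤ c.length) A →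
      u ∈ wordSet S n φ (fun c => l + 1 ≤ c.length) A →
      y ∈ wordSet S n φ (fun c => m ≤ c.length) A →
      z ∈ wordSet S n φ (fun c => m + 1 ≤ c.length) A →
      ∃ h ∈ wordSet S n φ (fun c => l + m + 1 ≤ c.length) C,
        (x * u)⁻¹ * (y * z)⁻¹ * (x * u) * (y * z) = (x⁻¹ * y⁻¹ * x * y) * h := by
  -- The four summands bound the four factors of `h` in `[xu, yz] = [x, y] · [xu, z]^[x,y] · [[x,
  -- y], u] · [u, y] · [[xu, y], z]`. Each factor involves `u` or `z`, hence has length at least `l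
  -- + m + 1`.
  refine ⟨(A + A) * (1 + A) ^ n * (1 + (A + A)) ^ n * (1 + A * (1 + A) ^ n * (1 + A) ^ n) ^ n +
      A * (1 + A) ^ n * (1 + A) ^ n * (1 + A) ^ n * (1 + A * (1 + A) ^ n * (1 + A) ^ n) ^ n +
      A * (1 + A) ^ n * (1 + A) ^ n + (A + A) * (1 + A) ^ n * (1 + (A + A)) ^ n * (1 + A) ^ n *
        (1 + (A + A) * (1 + A) ^ n * (1 + (A + A)) ^ n) ^ n, by positivity, ?_⟩
  · intro φ hφ x u y z hx hu hy hz
    have hxu := mul_mem_wordSet hx (wordSet_mono hφ (fun c (hc : l + 1 ≤ c.length) =>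
      (by omega : l ≤ c.length)) le_rfl hu)
    have hxy := comm_mem_wordSet_length hφ hA hA hx hy
    have h1 := conj_mem_wordSet_length hφ (by positivity) (by positivity)
      (comm_mem_wordSet_length hφ (by positivity) hA hxu hz) hxy
    have h2 := comm_mem_wordSet_length hφ (by positivity) hA hxy hu
    have h3 := comm_mem_wordSet_length hφ hA hA hu hy
    have h4 := comm_mem_wordSet_length hφ (by positivity) hA
      (comm_mem_wordSet_length hφ (by positivity) hA hxu hy) hz
    have m1 := wordSet_mono hφ (Q := fun c => l + m + 1 ≤ c.length) (fun c hc => by omega) le_rfl h1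
    have m2 := wordSet_mono hφ (Q := fun c => l + m + 1 ≤ c.length) (fun c hc => by omega) le_rfl h2
    have m3 := wordSet_mono hφ (Q := fun c => l + m + 1 ≤ c.length) (fun c hc => by omega) le_rfl h3
    have m4 := wordSet_mono hφ (Q := fun c => l + m + 1 ≤ c.length) (fun c hc => by omega) le_rfl h4
    refine ⟨_, mul_mem_wordSet (mul_mem_wordSet (mul_mem_wordSet m1 m2) m3) m4, ?_⟩
    group

end Factor

end FormalCommutator

/-! ### Factorization of bounded words into powers of generators -/

namespace FormalCommutator

variable {G : Type*} [Group G] {k : ℕ}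

/-- The elements of the sets `X r` are products of boundedly many powers of generators and of a
bounded word in the commutators of length at least `m`, uniformly in `r`. -/
def IsFactorable (S : Fin k → G) (n : ℕ) (F : WeightFunctionSystem k) (m : ℕ) (X : ℝ → Set G) :
    Prop :=
  ∃ (s : List (Fin k)) (C : ℝ), 0 ≤ C ∧ ∀ r : ℝ, 1 ≤ r → ∀ g ∈ X r,
    ∃ g₁ ∈ letterPowers S (fun i => F.letterFun i r) C s,
    ∃ g₂ ∈ wordSet S n (fun c => F.weightFun c r) (fun c => m ≤ c.length) C, g = g₁ * g₂

section Factorable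

variable {S : Fin k → G} {n m : ℕ} {F : WeightFunctionSystem k} {X Y : ℝ → Set G}

theorem IsFactorable.mono (hY : IsFactorable S n F m Y) (h : ∀ r, 1 ≤ r → ∀ g ∈ X r, g ∈ Y r) :
    IsFactorable S n F m X := by
  obtain ⟨s, C, hC, H⟩ := hY
  exact ⟨s, C, hC, fun r hr g hg => H r hr g (h r hr g hg)⟩

theorem letterFun_nonneg (F : WeightFunctionSystem k) {r : ℝ} (hr : 1 ≤ r) (i : Fin k) :
    0 ≤ F.letterFun i r := zero_le_one.trans (F.one_le i r hr)

/-- `(p h)(p' h') = (p p') · (p'⁻¹ h p') h'`, and `p'` is itself a bounded word, so the conjugate of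
`h` stays bounded without losing length. -/
theorem IsFactorable.mul (hX : IsFactorable S n F m X) (hY : IsFactorable S n F m Y) :
    IsFactorable S n F m fun r => {g | ∃ x ∈ X r, ∃ y ∈ Y r, g = x * y} := by
  obtain ⟨s, C, hC, HX⟩ := hX
  obtain ⟨t, D, hD, HY⟩ := hY
  refine ⟨s ++ t, max (max C D) (C * (1 + t.length * D) ^ n + D), by positivity, ?_⟩
  rintro r hr _ ⟨x, hx, y, hy, rfl⟩
  obtain ⟨p, hp, h, hh, rfl⟩ := HX r hr x hx
  obtain ⟨p', hp', h', hh', rfl⟩ := HY r hr y hy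
  have hφ := isMultiplicativeWeight_weightFun F hr
  have hf := letterFun_nonneg F hr
  refine ⟨p * p', mul_mem_letterPowers
    (letterPowers_mono hf ((le_max_left _ _).trans (le_max_left _ _)) hp)
    (letterPowers_mono hf ((le_max_right _ _).trans (le_max_left _ _)) hp'),
    (p'⁻¹ * h * p') * h', ?_, by group⟩
  refine wordSet_mono hφ (fun _ h => h) (le_max_right _ _) (mul_mem_wordSet ?_ hh')
  exact conj_mem_wordSet_length hφ (by positivity) hC hh
    (letterPowers_subset_wordSet hφ n (fun _ => rfl) hD hp')

theorem isFactorable_wordSet {A : ℝ} (hA : 0 ≤ A) : IsFactorable S n F m fun r =>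
    wordSet S n (fun c => F.weightFun c r) (fun c => m ≤ c.length) A :=
  ⟨[], A, hA, fun _ _ g hg => ⟨1, rfl, g, hg, (one_mul g).symm⟩⟩

/-- The powers `c ^ q` with `q ≤ A * F_c(r)`. -/
def boundedPowers (S : Fin k → G) (F : WeightFunctionSystem k) (c : FormalCommutator k) (A r : ℝ) :
    Set G := {g | ∃ q : ℕ, (q : ℝ) ≤ A * F.weightFun c r ∧ g = c.eval S ^ q}

/-- Up to longer words, `[a, b]^(q v)` is `[a^q, b^v]`, and this is `[p, p']` for the letter powers
`p`, `p'` that approximate `a^q` and `b^v`. The pattern of `[p, p']` is fixed, since those of `p`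
and `p'` are. -/
theorem isFactorable_pow_mul (a b : FormalCommutator k) {A : ℝ} (hA : 0 ≤ A)
    (ha : IsFactorable S n F (a.length + 1) (boundedPowers S F a A))
    (hb : IsFactorable S n F (b.length + 1) (boundedPowers S F b A)) :
    IsFactorable S n F (a.length + b.length + 1) fun r => {g | ∃ q v : ℕ,
      (q : ℝ) ≤ A * F.weightFun a r ∧ (v : ℝ) ≤ A * F.weightFun b r ∧
        g = (bracket a b).eval S ^ (q * v)} := by
  obtain ⟨s, C, hC, HX⟩ := ha
  obtain ⟨t, D, hD, HY⟩ := hb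
  obtain ⟨E, hE, HE⟩ := comm_mul_mul S n a.length b.length (A := max A (max C D))
    (by positivity)
  set K := A * (1 + A) ^ n * (1 + A) ^ n * (1 + A * (1 + A) ^ n * (1 + A) ^ n) ^ n with hK
  have hK0 : 0 ≤ K := by positivity
  refine ⟨s.reverse ++ t.reverse ++ s ++ t, max (max C D) (E + K), by positivity, ?_⟩
  rintro r hr _ ⟨q, v, hq, hv, rfl⟩
  have hφ := isMultiplicativeWeight_weightFun F hr
  have hf := letterFun_nonneg F hr
  obtain ⟨p, hp, h, hh, hqp⟩ := HX r hr _ ⟨q, hq, rfl⟩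
  obtain ⟨p', hp', h', hh', hvp⟩ := HY r hr _ ⟨v, hv, rfl⟩
  obtain ⟨e, he, heq⟩ := comm_pow_pow (S := S) (n := n) hφ a b hA hA hq hv
  have hle : A ≤ max A (max C D) := le_max_left _ _
  have hinv : ∀ l : ℕ, ∀ c : FormalCommutator k, l ≤ c.length → l ≤ c.finv.length :=
    fun l c hc => by rwa [length_finv]
  obtain ⟨e', he', heq'⟩ := HE _ hφ (a.eval S ^ q) h⁻¹ (b.eval S ^ v) h'⁻¹
    (wordSet_mono hφ (fun _ h => h) hle (pow_mem_wordSet hφ (le_refl a.length) hA hq))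
    (wordSet_mono hφ (fun _ h => h) ((le_max_left _ _).trans (le_max_right _ _))
      (inv_mem_wordSet hφ (hinv _) hh))
    (wordSet_mono hφ (fun _ h => h) hle (pow_mem_wordSet hφ (le_refl b.length) hA hv))
    (wordSet_mono hφ (fun _ h => h) ((le_max_right _ _).trans (le_max_right _ _))
      (inv_mem_wordSet hφ (hinv _) hh'))
  have e1 : a.eval S ^ q * h⁻¹ = p := by rw [hqp]; group
  have e2 : b.eval S ^ v * h'⁻¹ = p' := by rw [hvp]; group
  rw [e1, e2, heq] at heq'
  have hp1 := letterPowers_mono hf ((le_max_left C D).trans (le_max_left _ (E + K))) hp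
  have hp2 := letterPowers_mono hf ((le_max_right C D).trans (le_max_left _ (E + K))) hp'
  refine ⟨p⁻¹ * p'⁻¹ * p * p', mul_mem_letterPowers (mul_mem_letterPowers (mul_mem_letterPowers
    (inv_mem_letterPowers hp1) (inv_mem_letterPowers hp2)) hp1) hp2, (e * e')⁻¹, ?_, ?_⟩
  · refine wordSet_mono hφ (fun _ h => h) (le_max_right _ _) (inv_mem_wordSet hφ (hinv _) ?_)
    rw [add_comm E K]
    exact mul_mem_wordSet he he'
  · rw [heq']; group

/-- Induction on `c`. For a bracket, `q` is of the order of a product, and division by `v =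
⌊F_b(r)⌋` writes `[a, b]^q` as two powers whose exponents are products of admissible ones: `(q / v)
* v` and `1 * (q % v)`. -/
theorem isFactorable_boundedPowers (S : Fin k → G) (n : ℕ) (F : WeightFunctionSystem k)
    (c : FormalCommutator k) {A : ℝ} (hA : 0 ≤ A) :
    IsFactorable S n F (c.length + 1) (boundedPowers S F c A) := by
  induction c generalizing A with
  | letter i b =>
    refine ⟨[i], A, hA, ?_⟩
    rintro r hr _ ⟨q, hq, rfl⟩
    refine ⟨(letter i b).eval S ^ q, ?_, 1,
      one_mem_wordSet (isMultiplicativeWeight_weightFun F hr) hA, (mul_one _).symm⟩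
    have hq' : |((q : ℤ) : ℝ)| ≤ A * F.letterFun i r := by
      rw [Int.cast_natCast, abs_of_nonneg q.cast_nonneg]
      exact hq
    cases b
    · have := inv_mem_letterPowers (zpow_mem_letterPowers (S := S)
        (f := fun i => F.letterFun i r) hq')
      simpa [eval] using this
    · simpa [eval] using zpow_mem_letterPowers (S := S) (f := fun i => F.letterFun i r) hq'
  | bracket a b iha ihb =>
    -- From `F_b ≤ 2 v` follows `q / v ≤ 2 A F_a`. The extra `1` admits the exponents `1`, `v` and
    -- `q % v`.
    have hA' : 0 ≤ 2 * A + 1 := by positivity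
    have H := isFactorable_pow_mul a b hA' (iha hA') (ihb hA')
    refine (H.mul H).mono ?_
    rintro r hr _ ⟨q, hq, rfl⟩
    have hφ := isMultiplicativeWeight_weightFun F hr
    have ha1 := hφ.one_le a
    have hb1 := hφ.one_le b
    set v := ⌊F.weightFun b r⌋₊ with hv
    have hv1 : 1 ≤ v := Nat.le_floor (by simpa using hb1)
    have hvle : (v : ℝ) ≤ F.weightFun b r := Nat.floor_le (by linarith)
    have hlt : F.weightFun b r < v + 1 := Nat.lt_floor_add_one _
    have hv1' : (1 : ℝ) ≤ v := by exact_mod_cast hv1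
    have hdiv : ((q / v : ℕ) : ℝ) * v ≤ q := by exact_mod_cast Nat.div_mul_le_self q v
    have hmod : ((q % v : ℕ) : ℝ) ≤ v := by exact_mod_cast (Nat.mod_lt q hv1).le
    refine ⟨_, ⟨q / v, v, ?_, ?_, rfl⟩, _, ⟨1, q % v, ?_, ?_, rfl⟩, ?_⟩
    · have hq' : (q : ℝ) ≤ A * (F.weightFun a r * F.weightFun b r) := hq
      have h3 : A * (F.weightFun a r * F.weightFun b r) ≤ 2 * A * F.weightFun a r * v := by
        have : F.weightFun b r ≤ 2 * v := by linarith
        have h4 : 0 ≤ A * F.weightFun a r := by positivity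
        nlinarith
      have h5 : ((q / v : ℕ) : ℝ) ≤ 2 * A * F.weightFun a r :=
        le_of_mul_le_mul_right (hdiv.trans (hq'.trans h3)) (by linarith)
      linarith
    · nlinarith
    · push_cast; nlinarith
    · nlinarith
    · rw [← pow_add, one_mul, mul_comm (q / v), Nat.div_add_mod]

/-- Words in the commutators of length at least `m` factor through those of larger length. -/
theorem isFactorable_length_succ (S : Fin k → G) (n : ℕ) (F : WeightFunctionSystem k) {m : ℕ}
    (hm : m ≤ n) {A : ℝ} (hA : 0 ≤ A) : IsFactorable S n F (m + 1) fun r =>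
      wordSet S n (fun c => F.weightFun c r) (fun c => m ≤ c.length) A := by
  -- `l` lists the commutators of length `m` that may still occur. Collecting one of them removes it
  -- from the list, and the brackets created are longer than `m`.
  have key : ∀ l : List (FormalCommutator k), (∀ c ∈ l, c.length = m) → ∀ A : ℝ, 0 ≤ A →
      IsFactorable S n F (m + 1) fun r => wordSet S n (fun c => F.weightFun c r)
        (fun c => m ≤ c.length ∧ (c.length = m → c ∈ l)) A := by
    intro l
    induction l with
    | nil =>
      intro _ A hA
      refine (isFactorable_wordSet hA).mono fun r hr g hg => ?_
      refine wordSet_mono (isMultiplicativeWeight_weightFun F hr) (fun c hc => ?_) le_rfl hg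
      have := hc.2
      simp only [List.not_mem_nil, imp_false] at this
      omega
    | cons e l ih =>
      intro hl A hA
      have he : e.length = m := hl e List.mem_cons_self
      have h1 := isFactorable_boundedPowers S n F e hA
      rw [he] at h1
      refine (h1.mul (ih (fun c hc => hl c (List.mem_cons_of_mem _ hc)) (A * (1 + A) ^ n)
        (by positivity))).mono fun r hr g hg => ?_
      obtain ⟨q, hq, h, hh, rfl⟩ := collect_single (isMultiplicativeWeight_weightFun F hr) hA e
        (R := fun c => m ≤ c.length ∧ (c.length = m → c ∈ l)) (fun c hc hce =>
          ⟨hc.1, fun h => (List.mem_cons.1 (hc.2 h)).resolve_left hce⟩) (fun y hy => by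
          have := one_le_length e
          have := hy.1
          simp only [length]
          exact ⟨by omega, fun h => by omega⟩) hg (he.trans_le hm)
      exact ⟨_, ⟨q, hq, rfl⟩, h, hh, rfl⟩
  have hfin : {c : FormalCommutator k | c.length = m}.Finite :=
    (finite_length_le k m).subset fun c hc => le_of_eq hc
  refine (key hfin.toFinset.toList (fun c hc => by simpa using hc) A hA).mono fun r hr g hg => ?_
  exact wordSet_mono (isMultiplicativeWeight_weightFun F hr) (fun c hc => ⟨hc, by simp⟩) le_rfl hg

theorem eq_one_of_mem_wordSet {φ : FormalCommutator k → ℝ} {P : FormalCommutator k → Prop} {A : ℝ}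
    (hP : ∀ c, P c → c.eval S = 1) {g : G} (hg : g ∈ wordSet S n φ P A) : g = 1 := by
  obtain ⟨L, h1, h2, rfl⟩ := hg
  clear h2
  induction L with
  | nil => rfl
  | cons c L ih =>
    rw [evalList_cons, hP c (h1 c List.mem_cons_self),
      ih fun c hc => h1 c (List.mem_cons_of_mem _ hc), one_mul]

/-- Bounded words are products of boundedly many powers of generators. -/
theorem exists_letterPowers (S : Fin k → G) {n : ℕ}
    (hn : ∀ c : FormalCommutator k, n < c.length → c.eval S = 1) (F : WeightFunctionSystem k)
    {A : ℝ} (hA : 0 ≤ A) : ∃ (s : List (Fin k)) (C : ℝ), 0 ≤ C ∧ ∀ r : ℝ, 1 ≤ r →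
      ∀ g ∈ wordSet S n (fun c => F.weightFun c r) (fun _ => True) A,
        g ∈ letterPowers S (fun i => F.letterFun i r) C s := by
  -- `i` is the number of lengths still to be removed. At length `n + 1` the remaining word is
  -- trivial in `G`.
  have key : ∀ i m : ℕ, m + i = n + 1 → ∀ A : ℝ, 0 ≤ A →
      IsFactorable S n F (n + 1) fun r =>
        wordSet S n (fun c => F.weightFun c r) (fun c => m ≤ c.length) A := by
    intro i
    induction i with
    | zero =>
      intro m hm A hA
      rw [add_zero] at hm
      exact hm ▸ isFactorable_wordSet hA
    | succ i ih =>
      intro m hm A hA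
      obtain ⟨s, C, hC, H⟩ := isFactorable_length_succ S n F (m := m) (by omega) hA
      obtain ⟨t, D, hD, H'⟩ := ih (m + 1) (by omega) C hC
      refine ⟨s ++ t, max C D, by positivity, fun r hr g hg => ?_⟩
      obtain ⟨p, hp, h, hh, rfl⟩ := H r hr g hg
      obtain ⟨p', hp', h', hh', rfl⟩ := H' r hr h hh
      have hf := letterFun_nonneg F hr
      exact ⟨p * p', mul_mem_letterPowers (letterPowers_mono hf (le_max_left _ _) hp)
        (letterPowers_mono hf (le_max_right _ _) hp'), h',
        wordSet_mono (isMultiplicativeWeight_weightFun F hr) (fun _ h => h) (le_max_right _ _) hh',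
        (mul_assoc _ _ _).symm⟩
  obtain ⟨s, C, hC, H⟩ := key (n + 1) 0 (zero_add _) A hA
  refine ⟨s, C, hC, fun r hr g hg => ?_⟩
  obtain ⟨p, hp, h, hh, rfl⟩ := H r hr g (wordSet_mono (isMultiplicativeWeight_weightFun F hr)
    (fun _ _ => Nat.zero_le _) le_rfl hg)
  rwa [eq_one_of_mem_wordSet (fun c hc => hn c hc) hh, mul_one]

theorem exists_exponents_of_mem_letterPowers {f : Fin k → ℝ} {C : ℝ} {s : List (Fin k)} {g : G}
    (hg : g ∈ letterPowers S f C s) : ∃ x : Fin s.length → ℤ,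
      g = (List.ofFn fun j => S (s.get j) ^ x j).prod ∧ ∀ j, |(x j : ℝ)| ≤ C * f (s.get j) := by
  induction s generalizing g with
  | nil => exact ⟨fun _ => 0, by simpa [letterPowers] using hg, fun j => j.elim0⟩
  | cons i s ih =>
    obtain ⟨x, hx, h, hh, rfl⟩ := hg
    obtain ⟨y, rfl, hy⟩ := ih hh
    refine ⟨Fin.cons x y, ?_, ?_⟩
    · simp [List.ofFn_succ]
    · intro j
      refine Fin.cases ?_ (fun j => ?_) j
      · simpa using hx
      · simpa using hy j

/-- Replacing the letter `c⁻¹` by the commutator `c.finv`, which has the same weight function,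
merges the occurrences of `c` and of `c.finv`. This accounts for the `2`. -/
theorem mem_wordSet_of_isExpressible {F : WeightFunctionSystem k} {r : ℝ} (hr : 1 ≤ r) {g : G}
    (hg : IsExpressible S F r g) :
    g ∈ wordSet S n (fun c => F.weightFun c r) (fun _ => True) 2 := by
  obtain ⟨ω, rfl, hω⟩ := hg
  refine ⟨ω.map fun p => if p.2 then p.1 else p.1.finv, fun _ _ => trivial, fun c _ => ?_, ?_⟩
  · have h1 : (ω.map fun p => if p.2 then p.1 else p.1.finv).count c ≤
        CommutatorWord.deg c ω + CommutatorWord.deg c.finv ω := by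
      clear hω
      induction ω with
      | nil => simp
      | cons p ω ih =>
        obtain ⟨d, b⟩ := p
        have hd : ∀ e : FormalCommutator k, CommutatorWord.deg e ((d, b) :: ω) =
            CommutatorWord.deg e ω + if d = e then 1 else 0 := by
          intro e
          simp only [CommutatorWord.deg, List.map_cons]
          rw [List.count_cons]
          simp
        rw [hd, hd, List.map_cons, List.count_cons]
        have h : (if ((if b then d else d.finv) == c) = true then 1 else 0) ≤
            (if d = c then 1 else 0) + (if d = c.finv then 1 else 0) := by
          cases b
          · simp only [Bool.false_eq_true, if_false, beq_iff_eq, finv_eq_iff]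
            exact Nat.le_add_left _ _
          · simp only [if_true, beq_iff_eq]
            exact Nat.le_add_right _ _
        simp only at h ⊢
        omega
    have h2 := hω c
    have h3 := hω c.finv
    rw [(isMultiplicativeWeight_weightFun F hr).finv c] at h3
    have h4 : (((ω.map fun p => if p.2 then p.1 else p.1.finv).count c : ℕ) : ℝ) ≤
        CommutatorWord.deg c ω + CommutatorWord.deg c.finv ω := by exact_mod_cast h1
    linarith
  · clear hω
    induction ω with
    | nil => simp [CommutatorWord.eval]
    | cons p ω ih =>
      obtain ⟨d, b⟩ := p
      simp only [CommutatorWord.eval, List.map_cons, List.prod_cons, evalList_cons] at ih ⊢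
      rw [ih]
      cases b <;> simp

end Factorable

end FormalCommutator

/-! ### Integer combinations with bounded coefficients -/

section IntegerCombinations

variable {V ι : Type*} [AddCommGroup V]

/-- A combination over the set of values of a family is a combination of the family itself, using
each value once. -/
theorem exists_coeff_of_image {κ : Type*} [DecidableEq ι] (v : ι → V) (s : Finset κ) (c : κ → ι)
    (x : ι → ℤ) : ∃ z : κ → ℤ, ∑ i ∈ s, z i • v (c i) = ∑ e ∈ s.image c, x e • v e ∧
      (∀ i, |z i| ≤ |x (c i)|) ∧ ∀ e, ∑ i ∈ s with c i = e, |z i| ≤ |x e| := by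
  classical
  -- `o e` is a chosen index of `s` with value `e`. It carries the whole coefficient `x e`, and the
  -- other indices with this value get `0`.
  have : ∀ e, ∃ o : Option κ, ∀ j ∈ s, c j = e → ∃ i ∈ s, o = some i ∧ c i = e := fun e => by
    by_cases h : ∃ i ∈ s, c i = e
    · obtain ⟨i, hi, hie⟩ := h
      exact ⟨some i, fun _ _ _ => ⟨i, hi, rfl, hie⟩⟩
    · exact ⟨none, fun j hj hje => absurd ⟨j, hj, hje⟩ h⟩
  choose o ho using this
  refine ⟨fun i => if o (c i) = some i then x (c i) else 0, ?_, fun i => ?_, fun e => ?_⟩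
  · rw [← Finset.sum_fiberwise_of_maps_to (t := s.image c) (g := c)
      (fun i hi => Finset.mem_image_of_mem c hi)]
    refine Finset.sum_congr rfl fun e he => ?_
    obtain ⟨j, hj, hje⟩ := Finset.mem_image.1 he
    obtain ⟨i, hi, hoi, hie⟩ := ho e j hj hje
    rw [Finset.sum_eq_single i]
    · simp [hie, hoi]
    · intro i' hi' hne
      rw [Finset.mem_filter] at hi'
      dsimp only
      rw [hi'.2, hoi, if_neg (fun h => hne (Option.some_injective _ h).symm), zero_smul]
    · intro h
      exact absurd (Finset.mem_filter.2 ⟨hi, hie⟩) h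
  · dsimp only
    split <;> simp
  · rcases Finset.eq_empty_or_nonempty (s.filter fun i => c i = e) with h | ⟨j, hj⟩
    · rw [h]; simp
    · rw [Finset.mem_filter] at hj
      obtain ⟨i, hi, hoi, hie⟩ := ho e j hj.1 hj.2
      rw [Finset.sum_eq_single i]
      · simp [hie, hoi]
      · intro i' hi' hne
        rw [Finset.mem_filter] at hi'
        dsimp only
        rw [hi'.2, hoi, if_neg (fun h => hne (Option.some_injective _ h).symm), abs_zero]
      · intro h
        exact absurd (Finset.mem_filter.2 ⟨hi, hie⟩) h

variable [Fintype ι]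

/-- Integer relations between finitely many vectors are combinations of finitely many relations,
with coefficients bounded linearly in the size of the relation. -/
theorem exists_bounded_relations (v : ι → V) :
    ∃ (q : ℕ) (l : Fin q → ι → ℤ) (C : ℝ), 0 ≤ C ∧ (∀ i, ∑ e, l i e • v e = 0) ∧
      ∀ M : ℝ, ∀ m : ι → ℤ, (∀ e, |(m e : ℝ)| ≤ M) → ∑ e, m e • v e = 0 →
        ∃ κ : Fin q → ℤ, m = ∑ i, κ i • l i ∧ ∀ i, |(κ i : ℝ)| ≤ C * M := by
  classical
  set f : (ι → ℤ) →ₗ[ℤ] V := Fintype.linearCombination ℤ v with hf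
  have hfa : ∀ m, f m = ∑ e, m e • v e := fun m => Fintype.linearCombination_apply ℤ v m
  -- In adapted bases the coordinates of a relation in the kernel are its coordinates in the ambient
  -- lattice divided by nonzero integers, so they are bounded linearly by its entries.
  obtain ⟨q, snf⟩ := Submodule.smithNormalForm (Pi.basisFun ℤ ι) (LinearMap.ker f)
  have ha : ∀ i, snf.a i ≠ 0 := fun i hi => by
    have h := snf.snf i
    rw [hi, zero_smul] at h
    exact snf.bN.ne_zero i (Subtype.ext h)
  refine ⟨q, fun i => (snf.bN i : ι → ℤ),
    ∑ i, ∑ e, |(snf.bM.repr (Pi.basisFun ℤ ι e) (snf.f i) : ℝ)|, by positivity,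
    fun i => by rw [← hfa]; exact (snf.bN i).2, fun M m hm h0 => ?_⟩
  rw [← hfa] at h0
  set m' : LinearMap.ker f := ⟨m, h0⟩
  refine ⟨fun i => snf.bN.repr m' i, ?_, fun i => ?_⟩
  · have h := congrArg (Subtype.val : LinearMap.ker f → ι → ℤ) (snf.bN.sum_repr m')
    rw [Submodule.coe_sum] at h
    exact h.symm
  · have h1 : snf.bM.repr m (snf.f i) = snf.bN.repr m' i * snf.a i := by
      have h := snf.repr_apply_embedding_eq_repr_smul (m := m') (i := i)
      rw [h]; simp [mul_comm]
    have h2 : |snf.bN.repr m' i| ≤ |snf.bM.repr m (snf.f i)| := by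
      rw [h1, abs_mul]
      exact le_mul_of_one_le_right (abs_nonneg _) (Int.one_le_abs (ha i))
    have h3 : snf.bM.repr m (snf.f i) =
        ∑ e, m e * snf.bM.repr (Pi.basisFun ℤ ι e) (snf.f i) := by
      conv_lhs => rw [← (Pi.basisFun ℤ ι).sum_repr m]
      rw [map_sum, Finsupp.finsetSum_apply]
      refine Finset.sum_congr rfl fun e _ => ?_
      rw [map_smul, Finsupp.smul_apply, smul_eq_mul, Pi.basisFun_repr]
    have h4 : |(snf.bM.repr m (snf.f i) : ℝ)| ≤
        ∑ e, M * |(snf.bM.repr (Pi.basisFun ℤ ι e) (snf.f i) : ℝ)| := by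
      rw [h3]
      push_cast
      refine (Finset.abs_sum_le_sum_abs _ _).trans (Finset.sum_le_sum fun e _ => ?_)
      rw [abs_mul]
      exact mul_le_mul_of_nonneg_right (hm e) (abs_nonneg _)
    have h5 : |(snf.bN.repr m' i : ℝ)| ≤ |(snf.bM.repr m (snf.f i) : ℝ)| := by exact_mod_cast h2
    refine (h5.trans h4).trans ?_
    rw [← Finset.mul_sum, mul_comm]
    rcases isEmpty_or_nonempty ι with hι | ⟨⟨e⟩⟩
    · simp
    · have hM : 0 ≤ M := (abs_nonneg _).trans (hm e)
      refine mul_le_mul_of_nonneg_right ?_ hM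
      exact Finset.single_le_sum
        (f := fun i => ∑ e, |(snf.bM.repr (Pi.basisFun ℤ ι e) (snf.f i) : ℝ)|)
        (fun _ _ => Finset.sum_nonneg fun _ _ => abs_nonneg _) (Finset.mem_univ i)

/-- If `T` spans up to torsion and `T ∪ U` spans, then integer combinations can be rewritten in
terms of `T ∪ U`, with bounded coefficients on `U`. -/
theorem exists_bounded_coeff_finset (v : ι → V) (T U : Finset ι)
    (hTU : ∀ e, v e ∈ Submodule.span ℤ (v '' T) ⊔ Submodule.span ℤ (v '' U))
    (hT : ∀ e, ∃ N : ℕ, 1 ≤ N ∧ N • v e ∈ Submodule.span ℤ (v '' T)) :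
    ∃ C : ℝ, 0 ≤ C ∧ ∀ M : ℝ, 1 ≤ M → ∀ m : ι → ℤ, (∀ e, |(m e : ℝ)| ≤ M) →
      ∃ x y : ι → ℤ, ∑ e ∈ T, x e • v e + ∑ e ∈ U, y e • v e = ∑ e, m e • v e ∧
        (∀ e, |(x e : ℝ)| ≤ C * M) ∧ ∀ e, |(y e : ℝ)| ≤ C := by
  classical
  choose N hN1 hN using hT
  have hN' : ∀ e, ∃ a : ι → ℤ, ∑ t ∈ T, a t • v t = (N e : ℤ) • v e := fun e => by
    have := hN e
    rw [Submodule.mem_span_image_finset_iff_exists_fun'] at this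
    simpa using this
  choose a ha using hN'
  have hb' : ∀ e, ∃ b d : ι → ℤ, ∑ t ∈ T, b t • v t + ∑ t ∈ U, d t • v t = v e := fun e => by
    obtain ⟨y, hy, z, hz, h⟩ := Submodule.mem_sup.1 (hTU e)
    rw [Submodule.mem_span_image_finset_iff_exists_fun'] at hy hz
    obtain ⟨b, rfl⟩ := hy
    obtain ⟨d, rfl⟩ := hz
    exact ⟨b, d, h⟩
  choose b d hbd using hb'
  -- With `m e = N e * (m e / N e) + m e % N e`, the multiple of `N e • v e` is expressed in `T`
  -- alone. Only the bounded remainder is expressed in `T` and `U` together.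
  refine ⟨∑ e, ∑ t, (|(a e t : ℝ)| + N e * |(b e t : ℝ)| + N e * |(d e t : ℝ)|), by positivity,
    fun M hM m hm => ⟨fun t => ∑ e, (m e / N e * a e t + m e % N e * b e t),
      fun t => ∑ e, m e % N e * d e t, ?_, ?_, ?_⟩⟩
  · simp only [Finset.sum_smul]
    rw [Finset.sum_comm, Finset.sum_comm (s := U), ← Finset.sum_add_distrib]
    refine Finset.sum_congr rfl fun e _ => ?_
    conv_rhs => rw [← Int.mul_ediv_add_emod (m e) (N e), add_smul, mul_comm, mul_smul, ← ha e]
    conv_rhs => rw [← hbd e]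
    simp only [add_smul, mul_smul, Finset.sum_add_distrib, Finset.smul_sum, smul_add]
    abel
  all_goals
    intro t
    have hN0 : ∀ e, (0 : ℤ) < N e := fun e => by exact_mod_cast hN1 e
    have hmod : ∀ e, |((m e % N e : ℤ) : ℝ)| ≤ N e := fun e => by
      have h1 := Int.emod_nonneg (m e) (hN0 e).ne'
      have h2 := (Int.emod_lt_of_pos (m e) (hN0 e)).le
      rw [abs_of_nonneg (by exact_mod_cast h1)]
      exact_mod_cast h2
  · have hdiv : ∀ e, |((m e / N e : ℤ) : ℝ)| ≤ M := fun e => by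
      refine le_trans ?_ (hm e)
      exact_mod_cast Int.abs_ediv_le_abs (m e) (N e)
    push_cast
    refine (Finset.abs_sum_le_sum_abs _ _).trans ?_
    rw [Finset.sum_mul]
    refine Finset.sum_le_sum fun e _ => ?_
    have h1 : |((m e / N e : ℤ) : ℝ) * a e t + ((m e % N e : ℤ) : ℝ) * b e t| ≤
        M * |(a e t : ℝ)| + N e * |(b e t : ℝ)| := by
      refine (abs_add_le _ _).trans ?_
      rw [abs_mul, abs_mul]
      exact add_le_add (mul_le_mul_of_nonneg_right (hdiv e) (abs_nonneg _))
        (mul_le_mul_of_nonneg_right (hmod e) (abs_nonneg _))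
    have h2 : |(a e t : ℝ)| + N e * |(b e t : ℝ)| + N e * |(d e t : ℝ)| ≤
        ∑ t, (|(a e t : ℝ)| + N e * |(b e t : ℝ)| + N e * |(d e t : ℝ)|) :=
      Finset.single_le_sum (f := fun t => |(a e t : ℝ)| + N e * |(b e t : ℝ)| + N e * |(d e t : ℝ)|)
        (fun _ _ => by positivity) (Finset.mem_univ t)
    have h3 : 0 ≤ (N e : ℝ) * |(b e t : ℝ)| := by positivity
    have h4 : 0 ≤ (N e : ℝ) * |(d e t : ℝ)| := by positivity
    refine h1.trans (le_trans ?_ (mul_le_mul_of_nonneg_right h2 (by linarith)))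
    nlinarith
  · push_cast
    refine (Finset.abs_sum_le_sum_abs _ _).trans (Finset.sum_le_sum fun e _ => ?_)
    have h2 : |(a e t : ℝ)| + N e * |(b e t : ℝ)| + N e * |(d e t : ℝ)| ≤
        ∑ t, (|(a e t : ℝ)| + N e * |(b e t : ℝ)| + N e * |(d e t : ℝ)|) :=
      Finset.single_le_sum (f := fun t => |(a e t : ℝ)| + N e * |(b e t : ℝ)| + N e * |(d e t : ℝ)|)
        (fun _ _ => by positivity) (Finset.mem_univ t)
    refine le_trans ?_ h2
    rw [abs_mul]
    have h3 : 0 ≤ (N e : ℝ) * |(b e t : ℝ)| := by positivity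
    have h4 := mul_le_mul_of_nonneg_right (hmod e) (abs_nonneg (d e t : ℝ))
    have h5 := abs_nonneg (a e t : ℝ)
    linarith

/-- Bounded coefficients with respect to a spanning family of which a part spans up to torsion,
uniformly over all families taken from a finite set of vectors. -/
theorem exists_bounded_coeff (v : ι → V) :
    ∃ C : ℝ, 0 ≤ C ∧ ∀ (κ : Type) (_ : Fintype κ) (c : κ → ι) (p : κ → Prop),
      (∀ e, v e ∈ Submodule.span ℤ (range fun i => v (c i))) →
      (∀ e, ∃ N : ℕ, 1 ≤ N ∧ N • v e ∈ Submodule.span ℤ ((fun i => v (c i)) '' {i | p i})) →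
      ∀ M : ℝ, 1 ≤ M → ∀ m : ι → ℤ, (∀ e, |(m e : ℝ)| ≤ M) →
        ∃ z : κ → ℤ, ∑ i, z i • v (c i) = ∑ e, m e • v e ∧ (∀ i, p i → |(z i : ℝ)| ≤ C * M) ∧
          (∀ i, ¬ p i → |(z i : ℝ)| ≤ C) ∧
          ∀ (e : ι) (s : Finset κ), (∀ i ∈ s, c i = e) → ∑ i ∈ s, |(z i : ℝ)| ≤ C * M := by
  classical
  -- The family `c` matters only through the images `TU` of its two parts. There are finitely many
  -- such pairs, and those violating the hypotheses receive the constant `0`.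
  have key : ∀ TU : Finset ι × Finset ι, ∃ C : ℝ, 0 ≤ C ∧
      ((∀ e, v e ∈ Submodule.span ℤ (v '' TU.1) ⊔ Submodule.span ℤ (v '' TU.2)) →
      (∀ e, ∃ N : ℕ, 1 ≤ N ∧ N • v e ∈ Submodule.span ℤ (v '' TU.1)) →
      ∀ M : ℝ, 1 ≤ M → ∀ m : ι → ℤ, (∀ e, |(m e : ℝ)| ≤ M) →
      ∃ x y : ι → ℤ, ∑ e ∈ TU.1, x e • v e + ∑ e ∈ TU.2, y e • v e = ∑ e, m e • v e ∧
        (∀ e, |(x e : ℝ)| ≤ C * M) ∧ ∀ e, |(y e : ℝ)| ≤ C) := by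
    intro TU
    by_cases h1 : ∀ e, v e ∈ Submodule.span ℤ (v '' TU.1) ⊔ Submodule.span ℤ (v '' TU.2)
    · by_cases h2 : ∀ e, ∃ N : ℕ, 1 ≤ N ∧ N • v e ∈ Submodule.span ℤ (v '' TU.1)
      · obtain ⟨C, hC, H⟩ := exists_bounded_coeff_finset v TU.1 TU.2 h1 h2
        exact ⟨C, hC, fun _ _ => H⟩
      · exact ⟨0, le_rfl, fun _ h => absurd h h2⟩
    · exact ⟨0, le_rfl, fun h => absurd h h1⟩
  choose D hD0 hD using key
  have hsum : ∀ TU, D TU ≤ ∑ TU, D TU := fun TU =>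
    Finset.single_le_sum (fun TU _ => hD0 TU) (Finset.mem_univ TU)
  have hsum0 : 0 ≤ ∑ TU, D TU := Finset.sum_nonneg fun TU _ => hD0 TU
  -- The factor `2` serves the last bound, where a value `e` can be attained in both parts. That
  -- bound does not depend on how often `e` is repeated in the family.
  refine ⟨2 * ∑ TU, D TU, by positivity, fun κ _ c p hspan htors M hM m hm => ?_⟩
  set s := Finset.univ.filter p
  set s' := Finset.univ.filter fun i => ¬ p i
  have hT : v '' (s.image c : Finset ι) = (fun i => v (c i)) '' {i | p i} := by
    ext w; simp [s]
  have hU : v '' (s'.image c : Finset ι) = (fun i => v (c i)) '' {i | ¬ p i} := by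
    ext w; simp [s']
  obtain ⟨x, y, hxy, hx, hy⟩ := hD (s.image c, s'.image c) (fun e => by
    rw [← Submodule.span_union, hT, hU, ← image_union]
    have h : {i | p i} ∪ {i | ¬ p i} = univ := by ext i; simp [em]
    rw [h, image_univ]
    exact hspan e) (fun e => by rw [hT]; exact htors e) M hM m hm
  replace hx : ∀ e, |(x e : ℝ)| ≤ (∑ TU, D TU) * M := fun e =>
    (hx e).trans (mul_le_mul_of_nonneg_right (hsum _) (by linarith))
  replace hy : ∀ e, |(y e : ℝ)| ≤ ∑ TU, D TU := fun e => (hy e).trans (hsum _)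
  obtain ⟨z, hz, hzx, hze⟩ := exists_coeff_of_image v s c x
  obtain ⟨z', hz', hzx', hze'⟩ := exists_coeff_of_image v s' c y
  have hsM : ∑ TU, D TU ≤ (∑ TU, D TU) * M := le_mul_of_one_le_right hsum0 hM
  refine ⟨fun i => if p i then z i else z' i, ?_, fun i hi => ?_, fun i hi => ?_,
    fun e t ht => ?_⟩
  · rw [← Finset.sum_filter_add_sum_filter_not _ p, ← hxy, ← hz, ← hz']
    refine congrArg₂ (· + ·) ?_ ?_
    · exact Finset.sum_congr rfl fun i hi => by simp only [if_pos (Finset.mem_filter.1 hi).2]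
    · exact Finset.sum_congr rfl fun i hi => by simp only [if_neg (Finset.mem_filter.1 hi).2]
  · simp only [if_pos hi]
    have h1 : |(z i : ℝ)| ≤ |(x (c i) : ℝ)| := by exact_mod_cast hzx i
    have := hx (c i)
    nlinarith
  · simp only [if_neg hi]
    have h1 : |(z' i : ℝ)| ≤ |(y (c i) : ℝ)| := by exact_mod_cast hzx' i
    have := hy (c i)
    linarith
  · have h1 : ∑ i ∈ s with c i = e, |(z i : ℝ)| ≤ |(x e : ℝ)| := by exact_mod_cast hze e
    have h2 : ∑ i ∈ s' with c i = e, |(z' i : ℝ)| ≤ |(y e : ℝ)| := by exact_mod_cast hze' e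
    rw [← Finset.sum_filter_add_sum_filter_not t p]
    have h3 : ∑ i ∈ t with p i, |((if p i then z i else z' i : ℤ) : ℝ)| ≤
        ∑ i ∈ s with c i = e, |(z i : ℝ)| := by
      rw [Finset.sum_congr rfl (g := fun i => |(z i : ℝ)|)
        fun i hi => by rw [if_pos (Finset.mem_filter.1 hi).2]]
      refine Finset.sum_le_sum_of_subset_of_nonneg (fun i hi => ?_) fun _ _ _ => abs_nonneg _
      rw [Finset.mem_filter] at hi
      simp [s, hi.2, ht i hi.1]
    have h4 : ∑ i ∈ t with ¬ p i, |((if p i then z i else z' i : ℤ) : ℝ)| ≤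
        ∑ i ∈ s' with c i = e, |(z' i : ℝ)| := by
      rw [Finset.sum_congr rfl (g := fun i => |(z' i : ℝ)|)
        fun i hi => by rw [if_neg (Finset.mem_filter.1 hi).2]]
      refine Finset.sum_le_sum_of_subset_of_nonneg (fun i hi => ?_) fun _ _ _ => abs_nonneg _
      rw [Finset.mem_filter] at hi
      simp [s', hi.2, ht i hi.1]
    have := hx e
    have := hy e
    linarith

end IntegerCombinations

/-! ### Abelian invariants of words -/

namespace FormalCommutator

variable {G : Type*} [Group G] {k : ℕ}

section WordSum

variable {V : Type*} [AddCommGroup V]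

/-- The sum of the values of a function over the letters of a word. -/
def wordSum (ψ : FormalCommutator k → V) (L : List (FormalCommutator k)) : V := (L.map ψ).sum

/-- The power of a word with integer exponent. -/
def powWord (L : List (FormalCommutator k)) (x : ℤ) : List (FormalCommutator k) :=
  (List.replicate x.natAbs (if 0 ≤ x then L else wordInv L)).flatten

/-- The product of the powers `f b ^ x b` over a list of indices `b`. -/
def combWord {β : Type*} (l : List β) (f : β → List (FormalCommutator k)) (x : β → ℤ) :
    List (FormalCommutator k) := (l.map fun b => powWord (f b) (x b)).flatten

variable {ψ : FormalCommutator k → V} {L L' : List (FormalCommutator k)}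

@[simp] theorem wordSum_nil : wordSum ψ [] = 0 := rfl

@[simp] theorem wordSum_cons (c : FormalCommutator k) :
    wordSum ψ (c :: L) = ψ c + wordSum ψ L := by simp [wordSum]

@[simp] theorem wordSum_append : wordSum ψ (L ++ L') = wordSum ψ L + wordSum ψ L' := by
  simp [wordSum]

theorem wordSum_wordInv (hψ : ∀ c, ψ c.finv = -ψ c) : wordSum ψ (wordInv L) = -wordSum ψ L := by
  induction L with
  | nil => simp [wordInv]
  | cons c L ih =>
    have : wordInv (c :: L) = wordInv L ++ [c.finv] := by simp [wordInv]
    simp [this, ih, hψ, add_comm]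

theorem wordSum_powWord (hψ : ∀ c, ψ c.finv = -ψ c) (x : ℤ) :
    wordSum ψ (powWord L x) = x • wordSum ψ L := by
  have h : ∀ (q : ℕ) (L : List (FormalCommutator k)),
      wordSum ψ (List.replicate q L).flatten = q • wordSum ψ L := by
    intro q L
    induction q with
    | zero => simp
    | succ q ih => simp [List.replicate_succ, ih, succ_nsmul']
  rw [powWord, h]
  split
  · rename_i hx
    rw [← natCast_zsmul, Int.natAbs_of_nonneg hx]
  · rename_i hx
    rw [wordSum_wordInv hψ, ← natCast_zsmul, Int.ofNat_natAbs_of_nonpos (by omega), neg_smul_neg]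

theorem evalList_powWord (S : Fin k → G) (x : ℤ) : evalList S (powWord L x) = evalList S L ^ x := by
  have h : ∀ (q : ℕ) (L : List (FormalCommutator k)),
      evalList S (List.replicate q L).flatten = evalList S L ^ q := by
    intro q L
    induction q with
    | zero => simp
    | succ q ih => simp [List.replicate_succ, ih, pow_succ']
  rw [powWord, h]
  split
  · rename_i hx
    conv_rhs => rw [← Int.natAbs_of_nonneg hx, zpow_natCast]
  · rename_i hx
    have hx' : x = -(x.natAbs : ℤ) := by omega
    rw [evalList_wordInv]
    conv_rhs => rw [hx', zpow_neg, zpow_natCast]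
    rw [inv_pow]

theorem count_powWord_le (d : FormalCommutator k) (x : ℤ) :
    (powWord L x).count d ≤ x.natAbs * (L.count d + L.count d.finv) := by
  rw [powWord, List.count_flatten, List.map_replicate, List.sum_replicate, smul_eq_mul]
  refine Nat.mul_le_mul_left _ ?_
  split
  · omega
  · rw [count_wordInv]; omega

theorem mem_powWord {x : ℤ} {c : FormalCommutator k} (h : c ∈ powWord L x) :
    c ∈ L ∨ c.finv ∈ L := by
  rw [powWord, List.mem_flatten] at h
  obtain ⟨l, hl, hc⟩ := h
  rw [List.eq_of_mem_replicate hl] at hc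
  split at hc
  · exact Or.inl hc
  · exact Or.inr (mem_wordInv.1 hc)

variable {β : Type*} {l : List β} {f : β → List (FormalCommutator k)} {x : β → ℤ}

theorem wordSum_combWord (hψ : ∀ c, ψ c.finv = -ψ c) :
    wordSum ψ (combWord l f x) = (l.map fun b => x b • wordSum ψ (f b)).sum := by
  induction l with
  | nil => rfl
  | cons b l ih =>
    have : combWord (b :: l) f x = powWord (f b) (x b) ++ combWord l f x := by simp [combWord]
    simp [this, ih, wordSum_powWord hψ]

theorem evalList_combWord (S : Fin k → G) :
    evalList S (combWord l f x) = (l.map fun b => evalList S (f b) ^ x b).prod := by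
  induction l with
  | nil => rfl
  | cons b l ih =>
    have : combWord (b :: l) f x = powWord (f b) (x b) ++ combWord l f x := by simp [combWord]
    simp [this, ih, evalList_powWord]

theorem count_combWord_le (d : FormalCommutator k) : (combWord l f x).count d ≤
    (l.map fun b => (x b).natAbs * ((f b).count d + (f b).count d.finv)).sum := by
  induction l with
  | nil => simp [combWord]
  | cons b l ih =>
    have : combWord (b :: l) f x = powWord (f b) (x b) ++ combWord l f x := by simp [combWord]
    rw [this, List.count_append, List.map_cons, List.sum_cons]
    exact add_le_add (count_powWord_le d (x b)) ih

theorem forall_mem_combWord {P : FormalCommutator k → Prop} (hP : ∀ c, P c → P c.finv)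
    (hf : ∀ b ∈ l, ∀ c ∈ f b, P c) : ∀ c ∈ combWord l f x, P c := by
  intro c hc
  rw [combWord, List.mem_flatten] at hc
  obtain ⟨m, hm, hc⟩ := hc
  obtain ⟨b, hb, rfl⟩ := List.mem_map.1 hm
  rcases mem_powWord hc with h | h
  · exact hf b hb c h
  · have := hP _ (hf b hb _ h)
    rwa [finv_finv] at this

/-- For a fixed list of words `f b` only the exponents grow, and they are affordable as soon as `X`
is dominated by the weight of every letter that can occur. The `2` accounts for a letter and its
formal inverse. -/
theorem isBounded_combWord {φ : FormalCommutator k → ℝ} (hφ : IsMultiplicativeWeight φ) {n : ℕ}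
    {P : FormalCommutator k → Prop} (hP : ∀ c, P c → P c.finv) (hf : ∀ b ∈ l, ∀ c ∈ f b, P c)
    {X Y : ℝ} (hx : ∀ b ∈ l, |(x b : ℝ)| ≤ X) (hY : 0 ≤ Y)
    (hXY : ∀ c, P c → c.length ≤ n → X ≤ Y * φ c) :
    IsBounded n φ (Y * (l.map fun b => 2 * (f b).length).sum) (combWord l f x) := by
  intro d hd
  have hd0 := zero_le_one.trans (hφ.one_le d)
  by_cases hPd : P d
  · have h1 : ((combWord l f x).count d : ℝ) ≤
        ((l.map fun b => (x b).natAbs * ((f b).count d + (f b).count d.finv)).sum : ℕ) :=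
      Nat.cast_le.2 (count_combWord_le d)
    have h2 : (((l.map fun b => (x b).natAbs * ((f b).count d + (f b).count d.finv)).sum : ℕ) : ℝ) ≤
        (Y * φ d) * ((l.map fun b => 2 * (f b).length).sum : ℕ) := by
      clear h1 hf
      induction l with
      | nil => simp
      | cons b l ih =>
        have ih := ih fun b hb => hx b (List.mem_cons_of_mem _ hb)
        have hb := (hx b List.mem_cons_self).trans (hXY d hPd hd)
        rw [List.map_cons, List.sum_cons, List.map_cons, List.sum_cons, Nat.cast_add, Nat.cast_add,
          mul_add (Y * φ d)]
        refine add_le_add ?_ ih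
        push_cast
        have e : ((x b).natAbs : ℝ) = |(x b : ℝ)| := Nat.cast_natAbs (x b) |>.trans (by push_cast; rfl)
        have h3 := List.count_le_length (a := d) (l := f b)
        have h4 := List.count_le_length (a := d.finv) (l := f b)
        have h5 : ((f b).count d : ℝ) + (f b).count d.finv ≤ 2 * (f b).length := by
          exact_mod_cast (by omega : (f b).count d + (f b).count d.finv ≤ 2 * (f b).length)
        rw [e]
        exact mul_le_mul hb h5 (by positivity) (by positivity)
    refine (h1.trans h2).trans (le_of_eq (by ring))
  · have : (combWord l f x).count d = 0 :=
      List.count_eq_zero.2 fun h => hPd (forall_mem_combWord hP hf d h)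
    rw [this]
    simp only [Nat.cast_zero]
    positivity

/-- A word sum in terms of the numbers of occurrences of finitely many letters. -/
theorem wordSum_eq_sum_count {ι : Type*} [Fintype ι] (u : ι → FormalCommutator k)
    (hu : Function.Injective u) (hL : ∀ c ∈ L, ψ c ≠ 0 → c ∈ range u) :
    wordSum ψ L = ∑ e, (L.count (u e) : ℤ) • ψ (u e) := by
  induction L with
  | nil => simp
  | cons c L ih =>
    rw [wordSum_cons, ih fun d hd => hL d (List.mem_cons_of_mem _ hd)]
    have : ∑ e, ((c :: L).count (u e) : ℤ) • ψ (u e) =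
        ∑ e, (L.count (u e) : ℤ) • ψ (u e) + ∑ e, if c = u e then ψ (u e) else 0 := by
      rw [← Finset.sum_add_distrib]
      refine Finset.sum_congr rfl fun e _ => ?_
      rw [List.count_cons]
      by_cases h : c = u e
      · simp [h, add_smul]
      · simp [h]
    rw [this, add_comm]
    congr 1
    by_cases hc : ψ c = 0
    · rw [hc]
      refine (Finset.sum_eq_zero fun e _ => ?_).symm
      split
      · rename_i h; rw [← h, hc]
      · rfl
    · obtain ⟨e, rfl⟩ := hL c List.mem_cons_self hc
      rw [Finset.sum_eq_single e]
      · simp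
      · intro e' _ h
        rw [if_neg fun h' => h (hu h').symm]
      · simp

end WordSum

/-! ### Cancellation of letters against their inverses -/

section Net

/-- The signed number of occurrences of `d` and its formal inverse in the letter `c`. -/
noncomputable def net (d c : FormalCommutator k) : ℤ :=
  (if c = d then 1 else 0) - if c = d.finv then 1 else 0

theorem net_finv (d c : FormalCommutator k) : net d c.finv = -net d c := by
  simp [net, finv_eq_iff]

theorem wordSum_net (d : FormalCommutator k) (L : List (FormalCommutator k)) :
    wordSum (net d) L = (L.count d : ℤ) - L.count d.finv := by
  induction L with
  | nil => simp
  | cons c L ih =>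
    rw [wordSum_cons, ih, List.count_cons, List.count_cons, net]
    by_cases h1 : c = d <;> by_cases h2 : c = d.finv <;> simp [h1, h2] <;> ring

/-- Only brackets `[a, a]` are their own formal inverses. Their net count is always zero, which is
harmless because they are trivial in `G`. -/
theorem eval_eq_one_of_finv_eq (S : Fin k → G) {c : FormalCommutator k} (h : c.finv = c) :
    c.eval S = 1 := by
  rcases c with ⟨i, b⟩ | ⟨a, b⟩
  · simp [finv] at h
  · simp only [finv, bracket.injEq] at h
    simp [eval, h.1]

theorem evalList_eq_zpow (S : Fin k → G) {e : FormalCommutator k} {L : List (FormalCommutator k)}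
    (hL : ∀ c ∈ L, c = e ∨ c = e.finv) : evalList S L = e.eval S ^ wordSum (net e) L := by
  induction L with
  | nil => simp
  | cons c L ih =>
    rw [evalList_cons, wordSum_cons, ih fun d hd => hL d (List.mem_cons_of_mem _ hd), zpow_add]
    congr 1
    by_cases he : e.finv = e
    · have h1 := eval_eq_one_of_finv_eq S he
      have hc : c = e := by
        rcases hL c List.mem_cons_self with h | h
        · exact h
        · rw [h, he]
      rw [hc, h1, one_zpow]
    · rcases hL c List.mem_cons_self with rfl | rfl
      · have h2 : ¬ c = c.finv := fun h => he h.symm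
        simp [net, h2]
      · simp [net, he]

variable {S : Fin k → G} {n : ℕ}

/-- A word in commutators of index at least `j`, in which every commutator of index `j` occurs
as often as its inverse, can be rewritten as a word in commutators of larger index. -/
theorem mem_wordSet_of_net_eq_zero (S : Fin k → G) (n : ℕ) {idx : FormalCommutator k → ℕ}
    (hinv : ∀ c, idx c.finv = idx c) (hlt : ∀ a b, idx a < idx (bracket a b)) {j : ℕ}
    (l : List (FormalCommutator k)) {A : ℝ} (hA : 0 ≤ A) : ∃ C : ℝ, 0 ≤ C ∧
      ∀ φ : FormalCommutator k → ℝ, IsMultiplicativeWeight φ → ∀ L : List (FormalCommutator k),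
        IsBounded n φ A L → (∀ c ∈ L, j ≤ idx c) → (∀ c ∈ L, idx c = j → c ∈ l) →
        (∀ d, idx d = j → wordSum (net d) L = 0) →
        evalList S L ∈ wordSet S n φ (fun c => j + 1 ≤ idx c) C := by
  induction l generalizing A with
  | nil =>
    refine ⟨A, hA, fun φ hφ L hL hj hl _ => ⟨L, fun c hc => ?_, hL, rfl⟩⟩
    have h1 := hj c hc
    have h2 := hl c hc
    simp only [List.not_mem_nil, imp_false] at h2
    omega
  | cons e l ih =>
    obtain ⟨C, hC, H⟩ := ih (A := A * (1 + A) ^ n) (by positivity)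
    obtain ⟨C', hC', H'⟩ := ih hA
    refine ⟨max C C', by positivity, fun φ hφ L hL hj hl hnet => ?_⟩
    by_cases he : idx e = j
    -- Both `e` and `e.finv` are collected. The collected part is a power of `e` whose exponent is
    -- the net count, hence trivial, and the brackets created have index larger than `j`, so the
    -- other letters of index `j` keep their counts.
    · set p : FormalCommutator k → Bool := fun c => decide (c = e ∨ c = e.finv) with hp
      have hpinv : ∀ c, p c.finv = p c := fun c => by
        simp only [hp, finv_eq_iff, finv_finv, or_comm]
      have hfilter := filter_collectRest (p := p) (L := L) (P := fun c => j ≤ idx c)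
        (fun c => decide (idx c = j)) hj (fun y hy x _ => by
          have := hlt y x
          exact ⟨by omega, decide_eq_false (by omega)⟩)
      have hcount : ∀ d, idx d = j →
          (collectRest p L).count d = if p d then 0 else L.count d := by
        intro d hd
        have h1 : ((collectRest p L).filter fun c => decide (idx c = j)).count d =
            (collectRest p L).count d := List.count_filter (by simpa using hd)
        rw [← h1, hfilter]
        split
        · rename_i hpd
          refine List.count_eq_zero.2 fun h => ?_
          simp [hpd] at h
        · rename_i hpd
          exact List.count_filter (by simp [hd, hpd])
      have hone : evalList S (L.filter p) = 1 := by
        rw [evalList_eq_zpow S (e := e) fun c hc => by simpa [hp] using (List.mem_filter.1 hc).2]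
        have h1 : wordSum (net e) (L.filter p) = wordSum (net e) L := by
          rw [wordSum_net, wordSum_net, List.count_filter (by simp [hp]),
            List.count_filter (by simp [hp])]
        rw [h1, hnet e he, zpow_zero]
      rw [evalList_collect S p L, hone, one_mul]
      refine wordSet_mono hφ (fun _ h => h) (le_max_left _ _) (H φ hφ _
        ((IsBounded.conjWord hφ hA hA hL hL).sublist (collectRest_sublist p L)) ?_ ?_ ?_)
      · exact forall_mem_collectRest (Q := fun _ => True) (fun c hc _ => hj c hc)
          (fun _ _ _ => trivial) fun y hy x _ => by have := hlt y x; omega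
      · intro c hc hcj
        have h1 : (collectRest p L).count c ≠ 0 := fun h => List.count_eq_zero.1 h hc
        rw [hcount c hcj] at h1
        have h2 : ¬ p c = true := fun h => h1 (if_pos h)
        rw [if_neg h2] at h1
        have h3 : c ∈ L := by
          by_contra h
          exact h1 (List.count_eq_zero.2 h)
        refine (List.mem_cons.1 (hl c h3 hcj)).resolve_left fun h => h2 ?_
        simp [hp, h]
      · intro d hd
        rw [wordSum_net, hcount d hd, hcount d.finv (by rw [hinv, hd]), hpinv]
        split
        · simp
        · rw [← wordSum_net, hnet d hd]
    · refine wordSet_mono hφ (fun _ h => h) (le_max_right _ _) (H' φ hφ L hL hj ?_ hnet)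
      intro c hc hcj
      exact (List.mem_cons.1 (hl c hc hcj)).resolve_left fun h => he (h ▸ hcj)

end Net

end FormalCommutator

/-! ### The index and the graded pieces of the filtration -/

namespace FormalCommutator

variable {G : Type*} [Group G] {k d : ℕ}

theorem weight_finv (w : WeightSystem k d) (c : FormalCommutator k) :
    w.weight c.finv = w.weight c := by
  cases c
  · rfl
  · exact add_comm _ _

theorem index_finv (w : WeightSystem k d) (c : FormalCommutator k) : w.index c.finv = w.index c := by
  rw [WeightSystem.index, WeightSystem.index, weight_finv]

theorem one_le_index (w : WeightSystem k d) (c : FormalCommutator k) : 1 ≤ w.index c :=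
  (Set.ncard_pos (w.finite_values_le _)).2 ⟨w.weight c, ⟨c, rfl⟩, le_rfl⟩

/-- By compatibility, the order of the weights is the preorder `F_b = O(F_c)`. The index of `c`
counts the distinct lower sets generated by the elements below `c`, which involves `F` alone. -/
theorem index_eq_of_isCompatible {d' : ℕ} {F : WeightFunctionSystem k} {w : WeightSystem k d}
    {w' : WeightSystem k d'} (h : F.IsCompatible w) (h' : F.IsCompatible w') :
    w.index = w'.index := by
  have key : ∀ {d : ℕ} (w : WeightSystem k d), F.IsCompatible w → ∀ c, w.index c =
      ((fun b => {a | ∃ C : ℝ, 1 ≤ C ∧ ∀ r, 1 ≤ r → F.weightFun a r ≤ C * F.weightFun b r}) ''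
        {b | ∃ C : ℝ, 1 ≤ C ∧ ∀ r, 1 ≤ r → F.weightFun b r ≤ C * F.weightFun c r}).ncard := by
    intro d w hw c
    have e1 : {b | ∃ C : ℝ, 1 ≤ C ∧ ∀ r, 1 ≤ r → F.weightFun b r ≤ C * F.weightFun c r} =
        {b | w.weight b ≤ w.weight c} := by
      ext b; exact (hw b c).symm
    have e2 : (fun b => {a | ∃ C : ℝ, 1 ≤ C ∧ ∀ r, 1 ≤ r →
        F.weightFun a r ≤ C * F.weightFun b r}) = fun b => {a | w.weight a ≤ w.weight b} := by
      ext b a; exact (hw a b).symm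
    have e3 : (fun b => {a | w.weight a ≤ w.weight b}) '' {b | w.weight b ≤ w.weight c} =
        (fun v => {a | w.weight a ≤ v}) '' {v | v ∈ range w.weight ∧ v ≤ w.weight c} := by
      ext s
      constructor
      · rintro ⟨b, hb, rfl⟩
        exact ⟨w.weight b, ⟨⟨b, rfl⟩, hb⟩, rfl⟩
      · rintro ⟨_, ⟨⟨b, rfl⟩, hb⟩, rfl⟩
        exact ⟨b, hb, rfl⟩
    rw [e1, e2, e3, WeightSystem.index, Set.InjOn.ncard_image]
    rintro _ ⟨⟨a, rfl⟩, _⟩ _ ⟨⟨b, rfl⟩, _⟩ hab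
    have h1 : a ∈ {x | w.weight x ≤ w.weight b} :=
      (Set.ext_iff.1 hab a).1 (le_refl (w.weight a))
    have h2 : b ∈ {x | w.weight x ≤ w.weight a} :=
      (Set.ext_iff.1 hab b).2 (le_refl (w.weight b))
    exact le_antisymm h1 h2
  funext c
  rw [key w h, key w' h']

section Graded

variable (S : Fin k → G) (hS : Subgroup.closure (range S) = ⊤) (w : WeightSystem k d) (j : ℕ)

theorem mem_closure_eval_iff (X : Set (FormalCommutator k)) (g : G) :
    g ∈ Subgroup.closure (eval S '' X) ↔
      ∃ L : List (FormalCommutator k), (∀ c ∈ L, c ∈ X ∨ c.finv ∈ X) ∧ evalList S L = g := by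
  constructor
  · intro hg
    induction hg using Subgroup.closure_induction with
    | mem x hx =>
      obtain ⟨c, hc, rfl⟩ := hx
      exact ⟨[c], by simp [hc], by simp⟩
    | one => exact ⟨[], by simp, rfl⟩
    | mul x y _ _ hx hy =>
      obtain ⟨L, hL, rfl⟩ := hx
      obtain ⟨L', hL', rfl⟩ := hy
      refine ⟨L ++ L', fun c hc => ?_, evalList_append _ _ _⟩
      rcases List.mem_append.1 hc with h | h
      exacts [hL c h, hL' c h]
    | inv x _ hx =>
      obtain ⟨L, hL, rfl⟩ := hx
      refine ⟨wordInv L, fun c hc => ?_, evalList_wordInv _ _⟩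
      have := hL _ (mem_wordInv.1 hc)
      rwa [finv_finv, or_comm] at this
  · rintro ⟨L, hL, rfl⟩
    induction L with
    | nil => exact one_mem _
    | cons c L ih =>
      rw [evalList_cons]
      refine mul_mem ?_ (ih fun d hd => hL d (List.mem_cons_of_mem _ hd))
      rcases hL c List.mem_cons_self with h | h
      · exact Subgroup.subset_closure ⟨c, h, rfl⟩
      · rw [← finv_finv c, eval_finv]
        exact inv_mem (Subgroup.subset_closure ⟨_, h, rfl⟩)

theorem mem_weightFiltration_iff (g : G) : g ∈ weightFiltration S w j ↔
    ∃ L : List (FormalCommutator k), (∀ c ∈ L, j ≤ w.index c) ∧ evalList S L = g := by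
  rw [weightFiltration, mem_closure_eval_iff]
  simp only [mem_ofPred_eq, index_finv, or_self]

/-- The class of a formal commutator in the `j`-th graded piece. -/
noncomputable def gradedClass (c : FormalCommutator k) : Additive (GradedPiece S w j) :=
  if h : j ≤ w.index c then
    Additive.ofMul (QuotientGroup.mk ⟨c.eval S, eval_mem_weightFiltration S w h⟩)
  -- The default value is neutral, so `gradedClass` is odd under `finv` without a condition on the
  -- index.
  else Additive.ofMul (QuotientGroup.mk 1)

theorem gradedClass_finv (c : FormalCommutator k) :
    letI := gradedPieceCommGroup S hS w j
    gradedClass S w j c.finv = -gradedClass S w j c := by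
  let := gradedPieceCommGroup S hS w j
  have := weightFiltration_normal S hS w (j + 1)
  by_cases h : j ≤ w.index c
  · have h' : j ≤ w.index c.finv := by rwa [index_finv]
    rw [gradedClass, gradedClass, dif_pos h, dif_pos h']
    have e : (⟨c.finv.eval S, eval_mem_weightFiltration S w h'⟩ : weightFiltration S w j) =
      (⟨c.eval S, eval_mem_weightFiltration S w h⟩)⁻¹ := Subtype.ext (eval_finv S c)
    rw [e]
    rfl
  · have h' : ¬ j ≤ w.index c.finv := by rwa [index_finv]
    rw [gradedClass, gradedClass, dif_neg h, dif_neg h']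
    exact (neg_zero (G := Additive (GradedPiece S w j))).symm

theorem exists_mk_evalList_eq {L : List (FormalCommutator k)} (hL : ∀ c ∈ L, j ≤ w.index c) :
    letI := gradedPieceCommGroup S hS w j
    ∃ h : evalList S L ∈ weightFiltration S w j,
      (Additive.ofMul (QuotientGroup.mk ⟨evalList S L, h⟩) : Additive (GradedPiece S w j)) =
        wordSum (gradedClass S w j) L := by
  let := gradedPieceCommGroup S hS w j
  have := weightFiltration_normal S hS w (j + 1)
  induction L with
  | nil => exact ⟨one_mem _, rfl⟩
  | cons c L ih =>
    obtain ⟨h, e⟩ := ih fun d hd => hL d (List.mem_cons_of_mem _ hd)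
    have hc := hL c List.mem_cons_self
    refine ⟨by rw [evalList_cons]; exact mul_mem (eval_mem_weightFiltration S w hc) h, ?_⟩
    rw [wordSum_cons, ← e, gradedClass, dif_pos hc]
    simp only [evalList_cons]
    rfl

/-- Turns membership in the next subgroup into a linear condition on the letters of the word. -/
theorem evalList_mem_weightFiltration_succ_iff {L : List (FormalCommutator k)}
    (hL : ∀ c ∈ L, j ≤ w.index c) :
    letI := gradedPieceCommGroup S hS w j
    evalList S L ∈ weightFiltration S w (j + 1) ↔ wordSum (gradedClass S w j) L = 0 := by
  let := gradedPieceCommGroup S hS w j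
  have := weightFiltration_normal S hS w (j + 1)
  obtain ⟨h, e⟩ := exists_mk_evalList_eq S hS w j hL
  rw [← e]
  have h1 : (Additive.ofMul (QuotientGroup.mk ⟨evalList S L, h⟩) : Additive (GradedPiece S w j)) = 0
      ↔ (QuotientGroup.mk ⟨evalList S L, h⟩ : GradedPiece S w j) = 1 := Iff.rfl
  rw [h1, QuotientGroup.eq_one_iff, Subgroup.mem_subgroupOf]

theorem gradedClass_eq_zero {c : FormalCommutator k} (hc : j ≤ w.index c)
    (h : c.eval S ∈ weightFiltration S w (j + 1)) :
    letI := gradedPieceCommGroup S hS w j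
    gradedClass S w j c = 0 := by
  let := gradedPieceCommGroup S hS w j
  have := (evalList_mem_weightFiltration_succ_iff S hS w j (L := [c]) (by simpa using hc)).1
    (by simpa using h)
  simpa using this

theorem wordSum_mem_span {V : Type*} [AddCommGroup V] {ψ : FormalCommutator k → V}
    (hψ : ∀ c, ψ c.finv = -ψ c) {X : Set (FormalCommutator k)} {L : List (FormalCommutator k)}
    (hL : ∀ c ∈ L, c ∈ X ∨ c.finv ∈ X) : wordSum ψ L ∈ Submodule.span ℤ (ψ '' X) := by
  induction L with
  | nil => exact zero_mem _
  | cons c L ih =>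
    rw [wordSum_cons]
    refine add_mem ?_ (ih fun d hd => hL d (List.mem_cons_of_mem _ hd))
    rcases hL c List.mem_cons_self with h | h
    · exact Submodule.subset_span ⟨c, h, rfl⟩
    · rw [← finv_finv c, hψ]
      exact neg_mem (Submodule.subset_span ⟨_, h, rfl⟩)

theorem exists_wordSum_eq_of_mem_span {V : Type*} [AddCommGroup V] {ψ : FormalCommutator k → V}
    (hψ : ∀ c, ψ c.finv = -ψ c) {X : Set (FormalCommutator k)} {v : V}
    (hv : v ∈ Submodule.span ℤ (ψ '' X)) :
    ∃ L : List (FormalCommutator k), (∀ c ∈ L, c ∈ X ∨ c.finv ∈ X) ∧ wordSum ψ L = v := by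
  induction hv using Submodule.span_induction with
  | mem x hx =>
    obtain ⟨c, hc, rfl⟩ := hx
    exact ⟨[c], by simp [hc], by simp⟩
  | zero => exact ⟨[], by simp, rfl⟩
  | add x y _ _ hx hy =>
    obtain ⟨L, hL, rfl⟩ := hx
    obtain ⟨L', hL', rfl⟩ := hy
    refine ⟨L ++ L', fun c hc => ?_, wordSum_append⟩
    rcases List.mem_append.1 hc with h | h
    exacts [hL c h, hL' c h]
  | smul a x _ hx =>
    obtain ⟨L, hL, rfl⟩ := hx
    refine ⟨powWord L a, fun c hc => ?_, wordSum_powWord hψ a⟩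
    rcases mem_powWord hc with h | h
    · exact hL c h
    · have := hL _ h
      rwa [finv_finv, or_comm] at this

/-- Spanning in the graded piece, expressed in the group. -/
theorem smul_gradedClass_mem_span_iff {X : Set (FormalCommutator k)} (hX : ∀ c ∈ X, w.index c = j)
    {e : FormalCommutator k} (he : j ≤ w.index e) (N : ℕ) :
    letI := gradedPieceCommGroup S hS w j
    N • gradedClass S w j e ∈ Submodule.span ℤ (gradedClass S w j '' X) ↔
      e.eval S ^ N ∈ Subgroup.closure (eval S '' X) ⊔ weightFiltration S w (j + 1) := by
  let := gradedPieceCommGroup S hS w j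
  have := weightFiltration_normal S hS w (j + 1)
  have hψ := gradedClass_finv S hS w j
  have hXj : ∀ L : List (FormalCommutator k), (∀ c ∈ L, c ∈ X ∨ c.finv ∈ X) →
      ∀ c ∈ wordInv L ++ List.replicate N e, j ≤ w.index c := by
    intro L hL c hc
    rcases List.mem_append.1 hc with h | h
    · rcases hL _ (mem_wordInv.1 h) with h | h
      · rw [← index_finv, hX _ h]
      · rw [finv_finv] at h; rw [hX _ h]
    · rwa [List.eq_of_mem_replicate h]
  have hsum : ∀ L : List (FormalCommutator k),
      wordSum (gradedClass S w j) (wordInv L ++ List.replicate N e) =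
        -wordSum (gradedClass S w j) L + N • gradedClass S w j e := by
    intro L
    rw [wordSum_append, wordSum_wordInv hψ]
    congr 1
    rw [wordSum, List.map_replicate, List.sum_replicate]
  have heval : ∀ L : List (FormalCommutator k),
      evalList S (wordInv L ++ List.replicate N e) = (evalList S L)⁻¹ * e.eval S ^ N := by
    intro L
    rw [evalList_append, evalList_wordInv, evalList_replicate]
  constructor
  · intro h
    obtain ⟨L, hL, hLe⟩ := exists_wordSum_eq_of_mem_span hψ h
    have h1 := (evalList_mem_weightFiltration_succ_iff S hS w j (hXj L hL)).2 (by
      rw [hsum, hLe, neg_add_cancel])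
    rw [heval] at h1
    have h2 := Subgroup.mul_mem_sup ((mem_closure_eval_iff S X _).2 ⟨L, hL, rfl⟩) h1
    rwa [mul_inv_cancel_left] at h2
  · intro h
    obtain ⟨x, hx, y, hy, hxy⟩ := Subgroup.mem_sup_of_normal_right.1 h
    obtain ⟨L, hL, rfl⟩ := (mem_closure_eval_iff S X _).1 hx
    have h1 := (evalList_mem_weightFiltration_succ_iff S hS w j (hXj L hL)).1 (by
      rw [heval, ← hxy, inv_mul_cancel_left]; exact hy)
    rw [hsum, neg_add_eq_zero] at h1
    rw [← h1]
    exact wordSum_mem_span hψ hL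

end Graded

end FormalCommutator

/-! ### Respelling words of the next subgroup -/

namespace FormalCommutator

variable {G : Type*} [Group G] {k d : ℕ}

/-- Multiplicative weights that are monotone in the index up to a constant, on the formal
commutators of length at most `n`. -/
structure IsMonotoneWeight (n : ℕ) (idx : FormalCommutator k → ℕ) (D : ℝ)
    (φ : FormalCommutator k → ℝ) : Prop extends IsMultiplicativeWeight φ where
  le_mul : ∀ c c', idx c ≤ idx c' → c.length ≤ n → c'.length ≤ n → φ c ≤ D * φ c'

theorem finite_level (n : ℕ) (idx : FormalCommutator k → ℕ) (j : ℕ) :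
    Finite {e : FormalCommutator k // idx e = j ∧ e.length ≤ n} :=
  ((finite_length_le k n).subset fun _ h => h.2 : {e | idx e = j ∧ e.length ≤ n}.Finite)

theorem wordSum_combWord_univ {V ι : Type*} [AddCommGroup V] [Fintype ι]
    {ψ : FormalCommutator k → V} (hψ : ∀ c, ψ c.finv = -ψ c) (u : ι → FormalCommutator k)
    (x : ι → ℤ) : wordSum ψ (combWord Finset.univ.toList (fun e => [u e]) x) =
      ∑ e, x e • ψ (u e) := by
  rw [wordSum_combWord hψ, Finset.sum_map_toList]
  simp

section Level

variable {n j : ℕ} {idx : FormalCommutator k → ℕ} {D : ℝ} {φ : FormalCommutator k → ℝ}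
  [Fintype {e : FormalCommutator k // idx e = j ∧ e.length ≤ n}]

/-- The size of the weights at a level. -/
def levelSize (n j : ℕ) (idx : FormalCommutator k → ℕ)
    [Fintype {e : FormalCommutator k // idx e = j ∧ e.length ≤ n}]
    (φ : FormalCommutator k → ℝ) : ℝ :=
  -- The summand `1` keeps the size at least `1` even if the level is empty.
  1 + ∑ e : {e : FormalCommutator k // idx e = j ∧ e.length ≤ n}, φ e

theorem one_le_levelSize (hφ : IsMonotoneWeight n idx D φ) : 1 ≤ levelSize n j idx φ :=
  le_add_of_nonneg_right (Finset.sum_nonneg fun e _ => zero_le_one.trans (hφ.one_le e.1))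

theorem le_levelSize (hφ : IsMonotoneWeight n idx D φ)
    (e : {e : FormalCommutator k // idx e = j ∧ e.length ≤ n}) : φ e ≤ levelSize n j idx φ := by
  have := Finset.single_le_sum
    (f := fun e : {e : FormalCommutator k // idx e = j ∧ e.length ≤ n} => φ e)
    (fun e _ => zero_le_one.trans (hφ.one_le e.1)) (Finset.mem_univ e)
  rw [levelSize]
  linarith

/-- One number controls the whole level: up to a constant it is at most the weight of any commutator
at this level or above. -/
theorem levelSize_le (hφ : IsMonotoneWeight n idx D φ) {c : FormalCommutator k} (hj : j ≤ idx c)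
    (hc : c.length ≤ n) : levelSize n j idx φ ≤
      (1 + Fintype.card {e : FormalCommutator k // idx e = j ∧ e.length ≤ n} * D) * φ c := by
  have h1 : ∑ e : {e : FormalCommutator k // idx e = j ∧ e.length ≤ n}, φ e ≤
      ∑ _e : {e : FormalCommutator k // idx e = j ∧ e.length ≤ n}, D * φ c :=
    Finset.sum_le_sum fun e _ => hφ.le_mul e c (e.2.1.trans_le hj) e.2.2 hc
  rw [Finset.sum_const, nsmul_eq_mul, Finset.card_univ] at h1
  have := hφ.one_le c
  rw [levelSize]
  linarith

end Level

section Core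

variable (S : Fin k → G) (w : WeightSystem k d)
  {n : ℕ}

/-- Leaves finitely many commutators to consider in each graded piece. -/
theorem gradedClass_eq_zero_of_notMem (hS : Subgroup.closure (range S) = ⊤) (j : ℕ) {c : FormalCommutator k} (hc : j ≤ w.index c)
    (h : c ∉ range (Subtype.val : {e : FormalCommutator k // w.index e = j ∧ e.length ≤ n} → _))
    (hn : ∀ c : FormalCommutator k, n < c.length → c.eval S = 1) :
    letI := gradedPieceCommGroup S hS w j
    gradedClass S w j c = 0 := by
  refine gradedClass_eq_zero S hS w j hc ?_
  by_cases h1 : w.index c = j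
  · have h2 : ¬ c.length ≤ n := fun h2 => h ⟨⟨c, h1, h2⟩, rfl⟩
    rw [hn c (by omega)]
    exact one_mem _
  · exact eval_mem_weightFiltration S w (by omega)

/-- Bounded words of level `j` with value in the next subgroup are bounded words of level
`j + 1`. -/
theorem mem_wordSet_succ (hn : ∀ c : FormalCommutator k, n < c.length → c.eval S = 1)
    (hS : Subgroup.closure (range S) = ⊤) (j : ℕ) {A D : ℝ} (hA : 0 ≤ A) (hD : 0 ≤ D) : ∃ C : ℝ, 0 ≤ C ∧
    ∀ φ, IsMonotoneWeight n w.index D φ → ∀ g ∈ wordSet S n φ (fun c => j ≤ w.index c) A,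
      g ∈ weightFiltration S w (j + 1) → g ∈ wordSet S n φ (fun c => j + 1 ≤ w.index c) C := by
  let := gradedPieceCommGroup S hS w j
  have hψ := gradedClass_finv S hS w j
  have hfin := finite_level n w.index j
  let : Fintype {e : FormalCommutator k // w.index e = j ∧ e.length ≤ n} := Fintype.ofFinite _
  set u : {e : FormalCommutator k // w.index e = j ∧ e.length ≤ n} → FormalCommutator k :=
    Subtype.val with hu
  obtain ⟨q, l, C₀, hC₀, hl, hrel⟩ := exists_bounded_relations fun e => gradedClass S w j (u e)
  set W : Fin q → List (FormalCommutator k) :=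
    fun i => combWord Finset.univ.toList (fun e => [u e]) (l i) with hW
  have hWmem : ∀ i, ∀ c ∈ W i, w.index c = j ∧ c.length ≤ n := fun i =>
    forall_mem_combWord (P := fun c => w.index c = j ∧ c.length ≤ n)
      (fun c hc => by rwa [index_finv, length_finv]) fun e _ c hc => by
        rw [List.mem_singleton] at hc; rw [hc]; exact e.2
  have hWK : ∀ i, evalList S (W i) ∈ weightFiltration S w (j + 1) := fun i =>
    (evalList_mem_weightFiltration_succ_iff S hS w j fun c hc => (hWmem i c hc).1.ge).2
      (by rw [hW, wordSum_combWord_univ hψ]; exact hl i)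
  -- Each basic relation gets a fixed spelling `W' i` one level up. No control of its length is
  -- needed, since there are finitely many relations, chosen before `φ`.
  have hL' : ∀ i, ∃ L : List (FormalCommutator k), (∀ c ∈ L, j + 1 ≤ w.index c) ∧
      evalList S L = evalList S (W i) := fun i => (mem_weightFiltration_iff S w (j + 1) _).1 (hWK i)
  choose W' hW'mem hW'eval using hL'
  set K : ℝ := 1 + Fintype.card {e : FormalCommutator k // w.index e = j ∧ e.length ≤ n} * D
  have hK : 0 ≤ K := by positivity
  -- `A` bounds the given word `L`, the second summand the correction `Q` built from the words `W
  -- i`.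
  set B := A + C₀ * A * K * ((Finset.univ : Finset (Fin q)).toList.map
    fun i => 2 * (W i).length).sum with hB
  have hB0 : 0 ≤ B := by positivity
  set B' := C₀ * A * K * ((Finset.univ : Finset (Fin q)).toList.map
    fun i => 2 * (W' i).length).sum with hB'
  have hB'0 : 0 ≤ B' := by positivity
  obtain ⟨C₁, hC₁, H⟩ := mem_wordSet_of_net_eq_zero S n (index_finv w) w.index_lt_index_bracket
    (j := j) (Finset.univ.toList.map u) hB0
  refine ⟨C₁ + B', by positivity, fun φ hφ g hg hgK => ?_⟩
  obtain ⟨L, hLmem, hLb, rfl⟩ := wordSet_and_length_le hn hg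
  have hφ' := hφ.toIsMultiplicativeWeight
  have hLu : ∀ c ∈ L, w.index c = j → c ∈ range u := fun c hc hcj =>
    ⟨⟨c, hcj, (hLmem c hc).2⟩, rfl⟩
  have hX : ∀ e, |(((L.count (u e) : ℕ) : ℤ) : ℝ)| ≤ A * levelSize n j w.index φ := fun e => by
    rw [Int.cast_natCast, abs_of_nonneg (Nat.cast_nonneg _)]
    exact (hLb (u e) e.2.2).trans (mul_le_mul_of_nonneg_left (le_levelSize hφ e) hA)
  have hsum0 : ∑ e, ((L.count (u e) : ℕ) : ℤ) • gradedClass S w j (u e) = 0 := by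
    rw [← wordSum_eq_sum_count u Subtype.val_injective]
    · exact (evalList_mem_weightFiltration_succ_iff S hS w j fun c hc => (hLmem c hc).1).1 hgK
    · intro c hc hne
      by_contra h
      exact hne (gradedClass_eq_zero_of_notMem S w hS j (hLmem c hc).1 h hn)
  obtain ⟨κ, hκ, hκb⟩ := hrel _ (fun e => ((L.count (u e) : ℕ) : ℤ)) hX hsum0
  have hbd : ∀ c, j ≤ w.index c → c.length ≤ n →
      C₀ * (A * levelSize n j w.index φ) ≤ C₀ * A * K * φ c := fun c hcj hcn => by
    have := mul_le_mul_of_nonneg_left (levelSize_le hφ hcj hcn) (mul_nonneg hC₀ hA)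
    calc _ = C₀ * A * levelSize n j w.index φ := by ring
      _ ≤ _ := this
      _ = _ := by ring
  have hκb' : ∀ i, |((-κ i : ℤ) : ℝ)| ≤ C₀ * (A * levelSize n j w.index φ) := fun i => by
    rw [Int.cast_neg, abs_neg]; exact hκb i
  -- `Q` cancels the letter counts of `L` at level `j`, and `Q'` has the same value but is spelled
  -- one level up. The same exponents are affordable for both, because the size of level `j` is
  -- dominated by the weights at all levels from `j` on.
  set Q := combWord (Finset.univ : Finset (Fin q)).toList W fun i => -κ i with hQ
  set Q' := combWord (Finset.univ : Finset (Fin q)).toList W' fun i => -κ i with hQ'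
  have hQmem : ∀ c ∈ Q, w.index c = j ∧ c.length ≤ n :=
    forall_mem_combWord (P := fun c => w.index c = j ∧ c.length ≤ n)
      (fun c hc => by rwa [index_finv, length_finv]) fun i _ c hc => hWmem i c hc
  have hQb : IsBounded n φ B (L ++ Q) := hLb.append
    (isBounded_combWord hφ' (P := fun c => j ≤ w.index c) (fun c hc => by rwa [index_finv])
      (fun i _ c hc => (hWmem i c hc).1.ge) (fun i _ => hκb' i) (by positivity) hbd)
  have hQ'mem : evalList S Q' ∈ wordSet S n φ (fun c => j + 1 ≤ w.index c) B' :=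
    ⟨Q', forall_mem_combWord (P := fun c => j + 1 ≤ w.index c)
      (fun c hc => by rwa [index_finv]) (fun i _ c hc => hW'mem i c hc),
      isBounded_combWord hφ' (P := fun c => j + 1 ≤ w.index c) (fun c hc => by rwa [index_finv])
      (fun i _ c hc => hW'mem i c hc) (fun i _ => hκb' i) (by positivity)
      fun c hcj => hbd c (by omega), rfl⟩
  have hQQ' : evalList S Q = evalList S Q' := by
    rw [hQ, hQ', evalList_combWord, evalList_combWord]
    simp only [hW'eval]
  have hmain := H φ hφ' (L ++ Q) hQb (fun c hc => ?_) (fun c hc hcj => ?_) (fun d hd => ?_)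
  · have h1 := mul_mem_wordSet hmain
      (inv_mem_wordSet hφ' (fun c hc => by rwa [index_finv]) hQ'mem)
    rwa [evalList_append, hQQ', mul_inv_cancel_right] at h1
  · rcases List.mem_append.1 hc with h | h
    · exact (hLmem c h).1
    · exact (hQmem c h).1.ge
  · have h : c.length ≤ n := by
      rcases List.mem_append.1 hc with h | h
      · exact (hLmem c h).2
      · exact (hQmem c h).2
    exact List.mem_map.2 ⟨⟨c, hcj, h⟩, by simp, rfl⟩
  · have hneg : ∀ c, net d c.finv = -net d c := net_finv d
    rw [wordSum_append, hQ, wordSum_combWord hneg, Finset.sum_map_toList,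
      wordSum_eq_sum_count u Subtype.val_injective]
    · simp only [hW, wordSum_combWord_univ hneg]
      have h1 : ∀ e, ((L.count (u e) : ℕ) : ℤ) = ∑ i, κ i * l i e := fun e => by
        have := congrFun hκ e
        simpa [Finset.sum_apply] using this
      simp only [h1, smul_eq_mul, Finset.sum_mul, Finset.mul_sum]
      rw [Finset.sum_comm, ← Finset.sum_add_distrib]
      refine Finset.sum_eq_zero fun i _ => ?_
      rw [← Finset.sum_add_distrib]
      exact Finset.sum_eq_zero fun e _ => by ring
    · intro c hc hne
      refine hLu c hc ?_
      by_cases h1 : c = d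
      · rw [h1, hd]
      by_cases h2 : c = d.finv
      · rw [h2, index_finv, hd]
      · simp [net, h1, h2] at hne

end Core

end FormalCommutator

/-! ### Normal forms along an adapted tuple -/

namespace FormalCommutator

variable {G : Type*} [Group G] {k d : ℕ}

section Core

variable (S : Fin k → G) (w : WeightSystem k d) {n : ℕ}

theorem sum_eq_sum_subtype_of_support {ι β : Type*} [Fintype ι] [AddCommMonoid β] (p : ι → Prop)
    [DecidablePred p] (f : ι → β) (hf : ∀ i, ¬ p i → f i = 0) :
    ∑ i, f i = ∑ i : {i : ι // p i}, f i.1 := by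
  rw [← Finset.sum_subtype (Finset.univ.filter p) (by simp) f]
  exact (Finset.sum_filter_of_ne fun i _ h => by_contra fun h' => h (hf i h')).symm

/-- Words of level `j` are products of powers of an adapted family, up to words of level `j + 1`. -/
theorem exists_level_step (hn : ∀ c : FormalCommutator k, n < c.length → c.eval S = 1)
    (hS : Subgroup.closure (range S) = ⊤) (j : ℕ) {A D : ℝ} (hA : 0 ≤ A) (hD : 0 ≤ D) :
    ∃ C : ℝ, 0 ≤ C ∧ ∀ φ, IsMonotoneWeight n w.index D φ →
      ∀ (t : ℕ) (c : Fin t → FormalCommutator k) (p : Fin t → Prop),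
      (∀ e, w.index e = j → e.eval S ∈ Subgroup.closure
        (eval S '' {x | ∃ i, c i = x ∧ w.index (c i) = j}) ⊔ weightFiltration S w (j + 1)) →
      (∀ e, w.index e = j → ∃ N : ℕ, 1 ≤ N ∧ e.eval S ^ N ∈ Subgroup.closure
        (eval S '' {x | ∃ i, p i ∧ c i = x ∧ w.index (c i) = j}) ⊔ weightFiltration S w (j + 1)) →
      ∀ g ∈ wordSet S n φ (fun c => j ≤ w.index c) A,
        ∃ z : Fin t → ℤ, (∀ i, z i ≠ 0 → w.index (c i) = j ∧ (c i).length ≤ n) ∧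
          (∀ i, p i → |(z i : ℝ)| ≤ C * φ (c i)) ∧ (∀ i, ¬ p i → |(z i : ℝ)| ≤ C) ∧
          ∃ h ∈ wordSet S n φ (fun c => j + 1 ≤ w.index c) C,
            g = (List.ofFn fun i => (c i).eval S ^ z i).prod * h := by
  classical
  let := gradedPieceCommGroup S hS w j
  have hψ := gradedClass_finv S hS w j
  have hfin := finite_level n w.index j
  let : Fintype {e : FormalCommutator k // w.index e = j ∧ e.length ≤ n} := Fintype.ofFinite _
  obtain ⟨C₀, hC₀, hcoef⟩ := exists_bounded_coeff
    fun e : {e : FormalCommutator k // w.index e = j ∧ e.length ≤ n} => gradedClass S w j e.1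
  set K : ℝ := 1 + Fintype.card {e : FormalCommutator k // w.index e = j ∧ e.length ≤ n} * D
  have hK : 0 ≤ K := by positivity
  -- The constant is the multiplicity bound for `wordInv Q ++ L`, where `Q` spells the product of
  -- powers that is split off.
  obtain ⟨C₁, hC₁, H⟩ := mem_wordSet_succ S w hn hS j (A := 2 * C₀ * (A + 1) * K + A)
    (by positivity) hD
  refine ⟨max (max C₁ C₀) (C₀ * (A + 1) * K), by positivity,
    fun φ hφ t c p hgen htor g hg => ?_⟩
  obtain ⟨L, hLmem, hLb, rfl⟩ := wordSet_and_length_le hn hg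
  have hφ' := hφ.toIsMultiplicativeWeight
  set M := levelSize n j w.index φ
  have hM1 : 1 ≤ M := one_le_levelSize hφ
  -- Generators longer than `n` have class zero and can be dropped, which leaves a family taken from
  -- a finite set.
  have hspan : ∀ X : Set (FormalCommutator k), ∀ Y : Set (Additive (GradedPiece S w j)),
      (∀ x ∈ X, w.index x = j) → (∀ x ∈ X, x.length ≤ n → gradedClass S w j x ∈ Y) →
      ∀ e, w.index e = j → ∀ N : ℕ,
        e.eval S ^ N ∈ Subgroup.closure (eval S '' X) ⊔ weightFiltration S w (j + 1) →
        N • gradedClass S w j e ∈ Submodule.span ℤ Y := by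
    intro X Y hX hXY e he N heN
    have h1 := (smul_gradedClass_mem_span_iff S hS w j hX he.ge N).2 heN
    refine (Submodule.span_le.2 ?_ : Submodule.span ℤ (gradedClass S w j '' X) ≤ _) h1
    rintro _ ⟨x, hx, rfl⟩
    by_cases hxn : x.length ≤ n
    · exact Submodule.subset_span (hXY x hx hxn)
    · rw [gradedClass_eq_zero_of_notMem S w hS j (hX x hx).ge
        (fun ⟨e, he⟩ => hxn (he ▸ e.2.2)) hn]
      exact zero_mem _
  obtain ⟨z', hz', hzp, hzn, hze⟩ := hcoef
    {i : Fin t // w.index (c i) = j ∧ (c i).length ≤ n} inferInstance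
    (fun i => ⟨c i.1, i.2⟩) (fun i => p i.1)
    (fun e => by
      have := hspan {x | ∃ i, c i = x ∧ w.index (c i) = j} (range fun i :
        {i : Fin t // w.index (c i) = j ∧ (c i).length ≤ n} => gradedClass S w j (c i.1))
        (by rintro _ ⟨i, rfl, hi⟩; exact hi)
        (by rintro _ ⟨i, rfl, hi⟩ hin; exact ⟨⟨i, hi, hin⟩, rfl⟩) e.1 e.2.1 1
        (by rw [pow_one]; exact hgen e.1 e.2.1)
      rwa [one_nsmul] at this)
    (fun e => by
      obtain ⟨N, hN, heN⟩ := htor e.1 e.2.1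
      refine ⟨N, hN, hspan {x | ∃ i, p i ∧ c i = x ∧ w.index (c i) = j} _
        (by rintro _ ⟨i, _, rfl, hi⟩; exact hi) ?_ e.1 e.2.1 N heN⟩
      rintro _ ⟨i, hpi, rfl, hi⟩ hin
      exact ⟨⟨i, hi, hin⟩, hpi, rfl⟩)
    -- `A + 1` replaces `A` because the coefficient bound passed here has to be at least `1`.
    ((A + 1) * M) (by nlinarith) (fun e => (L.count e.1 : ℤ)) (fun e => by
      rw [Int.cast_natCast, abs_of_nonneg (Nat.cast_nonneg _)]
      have h1 := hLb e.1 e.2.2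
      have h2 := mul_le_mul_of_nonneg_left (le_levelSize hφ e) hA
      have h3 : (A + 1) * M = A * M + M := by ring
      linarith)
  set z : Fin t → ℤ := fun i =>
    if h : w.index (c i) = j ∧ (c i).length ≤ n then z' ⟨i, h⟩ else 0 with hz
  set f : Fin t → List (FormalCommutator k) := fun i =>
    if w.index (c i) = j ∧ (c i).length ≤ n then [c i] else [] with hf
  have hzκ : ∀ i : {i : Fin t // w.index (c i) = j ∧ (c i).length ≤ n}, z i.1 = z' i :=
    fun i => dif_pos i.2
  have hfκ : ∀ i : {i : Fin t // w.index (c i) = j ∧ (c i).length ≤ n}, f i.1 = [c i.1] :=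
    fun i => if_pos i.2
  have hz0 : ∀ i, ¬ (w.index (c i) = j ∧ (c i).length ≤ n) → z i = 0 := fun i hi => dif_neg hi
  have hfmem : ∀ i, ∀ x ∈ f i, w.index x = j ∧ x.length ≤ n := fun i x hx => by
    simp only [hf] at hx
    split at hx
    · rename_i h; rw [List.mem_singleton.1 hx]; exact h
    · simp at hx
  set Q := combWord (List.finRange t) f z with hQ
  have hQmem : ∀ x ∈ Q, w.index x = j ∧ x.length ≤ n :=
    forall_mem_combWord (P := fun c => w.index c = j ∧ c.length ≤ n)
      (fun c hc => by rwa [index_finv, length_finv]) fun i _ => hfmem i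
  have hQsum : wordSum (gradedClass S w j) Q = wordSum (gradedClass S w j) L := by
    rw [hQ, wordSum_combWord hψ, ← Fin.sum_univ_def, sum_eq_sum_subtype_of_support
      (fun i => w.index (c i) = j ∧ (c i).length ≤ n) _ fun i hi => by rw [hz0 i hi, zero_smul]]
    simp only [hzκ, hfκ, wordSum_cons, wordSum_nil, add_zero]
    rw [hz', wordSum_eq_sum_count (fun e :
      {e : FormalCommutator k // w.index e = j ∧ e.length ≤ n} => e.1) Subtype.val_injective]
    intro c hc hne
    by_contra h
    exact hne (gradedClass_eq_zero_of_notMem S w hS j (hLmem c hc).1 h hn)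
  -- The exponents at all entries equal to `x` are bounded together, so the multiplicity of `x` in
  -- `Q` does not depend on `t`.
  have hcnt : ∀ x, w.index x = j → x.length ≤ n →
      ∑ i, |(z i : ℝ)| * ((f i).count x : ℝ) ≤ C₀ * ((A + 1) * M) := by
    intro x hxj hxn
    rw [sum_eq_sum_subtype_of_support (fun i => w.index (c i) = j ∧ (c i).length ≤ n) _
      fun i hi => by rw [hz0 i hi, Int.cast_zero, abs_zero, zero_mul]]
    simp only [hzκ, hfκ]
    refine le_trans (le_of_eq ?_) (hze ⟨x, hxj, hxn⟩ (Finset.univ.filter fun i => c i.1 = x)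
      fun i hi => Subtype.ext (Finset.mem_filter.1 hi).2)
    rw [Finset.sum_filter]
    refine Finset.sum_congr rfl fun i _ => ?_
    by_cases h : c i.1 = x
    · simp [h]
    · simp [h]
  have hbd : ∀ x, j ≤ w.index x → x.length ≤ n → C₀ * ((A + 1) * M) ≤ C₀ * (A + 1) * K * φ x := by
    intro x hxj hxn
    have := mul_le_mul_of_nonneg_left (levelSize_le hφ hxj hxn) (by positivity : 0 ≤ C₀ * (A + 1))
    calc _ = C₀ * (A + 1) * M := by ring
      _ ≤ _ := this
      _ = _ := by ring
  have hQb : IsBounded n φ (2 * C₀ * (A + 1) * K) Q := by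
    intro x hxn
    have hx0 := zero_le_one.trans (hφ'.one_le x)
    by_cases hxj : w.index x = j
    · have h1 : (Q.count x : ℝ) ≤ (((List.finRange t).map fun i =>
          (z i).natAbs * ((f i).count x + (f i).count x.finv)).sum : ℕ) :=
        Nat.cast_le.2 (count_combWord_le x)
      rw [← Fin.sum_univ_def] at h1
      push_cast at h1
      have h2 := hcnt x hxj hxn
      have h3 := hcnt x.finv (by rwa [index_finv]) (by rwa [length_finv])
      have h4 := hbd x hxj.ge hxn
      simp only [Nat.cast_natAbs, Int.cast_abs, mul_add, Finset.sum_add_distrib] at h1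
      linarith
    · have : Q.count x = 0 := List.count_eq_zero.2 fun h => hxj (hQmem x h).1
      rw [this, Nat.cast_zero]
      positivity
  have hprod : evalList S Q = (List.ofFn fun i => (c i).eval S ^ z i).prod := by
    rw [hQ, evalList_combWord, List.ofFn_eq_map]
    congr 2
    funext i
    by_cases hi : w.index (c i) = j ∧ (c i).length ≤ n
    · simp [hf, hi]
    · simp [hz0 i hi]
  refine ⟨z, fun i hi => by_contra fun h => hi (hz0 i h), fun i hi => ?_, fun i hi => ?_,
    (evalList S Q)⁻¹ * evalList S L, ?_, by rw [← hprod, mul_inv_cancel_left]⟩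
  · have hi0 := zero_le_one.trans (hφ'.one_le (c i))
    by_cases h : w.index (c i) = j ∧ (c i).length ≤ n
    · rw [hzκ ⟨i, h⟩]
      exact ((hzp ⟨i, h⟩ hi).trans (hbd (c i) h.1.ge h.2)).trans
        (mul_le_mul_of_nonneg_right (le_max_right _ _) hi0)
    · rw [hz0 i h, Int.cast_zero, abs_zero]
      positivity
  · by_cases h : w.index (c i) = j ∧ (c i).length ≤ n
    · rw [hzκ ⟨i, h⟩]
      exact (hzn ⟨i, h⟩ hi).trans ((le_max_right _ _).trans (le_max_left _ _))
    · rw [hz0 i h, Int.cast_zero, abs_zero]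
      positivity
  · refine wordSet_mono hφ' (fun _ h => h) ((le_max_left _ _).trans (le_max_left _ _)) ?_
    have hmem : ∀ x ∈ wordInv Q ++ L, j ≤ w.index x := by
      intro x hx
      rcases List.mem_append.1 hx with h | h
      · rw [← index_finv]; exact (hQmem _ (mem_wordInv.1 h)).1.ge
      · exact (hLmem x h).1
    have hev : evalList S (wordInv Q ++ L) = (evalList S Q)⁻¹ * evalList S L := by
      rw [evalList_append, evalList_wordInv]
    rw [← hev]
    refine H φ hφ _ ⟨_, hmem, (hQb.wordInv hφ').append hLb, rfl⟩ ?_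
    rw [evalList_mem_weightFiltration_succ_iff S hS w j hmem, wordSum_append, wordSum_wordInv hψ,
      hQsum, neg_add_cancel]

/-- Products of powers with separated supports can be multiplied exponentwise. -/
theorem prod_ofFn_zpow_mul {t : ℕ} (a : Fin t → G) (x y : Fin t → ℤ)
    (h : ∀ i i', x i ≠ 0 → y i' ≠ 0 → i < i') :
    (List.ofFn fun i => a i ^ x i).prod * (List.ofFn fun i => a i ^ y i).prod =
      (List.ofFn fun i => a i ^ (x i + y i)).prod := by
  induction t with
  | zero => simp
  | succ t ih =>
    have ih := ih (fun i => a i.succ) (fun i => x i.succ) (fun i => y i.succ)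
      fun i i' hi hi' => by simpa using h _ _ hi hi'
    simp only [List.ofFn_succ, List.prod_cons]
    rw [← ih, zpow_add]
    by_cases hy : y 0 = 0
    · simp [hy, mul_assoc]
    · have hx : ∀ i, x i = 0 := fun i => by
        by_contra hi
        exact absurd (h i 0 hi hy) (Fin.not_lt_zero i)
      simp [hx]

/-- Bounded words in terms of an adapted family, uniformly over the families. -/
theorem exists_adapted_form (hn : ∀ c : FormalCommutator k, n < c.length → c.eval S = 1)
    (hS : Subgroup.closure (range S) = ⊤) {J : ℕ}
    (hJ : ∀ c : FormalCommutator k, J ≤ w.index c → c.eval S = 1) (s : ℕ) {D : ℝ} (hD : 0 ≤ D)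
    (j : ℕ) (hsj : J ≤ j + s) {A : ℝ} (hA : 0 ≤ A) :
    ∃ C : ℝ, 0 ≤ C ∧ ∀ φ, IsMonotoneWeight n w.index D φ →
      ∀ (t : ℕ) (c : Fin t → FormalCommutator k) (p : Fin t → Prop),
      Monotone (fun i => w.index (c i)) →
      (∀ e, j ≤ w.index e → e.eval S ∈ Subgroup.closure (eval S ''
        {x | ∃ i, c i = x ∧ w.index (c i) = w.index e}) ⊔ weightFiltration S w (w.index e + 1)) →
      (∀ e, j ≤ w.index e → ∃ N : ℕ, 1 ≤ N ∧ e.eval S ^ N ∈ Subgroup.closure (eval S ''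
        {x | ∃ i, p i ∧ c i = x ∧ w.index (c i) = w.index e}) ⊔
          weightFiltration S w (w.index e + 1)) →
      ∀ g ∈ wordSet S n φ (fun c => j ≤ w.index c) A,
        ∃ z : Fin t → ℤ, (∀ i, z i ≠ 0 → j ≤ w.index (c i) ∧ (c i).length ≤ n) ∧
          (∀ i, p i → |(z i : ℝ)| ≤ C * φ (c i)) ∧ (∀ i, ¬ p i → |(z i : ℝ)| ≤ C) ∧
            g = (List.ofFn fun i => (c i).eval S ^ z i).prod := by
  induction s generalizing j A with
  | zero =>
    refine ⟨0, le_rfl, fun φ _ t c p _ _ _ g hg => ⟨fun _ => 0, by simp, by simp, by simp, ?_⟩⟩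
    rw [eq_one_of_mem_wordSet (fun c (hc : j ≤ w.index c) => hJ c (by omega)) hg]
    simp
  | succ s ih =>
    obtain ⟨C, hC, H⟩ := exists_level_step S w hn hS j hA hD
    obtain ⟨C', hC', H'⟩ := ih (j + 1) (by omega) hC
    refine ⟨C + C', by positivity, fun φ hφ t c p hmono hgen htor g hg => ?_⟩
    obtain ⟨z, hz, hzp, hzn, h, hh, rfl⟩ := H φ hφ t c p
      (fun e he => by have := hgen e he.ge; rwa [he] at this)
      (fun e he => by have := htor e he.ge; rwa [he] at this) g hg
    obtain ⟨z', hz', hzp', hzn', rfl⟩ := H' φ hφ t c p hmono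
      (fun e he => hgen e (by omega)) (fun e he => htor e (by omega)) h hh
    refine ⟨fun i => z i + z' i, fun i hi => ?_, fun i hi => ?_, fun i hi => ?_,
      prod_ofFn_zpow_mul _ z z' fun i i' hi hi' => ?_⟩
    · by_cases h0 : z i = 0
      · have := hz' i (by simpa [h0] using hi)
        exact ⟨by omega, this.2⟩
      · exact ⟨(hz i h0).1.ge, (hz i h0).2⟩
    · push_cast
      rw [add_mul]
      exact (abs_add_le _ _).trans (add_le_add (hzp i hi) (hzp' i hi))
    · push_cast
      exact (abs_add_le _ _).trans (add_le_add (hzn i hi) (hzn' i hi))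
    -- The indices along the tuple are non-decreasing, so the entries used at level `j` precede
    -- those used at later levels.
    · by_contra hlt
      have h1 : w.index (c i') ≤ w.index (c i) := hmono (not_lt.1 hlt)
      have h2 := (hz i hi).1
      have h3 := (hz' i' hi').1
      omega

end Core

end FormalCommutator

/-! ### Uniform comparison of weight functions -/

namespace FormalCommutator

variable {G : Type*} [Group G] {k d : ℕ}

theorem exists_index_bound (S : Fin k → G) (w : WeightSystem k d) {n : ℕ}
    (hn : ∀ c : FormalCommutator k, n < c.length → c.eval S = 1) :
    ∃ J : ℕ, ∀ c : FormalCommutator k, J ≤ w.index c → c.eval S = 1 := by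
  obtain ⟨J, hJ⟩ := ((finite_length_le k n).image w.index).bddAbove
  refine ⟨J + 1, fun c hc => hn c ?_⟩
  by_contra h
  have : w.index c ≤ J := hJ ⟨c, not_lt.1 h, rfl⟩
  omega

/-- Sums the compatibility constants of the finitely many pairs of commutators of length at most
`n`, so `D` is independent of `r`. -/
theorem exists_isMonotoneWeight {F : WeightFunctionSystem k} {w : WeightSystem k d}
    (h : F.IsCompatible w) (n : ℕ) : ∃ D : ℝ, 0 ≤ D ∧ ∀ r : ℝ, 1 ≤ r →
      IsMonotoneWeight n w.index D fun c => F.weightFun c r := by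
  have key : ∀ q : FormalCommutator k × FormalCommutator k, ∃ C : ℝ, 0 ≤ C ∧
      (w.index q.1 ≤ w.index q.2 → ∀ r, 1 ≤ r → F.weightFun q.1 r ≤ C * F.weightFun q.2 r) := by
    intro q
    by_cases hq : w.index q.1 ≤ w.index q.2
    · obtain ⟨C, hC, H⟩ := (h q.1 q.2).1 ((w.index_le_index_iff _ _).1 hq)
      exact ⟨C, by linarith, fun _ => H⟩
    · exact ⟨0, le_rfl, fun hq' => absurd hq' hq⟩
  choose C hC0 hC using key
  set T := (finite_length_le k n).toFinset
  refine ⟨∑ q ∈ T ×ˢ T, C q, Finset.sum_nonneg fun q _ => hC0 q, fun r hr => ?_⟩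
  have hφ := isMultiplicativeWeight_weightFun F hr
  refine { hφ with le_mul := fun c c' hcc' hc hc' => ?_ }
  refine (hC (c, c') hcc' r hr).trans
    (mul_le_mul_of_nonneg_right ?_ (zero_le_one.trans (hφ.one_le c')))
  exact Finset.single_le_sum (f := C) (fun q _ => hC0 q)
    (Finset.mem_product.2 ⟨by simpa [T] using hc, by simpa [T] using hc'⟩)

section Comparable

variable {F : WeightFunctionSystem k}

theorem weightFun_le_weightFun (c : FormalCommutator k) {r s : ℝ} (hr : 1 ≤ r) (hrs : r ≤ s) :
    F.weightFun c r ≤ F.weightFun c s := by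
  induction c with
  | letter i b => exact F.monotoneOn i hr (hr.trans hrs) hrs
  | bracket a b ha hb =>
    exact mul_le_mul ha hb
      (zero_le_one.trans ((isMultiplicativeWeight_weightFun F hr).one_le b))
      (zero_le_one.trans ((isMultiplicativeWeight_weightFun F (hr.trans hrs)).one_le a))

theorem exists_weightFun_pow_mul_le (hF : F.IsRegular) (c : FormalCommutator k) :
    ∃ C : ℝ, 0 ≤ C ∧ ∀ (m : ℕ) (r : ℝ), 1 ≤ r →
      F.weightFun c (2 ^ m * r) ≤ C ^ m * F.weightFun c r := by
  obtain ⟨C₀, hC₀, H⟩ := hF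
  have key : ∃ C : ℝ, 0 ≤ C ∧ ∀ r : ℝ, 1 ≤ r → F.weightFun c (2 * r) ≤ C * F.weightFun c r := by
    induction c with
    | letter i b => exact ⟨C₀, by linarith, fun r hr => (H i r hr).2⟩
    | bracket a b ha hb =>
      obtain ⟨A, hA, HA⟩ := ha
      obtain ⟨B, hB, HB⟩ := hb
      refine ⟨A * B, by positivity, fun r hr => ?_⟩
      have h1 := zero_le_one.trans ((isMultiplicativeWeight_weightFun F hr).one_le a)
      have h2 := zero_le_one.trans
        ((isMultiplicativeWeight_weightFun F (by linarith : 1 ≤ 2 * r)).one_le b)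
      calc F.weightFun a (2 * r) * F.weightFun b (2 * r)
          ≤ (A * F.weightFun a r) * (B * F.weightFun b r) :=
            mul_le_mul (HA r hr) (HB r hr) h2 (by positivity)
        _ = A * B * (F.weightFun a r * F.weightFun b r) := by ring
  obtain ⟨C, hC, hCr⟩ := key
  refine ⟨C, hC, fun m => ?_⟩
  induction m with
  | zero => intro r _; simp
  | succ m ih =>
    intro r hr
    have h1 : (1 : ℝ) ≤ 2 ^ m * r := one_le_mul_of_one_le_of_one_le (one_le_pow₀ (by norm_num)) hr
    calc F.weightFun c (2 ^ (m + 1) * r) = F.weightFun c (2 * (2 ^ m * r)) := by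
          congr 1; ring
      _ ≤ C * F.weightFun c (2 ^ m * r) := hCr _ h1
      _ ≤ C * (C ^ m * F.weightFun c r) := mul_le_mul_of_nonneg_left (ih r hr) hC
      _ = C ^ (m + 1) * F.weightFun c r := by ring

/-- The relation `≃` allows a rescaling of the argument by `b`. Doubling absorbs it: `F_c(r) ≤ C^m
F_c(r / b) ≤ C^m a f(r)` once `2^m > b` and `r` is large. Small `r` are covered by monotonicity of
`F_c` and `f ≥ 1`. -/
theorem exists_weightFun_le_mul (hF : F.IsRegular) (c : FormalCommutator k) {f : ℝ → ℝ}
    (hf : ∀ r, 1 ≤ r → 1 ≤ f r) (hfc : IsComparable f (F.weightFun c)) :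
    ∃ E : ℝ, 0 ≤ E ∧ ∀ r : ℝ, 1 ≤ r → F.weightFun c r ≤ E * f r := by
  obtain ⟨_, _, a, b, _, _, ha, hb, hev⟩ := hfc
  obtain ⟨r₀, hr₀⟩ := eventually_atTop.1 hev
  obtain ⟨C, hC, H⟩ := exists_weightFun_pow_mul_le hF c
  obtain ⟨m, hm⟩ := pow_unbounded_of_one_lt b (one_lt_two (α := ℝ))
  -- Beyond `s` the point `r / b` lies in the range where the comparison holds and is at least `1`.
  set s := max (b * max r₀ 1) 1
  have hs0 := zero_le_one.trans
    ((isMultiplicativeWeight_weightFun F (le_max_right _ _ : 1 ≤ s)).one_le c)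
  refine ⟨C ^ m * a + F.weightFun c s, by positivity, fun r hr => ?_⟩
  have hfr := hf r hr
  have hCa : 0 ≤ C ^ m * a := by positivity
  rcases le_total r s with hrs | hrs
  · have := weightFun_le_weightFun (F := F) c hr hrs
    nlinarith
  · have h1 : max r₀ 1 ≤ r / b := by
      rw [le_div_iff₀ hb, mul_comm]
      exact (le_max_left _ _).trans hrs
    have h2 : 1 ≤ r / b := (le_max_right _ _).trans h1
    have h3 := (hr₀ (r / b) ((le_max_left _ _).trans h1)).2
    rw [mul_div_cancel₀ _ hb.ne'] at h3
    have h4 : r ≤ 2 ^ m * (r / b) := by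
      have : r = b * (r / b) := by field_simp
      nlinarith
    have h5 := (weightFun_le_weightFun (F := F) c hr h4).trans (H m (r / b) h2)
    have h6 : C ^ m * F.weightFun c (r / b) ≤ C ^ m * (a * f r) :=
      mul_le_mul_of_nonneg_left h3 (by positivity)
    nlinarith

theorem exists_weightFun_le_mul_of_length_le (hF : F.IsRegular) (w : WeightSystem k d) (n : ℕ)
    {f : ℕ → ℝ → ℝ} (hf : ∀ j r, 1 ≤ r → 1 ≤ f j r)
    (hfc : ∀ c : FormalCommutator k, IsComparable (f (w.index c)) (F.weightFun c)) :
    ∃ E : ℝ, 0 ≤ E ∧ ∀ c : FormalCommutator k, c.length ≤ n → ∀ r : ℝ, 1 ≤ r →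
      F.weightFun c r ≤ E * f (w.index c) r := by
  choose E hE0 hE using fun c => exists_weightFun_le_mul hF c (hf (w.index c)) (hfc c)
  refine ⟨∑ c ∈ (finite_length_le k n).toFinset, E c, Finset.sum_nonneg fun c _ => hE0 c,
    fun c hc r hr => (hE c r hr).trans (mul_le_mul_of_nonneg_right ?_
      (zero_le_one.trans (hf _ r hr)))⟩
  exact Finset.single_le_sum (f := E) (fun c _ => hE0 c) (by simpa using hc)

end Comparable

/-! ### Spanning properties of adapted tuples -/

section Adapted

variable {S : Fin k → G} {hS : Subgroup.closure (range S) = ⊤} {w : WeightSystem k d} {t : ℕ}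
  {c : Fin t → FormalCommutator k}

theorem monotone_index_of_isAdaptedTuple (h : IsAdaptedTuple S hS w c) :
    Monotone fun i => w.index (c i) := fun _ _ hij =>
  (w.index_le_index_iff _ _).2 (h.monotone_weight hij)

theorem eval_mem_sup_of_isAdaptedTuple (h : IsAdaptedTuple S hS w c) (e : FormalCommutator k) :
    e.eval S ∈ Subgroup.closure (eval S '' {x | ∃ i, c i = x ∧ w.index (c i) = w.index e}) ⊔
      weightFiltration S w (w.index e + 1) := by
  rw [h.generates _ (one_le_index w e)]
  exact eval_mem_weightFiltration S w le_rfl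

theorem le_index_of_blockStart_le (h : Monotone fun i => w.index (c i)) {j : ℕ} {i : Fin t}
    (hi : blockStart w c j ≤ i) : j ≤ w.index (c i) := by
  by_contra hlt
  have h1 : Finset.Iic i ⊆ Finset.univ.filter fun i => w.index (c i) < j := fun i' hi' => by
    rw [Finset.mem_Iic] at hi'
    have := h hi'
    simp only at this
    simp only [Finset.mem_filter, Finset.mem_univ, true_and]
    omega
  have h2 := Finset.card_le_card h1
  rw [Fin.card_Iic] at h2
  rw [blockStart] at hi
  omega

/-- An entry `i₀` of weight index `j` outside the free block has at least `R_j` positions of its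
block before it, and by monotonicity all of these have index `j`. -/
theorem torsionFreeRank_le_card (h : Monotone fun i => w.index (c i)) {j : ℕ} {i₀ : Fin t}
    (hi₀ : w.index (c i₀) = j) (hfree : ¬ InFreeBlock S hS w c i₀)
    [Fintype {i : Fin t // InFreeBlock S hS w c i ∧ w.index (c i) = j}] :
    torsionFreeRank S hS w j ≤
      Fintype.card {i : Fin t // InFreeBlock S hS w c i ∧ w.index (c i) = j} := by
  rw [InFreeBlock, hi₀, not_lt] at hfree
  have hlt : ∀ r : Fin (torsionFreeRank S hS w j), blockStart w c j + r < i₀ := fun r =>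
    (Nat.add_lt_add_left r.2 _).trans_le hfree
  have hidx : ∀ r : Fin (torsionFreeRank S hS w j),
      w.index (c ⟨blockStart w c j + r, (hlt r).trans i₀.2⟩) = j := fun r =>
    le_antisymm ((h (a := ⟨blockStart w c j + r, (hlt r).trans i₀.2⟩) (b := i₀)
      (Fin.le_def.2 (hlt r).le)).trans hi₀.le) (le_index_of_blockStart_le h (Nat.le_add_right _ _))
  have := Fintype.card_le_of_injective
    (fun r : Fin (torsionFreeRank S hS w j) =>
      (⟨⟨blockStart w c j + r, (hlt r).trans i₀.2⟩, by
        rw [InFreeBlock, hidx]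
        exact Nat.add_lt_add_left r.2 _, hidx r⟩ :
        {i : Fin t // InFreeBlock S hS w c i ∧ w.index (c i) = j}))
    fun r r' hrr => by
      simp only [Subtype.mk.injEq, Fin.mk.injEq] at hrr
      exact Fin.ext (by omega)
  simpa using this

/-- The free part of an adapted tuple generates a subgroup of finite exponent in each piece. -/
theorem exists_pow_mem_sup_of_isAdaptedTuple (h : IsAdaptedTuple S hS w c)
    (e : FormalCommutator k) : ∃ N : ℕ, 1 ≤ N ∧ e.eval S ^ N ∈ Subgroup.closure (eval S ''
      {x | ∃ i, InFreeBlock S hS w c i ∧ c i = x ∧ w.index (c i) = w.index e}) ⊔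
        weightFiltration S w (w.index e + 1) := by
  classical
  set j := w.index e with hj
  have hmem := eval_mem_sup_of_isAdaptedTuple h
  by_cases hall : ∀ i, w.index (c i) = j → InFreeBlock S hS w c i
  -- If every entry of the block counts as free, the free part already generates and `N = 1` works.
  · refine ⟨1, le_rfl, ?_⟩
    have hset : {x | ∃ i, InFreeBlock S hS w c i ∧ c i = x ∧ w.index (c i) = j} =
        {x | ∃ i, c i = x ∧ w.index (c i) = j} := by
      ext x
      exact ⟨fun ⟨i, _, h1, h2⟩ => ⟨i, h1, h2⟩, fun ⟨i, h1, h2⟩ => ⟨i, hall i h2, h1, h2⟩⟩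
    rw [pow_one, hset]
    exact hmem e
  · push Not at hall
    obtain ⟨i₀, hi₀, hfree⟩ := hall
    let := gradedPieceCommGroup S hS w j
    set X := {x | ∃ i, InFreeBlock S hS w c i ∧ c i = x ∧ w.index (c i) = j} with hX
    set Y := {x | ∃ i, c i = x ∧ w.index (c i) = j} with hY
    have hXj : ∀ x ∈ X, w.index x = j := by rintro _ ⟨i, _, rfl, hi⟩; exact hi
    have hYj : ∀ x ∈ Y, w.index x = j := by rintro _ ⟨i, rfl, hi⟩; exact hi
    have htop : Submodule.span ℤ (gradedClass S w j '' Y) = ⊤ := by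
      rw [eq_top_iff]
      rintro ⟨⟨g, hg⟩⟩ -
      obtain ⟨L, hL, rfl⟩ := (mem_weightFiltration_iff S w j g).1 hg
      obtain ⟨h', e'⟩ := exists_mk_evalList_eq S hS w j hL
      have hsum : wordSum (gradedClass S w j) L ∈ Submodule.span ℤ (gradedClass S w j '' Y) := by
        clear e' h' hg
        induction L with
        | nil => exact zero_mem _
        | cons x L ih =>
          rw [wordSum_cons]
          refine add_mem ?_ (ih fun y hy => hL y (List.mem_cons_of_mem _ hy))
          have hx := hL x List.mem_cons_self
          rcases hx.eq_or_lt with hxj | hxj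
          · have := (smul_gradedClass_mem_span_iff S hS w j hYj hx 1).2 (by
              have := hmem x
              rw [← hxj] at this
              rwa [pow_one])
            rwa [one_nsmul] at this
          · rw [gradedClass_eq_zero S hS w j hx (eval_mem_weightFiltration S w hxj)]
            exact zero_mem _
      rw [← e'] at hsum
      exact hsum
    have hYfin : Y.Finite := (Set.finite_range c).subset (by rintro _ ⟨i, rfl, _⟩; exact ⟨i, rfl⟩)
    have : Module.Finite ℤ (Additive (GradedPiece S w j)) :=
      ⟨Submodule.fg_def.2 ⟨_, hYfin.image _, htop⟩⟩
    set v := fun i : {i : Fin t // InFreeBlock S hS w c i ∧ w.index (c i) = j} =>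
      gradedClass S w j (c i.1) with hv
    have hlin : LinearIndependent ℤ v := by
      have h1 := h.free j (one_le_index w e)
      have h2 : v = fun i => (Additive.ofMul (QuotientGroup.mk
          ⟨(c i.1).eval S, eval_mem_weightFiltration S w i.2.2.ge⟩) :
            Additive (GradedPiece S w j)) := by
        funext i
        rw [hv]
        exact dif_pos i.2.2.ge
      rw [h2]
      exact h1
    have hrange : Submodule.span ℤ (range v) = Submodule.span ℤ (gradedClass S w j '' X) := by
      congr 1
      ext y
      constructor
      · rintro ⟨i, rfl⟩
        exact ⟨c i.1, ⟨i.1, i.2.1, rfl, i.2.2⟩, rfl⟩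
      · rintro ⟨_, ⟨i, hi, rfl, hij⟩, rfl⟩
        exact ⟨⟨i, hi, hij⟩, rfl⟩
    -- The free entries are independent and at least as many as the rank, so the quotient by their
    -- span has rank zero and every class in it is torsion.
    have hcard := torsionFreeRank_le_card (monotone_index_of_isAdaptedTuple h) hi₀ hfree
    have h1 := finrank_span_eq_card hlin
    have h2 := Submodule.finrank_quotient_add_finrank (Submodule.span ℤ (range v))
    have h3 : torsionFreeRank S hS w j = Module.finrank ℤ (Additive (GradedPiece S w j)) := rfl
    have h4 : Module.finrank ℤ
        (Additive (GradedPiece S w j) ⧸ Submodule.span ℤ (range v)) = 0 := by omega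
    obtain ⟨a, ha, hae⟩ := Module.finrank_eq_zero_iff.1 h4
      (Submodule.Quotient.mk (gradedClass S w j e))
    rw [← Submodule.Quotient.mk_smul, Submodule.Quotient.mk_eq_zero, hrange] at hae
    refine ⟨a.natAbs, Int.natAbs_pos.2 ha, ?_⟩
    refine (smul_gradedClass_mem_span_iff S hS w j hXj le_rfl _).1 ?_
    rw [← natCast_zsmul]
    rcases Int.natAbs_eq a with h5 | h5
    · rwa [← h5]
    · have h6 : ((a.natAbs : ℕ) : ℤ) = -a := by omega
      rw [h6, neg_smul]
      exact neg_mem hae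

end Adapted

theorem weightFiltration_congr (S : Fin k → G) {d' : ℕ} {w : WeightSystem k d}
    {w' : WeightSystem k d'} (h : w.index = w'.index) (j : ℕ) :
    weightFiltration S w j = weightFiltration S w' j := by
  rw [weightFiltration, weightFiltration, h]

end FormalCommutator

/-! ### Proof of the theorem -/

open FormalCommutator

theorem mainTheorem9 {G : Type*} [Group G] [Group.IsNilpotent G] {k : ℕ} (S : Fin k → G)
    (hS : Subgroup.closure (Set.range S) = ⊤) (F : WeightFunctionSystem k) (hF : F.IsRegular) :
    (∀ bF : ℕ → ℝ → ℝ, (∀ j r, 1 ≤ r → 1 ≤ bF j r) →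
      ∃ C : ℝ, 0 < C ∧
        ∀ (d : ℕ) (w : WeightSystem k d), F.IsCompatible w →
          (∀ c : FormalCommutator k, IsComparable (bF (w.index c)) (F.weightFun c)) →
          ∀ (t : ℕ) (c : Fin t → FormalCommutator k), IsAdaptedTuple S hS w c →
            ∀ r : ℝ, 1 ≤ r → ∀ g : G, IsExpressible S F r g →
              ∃ x : Fin t → ℤ,
                g = (List.ofFn fun i => (c i).eval S ^ x i).prod ∧
                ∀ i, (InFreeBlock S hS w c i → |(x i : ℝ)| ≤ C * bF (w.index (c i)) r) ∧
                  (¬ InFreeBlock S hS w c i → |(x i : ℝ)| ≤ C)) ∧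
    (∃ (p : ℕ) (s : Fin p → Fin k) (C : ℝ), 0 < C ∧
      ∀ (d : ℕ) (w : WeightSystem k d), F.IsCompatible w →
        ∀ r : ℝ, 1 ≤ r → ∀ g : G, IsExpressible S F r g →
          ∃ x : Fin p → ℤ,
            g = (List.ofFn fun j => S (s j) ^ x j).prod ∧
            ∀ j, |(x j : ℝ)| ≤ C * F.letterFun (s j) r) := by
  obtain ⟨n, hn⟩ := exists_eval_eq_one S
  refine ⟨fun bF hbF => ?_, ?_⟩
  -- All constants are computed from one admissible weight system `w₀`. They serve every other one,
  -- since the index is the same. If there is none, the claim is vacuous.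
  · by_cases hex : ∃ (d : ℕ) (w : WeightSystem k d), F.IsCompatible w ∧
      ∀ c : FormalCommutator k, IsComparable (bF (w.index c)) (F.weightFun c)
    · obtain ⟨d₀, w₀, hw₀, hbF₀⟩ := hex
      obtain ⟨J, hJ⟩ := exists_index_bound S w₀ hn
      obtain ⟨D, hD, hφ⟩ := exists_isMonotoneWeight hw₀ n
      obtain ⟨E, hE, hEF⟩ := exists_weightFun_le_mul_of_length_le hF w₀ n hbF hbF₀
      -- Starting at level `0`, below all indices, `J` steps reach the levels where all commutators
      -- are trivial in `G`.
      obtain ⟨C, hC, H⟩ := exists_adapted_form S w₀ hn hS hJ J hD 0 (by omega)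
        (A := 2) (by norm_num)
      refine ⟨C * E + C + 1, by positivity, fun d w hw _ t c hc r hr g hg => ?_⟩
      have hidx : w₀.index = w.index := index_eq_of_isCompatible hw₀ hw
      obtain ⟨x, hx, hxp, hxn, hgx⟩ := H _ (hφ r hr) t c (InFreeBlock S hS w c)
        (by rw [hidx]; exact monotone_index_of_isAdaptedTuple hc)
        (fun e _ => by
          rw [weightFiltration_congr S hidx, hidx]
          exact eval_mem_sup_of_isAdaptedTuple hc e)
        (fun e _ => by
          rw [weightFiltration_congr S hidx, hidx]
          exact exists_pow_mem_sup_of_isAdaptedTuple hc e) g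
        (wordSet_mono (isMultiplicativeWeight_weightFun F hr) (fun _ _ => Nat.zero_le _) le_rfl
          (mem_wordSet_of_isExpressible hr hg))
      refine ⟨x, hgx, fun i => ⟨fun hi => ?_, fun hi => ?_⟩⟩
      · have hb := hbF (w.index (c i)) r hr
        -- The comparison constant `E` covers only commutators of length at most `n`. Entries with
        -- nonzero exponent are of this kind.
        by_cases h0 : x i = 0
        · rw [h0, Int.cast_zero, abs_zero]
          positivity
        · have h1 := hEF (c i) (hx i h0).2 r hr
          rw [hidx] at h1
          have h2 := mul_le_mul_of_nonneg_left h1 hC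
          have h3 := hxp i hi
          nlinarith
      · have := hxn i hi
        nlinarith [mul_nonneg hC hE]
    · exact ⟨1, one_pos, fun d w hw hbw => absurd ⟨d, w, hw, hbw⟩ hex⟩
  · obtain ⟨s, C, hC, H⟩ := exists_letterPowers S hn F (A := 2) (by norm_num)
    refine ⟨s.length, s.get, C + 1, by positivity, fun d w _ r hr g hg => ?_⟩
    obtain ⟨x, hgx, hx⟩ := exists_exponents_of_mem_letterPowers
      (H r hr g (mem_wordSet_of_isExpressible hr hg))
    exact ⟨x, hgx, fun j => (hx j).trans (mul_le_mul_of_nonneg_right (by linarith)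
      (letterFun_nonneg F hr _))⟩
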